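/- **Conventions.** Everything is over $\mathbb C$. For a vector space $W$, $W((x))$ is the space of lower truncated Laurent series and $W((x_1,x_2))=W[[x_1,x_2]][x_1^{-1},x_2^{-1}]$; $\mathbb C_*((x_1,x_2))$ is the field of fractions of $\mathbb C((x_1,x_2))$, and $\iota_{x_2,x_1}$ is its canonical embedding into $\mathbb C((x_2))((x_1))$. Binomials are expanded in nonnegative powers of the second variable. Fix $0\ne p(x)\in\mathbb C((x))$ and put $\phi(x,z)=e^{zp(x)\frac{d}{dx}}x\in\mathbb C((x))[[z]]$. For $A\in W((x_1,x_2))$, $A|_{x_1=\phi(x_2,z)}\in W((x_2))[[z]]$ is the result of substitution; for $F=f/g\in\mathbb C_*((x_1,x_2))$ with $f,g\in\mathbb C((x_1,x_2))$, $F(\phi(x,z),x)=f(\phi(x,z),x)/g(\phi(x,z),x)\in\mathbb C((x))((z))$. Let $\mathbb C_\phi((x_1,x_2))$ be the set of $F\in\mathbb C_*((x_1,x_2))$ with $p(x_1)\partial_{x_1}F=-p(x_2)\partial_{x_2}F$. The map $\pi_\phi(F)=F(\phi(x,z),x)$ is an injective linear map from $\mathbb C_\phi((x_1,x_2))$ to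 $\mathbb C((z))$; its image is denoted $\mathbb C_\phi((z))$. Let $G$ be a group with linear characters $\chi,\chi_\phi:G\to\mathbb C^\times$ such that $\phi(x,\chi(g)z)=\chi_\phi(g)\phi(\chi_\phi(g)^{-1}x,z)$ for $g\in G$. Let $\mathbb C_{\chi_\phi(G)}[x]$ be the multiplicative monoid generated by the polynomials $x-\chi_\phi(g)$, $g\in G$. **Nonlocal vertex algebras.** A *nonlocal vertex algebra* is a vector space $V$ with a linear map $Y(\cdot,x):V\to\mathrm{Hom}(V,V((x)))$ and $\mathbf 1\in V$ such that $Y(\mathbf 1,x)=1$, $Y(v,x)\mathbf 1\in V[[x]]$ has constant term $v$, and for all $u,v\in V$ there is $k\in\mathbb N$ with $(x_1-x_2)^kY(u,x_1)Y(v,x_2)\in\mathrm{Hom}(V,V((x_1,x_2)))$ and $$\big((x_1-x_2)^kY(u,x_1)Y(v,x_2)\big)|_{x_1=x_2+x_0}=x_0^kY(Y(u,x_0)v,x_2).$$ A *module* $(W,Y_W)$ is given by $Y_W(\cdot,x):V\to\mathrm{Hom}(W,W((x)))$ with $Y_W(\mathbf 1,x)=1$ and the same two conditions on $Y_W(u,x_1)Y_W(v,x_2)$.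 A *$(G,\chi)$-module nonlocal vertex algebra* carries a representation $R$ of $G$ with $R(g)\mathbf 1=\mathbf 1$ and $R(g)Y(v,x)R(g)^{-1}=Y(R(g)v,\chi(g)x)$. A *$(G,\chi)$-module nonlocal vertex bialgebra* is a $(G,\chi)$-module nonlocal vertex algebra $H$ with a coalgebra structure $(\Delta,\varepsilon)$ such that $\Delta$ and $\varepsilon$ are homomorphisms of nonlocal vertex algebras and $G$ acts by coalgebra automorphisms. We write $\Delta(h)=\sum h_{(1)}\otimes h_{(2)}$. A *$\phi$-compatible $H$-module nonlocal vertex algebra* is a nonlocal vertex algebra $V$ with a module structure $Y_V^H$ on $V$ for the nonlocal vertex algebra $H$ such that, for $h\in H$, $u,v\in V$: $Y_V^H(h,x)v\in V\otimes\mathbb C((x))$; $Y_V^H(h,x)\mathbf 1=\varepsilon(h)\mathbf 1$; $Y_V^H(h,x_1)Y(u,x_2)v=\sum Y(Y_V^H(h_{(1)},x_1-x_2)u,x_2)Y_V^H(h_{(2)},x_1)v$; $Y_V^H(h,z)v\in V\otimes\mathbb C_\phi((z))$; and, with $\widehat Y_V^H(h,x_1,x_2)v=(1\otimes\pi_\phi^{-1})Y_V^H(h,z)v$,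 there is $q\in\mathbb C_{\chi_\phi(G)}[x]$ with $q(x_2/x_1)\widehat Y_V^H(h,x_1,x_2)v\in V\otimes\mathbb C((x_1,x_2))$. **Quasi modules.** For a $(G,\chi)$-module nonlocal vertex algebra $(V,R)$, a *$(G,\chi_\phi)$-equivariant $\phi$-coordinated quasi $V$-module* is a vector space $W$ with a linear map $Y_W(\cdot,x):V\to\mathrm{Hom}(W,W((x)))$ such that $Y_W(\mathbf 1,x)=1$; for all $u,v\in V$ there is $0\ne f\in\mathbb C((x_1,x_2))$ with $f(x_1,x_2)Y_W(u,x_1)Y_W(v,x_2)\in\mathrm{Hom}(W,W((x_1,x_2)))$ and $$\big(f(x_1,x_2)Y_W(u,x_1)Y_W(v,x_2)\big)|_{x_1=\phi(x_2,z)}=f(\phi(x_2,z),x_2)Y_W(Y(u,z)v,x_2);$$ $Y_W(R(g)v,x)=Y_W(v,\chi_\phi(g)^{-1}x)$ for $g\in G$, $v\in V$; and for all $u,v\in V$ there is $q\in\mathbb C_{\chi_\phi(G)}[x]$ with $q(x_1/x_2)Y_W(u,x_1)Y_W(v,x_2)\in\mathrm{Hom}(W,W((x_1,x_2)))$. If $H$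 is a $(G,\chi)$-module nonlocal vertex bialgebra and $V$ is both a $(G,\chi)$-module nonlocal vertex algebra and a $\phi$-compatible $H$-module nonlocal vertex algebra, a *$(G,\chi_\phi)$-equivariant $\phi$-coordinated quasi $(H,V)$-module* is a vector space $W$ with $(G,\chi_\phi)$-equivariant $\phi$-coordinated quasi module structures $Y_W^H$ for $H$ and $Y_W^V$ for $V$ such that, for $h\in H$, $v\in V$, $w\in W$, $Y_W^H(h,x)w\in W\otimes\mathbb C((x))$ and $$Y_W^H(h,x_1)Y_W^V(v,x_2)=\sum Y_W^V\big(\iota_{x_2,x_1}\widehat Y_V^H(h_{(1)},x_1,x_2)v,x_2\big)Y_W^H(h_{(2)},x_1).$$ **Theorem.** Let $(H,R_H)$ be a $(G,\chi)$-module nonlocal vertex bialgebra, let $V$ be a $(G,\chi)$-module nonlocal vertex algebra $(V,R_V)$ that is also a $\phi$-compatible $H$-module nonlocal vertex algebra $(V,Y_V^H)$, with $$R_V(g)Y_V^H(h,x)v=Y_V^H(R_H(g)h,\chi(g)x)R_V(g)v\qquad(g\in G,\ h\in H,\ v\in V),$$ and let $(W,Y_W^H,Y_W^V)$ be a $(G,\chi_\phi)$-equivariant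 $\phi$-coordinated quasi $(H,V)$-module. Let $V\sharp H=V\otimes H$ with vacuum $\mathbf 1\otimes\mathbf 1$ and $$Y^\sharp(u\otimes h,x)(v\otimes k)=\sum Y(u,x)Y_V^H(h_{(1)},x)v\otimes Y(h_{(2)},x)k .$$ Then $V\sharp H$ with $R_V\otimes R_H$ is a $(G,\chi)$-module nonlocal vertex algebra, and $$Y_W^\sharp(v\otimes h,x)=Y_W^V(v,x)Y_W^H(h,x)\qquad(v\in V,\ h\in H)$$ makes $W$ a $(G,\chi_\phi)$-equivariant $\phi$-coordinated quasi $V\sharp H$-module. -/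

import Mathlib

open scoped TensorProduct

noncomputable section

namespace PhiCoord

universe u

/-! ### Formal series -/

/-- `Lau W` is the space `W((x))` of lower truncated formal Laurent series with coefficients in `W`;
`Lau (Lau W)` is `W((x))((y))`, the inner variable being `x` and the outer one `y`. -/
abbrev Lau (W : Type u) [Zero W] : Type u := LaurentSeries W

/-- The field `ℂ((x))((y))` (inner variable `x`, outer variable `y`). -/
def LL : Type := Lau (Lau ℂ)

instance : Field LL := inferInstanceAs (Field (Lau (Lau ℂ)))

instance : Module ℂ LL := inferInstanceAs (Module ℂ (Lau (Lau ℂ)))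

/-- The identification of `Lau (Lau ℂ)` with the field `LL`. -/
def toLL : Lau (Lau ℂ) ≃ₗ[ℂ] LL := LinearEquiv.refl ℂ _

/-- The coefficient of `y ^ i * x ^ j` in a series from `ℂ((x))((y))` (outer variable `y`). -/
def LL.coeff (F : LL) (i j : ℤ) : ℂ := ((toLL.symm F).coeff i).coeff j

theorem LL.ext {F G : LL} (h : ∀ i j, F.coeff i j = G.coeff i j) : F = G :=
  HahnSeries.ext (funext fun i => HahnSeries.ext (funext fun j => h i j))

/-- The ring `ℂ((x₁, x₂)) = ℂ[[x₁, x₂]][x₁⁻¹, x₂⁻¹]`: series whose support in `ℤ × ℤ` (with the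
product order) is partially well-ordered, that is, bounded below in both exponents
(see `isPWO_iff_boundedBelow`). -/
abbrev Lau2 : Type := HahnSeries (ℤ × ℤ) ℂ

/-- The field `ℂ_*((x₁, x₂))` of fractions of `ℂ((x₁, x₂))`. -/
abbrev Frac2 : Type := FractionRing Lau2

/-- The space `W[[x₁^{±1}, x₂^{±1}]]` of all doubly infinite formal series in two variables;
`A (m, n)` is the coefficient of `x₁ ^ m * x₂ ^ n`. -/
abbrev Ser2 (W : Type u) : Type u := ℤ × ℤ → W

theorem isPWO_iff_boundedBelow (S : Set (ℤ × ℤ)) :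
    S.IsPWO ↔ ∃ N : ℤ, ∀ a ∈ S, N ≤ a.1 ∧ N ≤ a.2 := by
  constructor
  · intro h
    rcases S.eq_empty_or_nonempty with rfl | hne
    · exact ⟨0, by simp⟩
    have h1 : (Prod.fst '' S).IsWF := (h.image_of_monotone monotone_fst).isWF
    have h2 : (Prod.snd '' S).IsWF := (h.image_of_monotone monotone_snd).isWF
    exact ⟨min (h1.min (hne.image _)) (h2.min (hne.image _)), fun c hc =>
      ⟨(min_le_left _ _).trans (h1.min_le (hne.image _) ⟨c, hc, rfl⟩),
      (min_le_right _ _).trans (h2.min_le (hne.image _) ⟨c, hc, rfl⟩)⟩⟩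
  · rintro ⟨N, hN⟩
    have hI : (Set.Ici N).IsPWO := (BddBelow.isWF bddBelow_Ici).isPWO
    exact (hI.prod hI).mono fun a ha => ⟨(hN a ha).1, (hN a ha).2⟩

section Series

variable {W : Type u}

/-- `A(x₁, x₂)` lies in `W((x₁, x₂))`. -/
def IsLau2 [Zero W] (A : Ser2 W) : Prop :=
  ∃ N : ℤ, ∀ a, A a ≠ 0 → N ≤ a.1 ∧ N ≤ a.2

variable [AddCommGroup W] [Module ℂ W]

/-- The product of a scalar series and a vector valued series in the same two variables. It is used
only where every coefficient of the product is a finite sum. -/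
def fmul (f : Ser2 ℂ) (A : Ser2 W) : Ser2 W :=
  fun a => ∑ᶠ b : ℤ × ℤ, f b • A (a - b)

/-- The substitution `A(x₁, x₂) ↦ A(φ(x, z), x)` for `A ∈ W((x₁, x₂))`, where `φ` is a series in
`ℂ((x))[[z]] ⊆ ℂ((x))((z))` with `φ(x, 0) = x`:
the monomial `x₁ ^ i * x₂ ^ j` is replaced by `φ(x, z) ^ i * x ^ j`.
The result is in the variables `(z, x)`: its value at `(k, n)` is the coefficient of
`z ^ k * x ^ n`. -/
def subst (φ : LL) (A : Ser2 W) : Ser2 W :=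
  fun a => ∑ᶠ b : ℤ × ℤ, (φ ^ b.1).coeff a.1 (a.2 - b.2) • A b

end Series

/-- The formal series `x + z`, as an element of `ℂ((x))((z))`. -/
def addPhi : LL :=
  toLL (HahnSeries.single 0 (HahnSeries.single 1 1) +
    HahnSeries.single 1 (HahnSeries.single 0 1))

/-- The formal series `φ(x, z) = e^{z p(x) d/dx} x = ∑ₖ zᵏ/k! (p(x) d/dx)ᵏ x`. -/
def phi (p : Lau ℂ) : LL :=
  toLL (HahnSeries.ofPowerSeries ℤ (Lau ℂ) (PowerSeries.mk fun k =>
    ((k.factorial : ℂ)⁻¹) •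
      (fun g : Lau ℂ => p * LaurentSeries.derivative ℂ g)^[k] (HahnSeries.single 1 1)))

/-! ### Products of Laurent series in one variable -/

section Conv

variable {A B C : Type*} [AddCommGroup A] [Module ℂ A] [AddCommGroup B] [Module ℂ B]
  [AddCommGroup C] [Module ℂ C]

theorem conv_finite (β : A →ₗ[ℂ] B →ₗ[ℂ] C) (f : Lau A) (g : Lau B) (n : ℤ) :
    (Function.support fun i : ℤ => β (f.coeff i) (g.coeff (n - i))).Finite := by
  refine (Set.finite_Icc f.order (n - g.order)).subset fun i hi => ?_
  simp only [Function.mem_support] at hi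
  refine ⟨?_, ?_⟩
  · by_contra h
    exact hi (by rw [HahnSeries.coeff_eq_zero_of_lt_order (not_le.mp h)]; simp)
  · by_contra h
    exact hi (by rw [HahnSeries.coeff_eq_zero_of_lt_order (i := n - i) (by lia)]; simp)

theorem conv_bddBelow (β : A →ₗ[ℂ] B →ₗ[ℂ] C) (f : Lau A) (g : Lau B) :
    BddBelow (Function.support fun n : ℤ => ∑ᶠ i : ℤ, β (f.coeff i) (g.coeff (n - i))) := by
  refine ⟨f.order + g.order, fun n hn => ?_⟩
  by_contra h
  refine hn (finsum_eq_zero_of_forall_eq_zero fun i => ?_)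
  by_cases hi : i < f.order
  · rw [HahnSeries.coeff_eq_zero_of_lt_order hi]; simp
  · rw [HahnSeries.coeff_eq_zero_of_lt_order (i := n - i) (by lia)]; simp

/-- The product `f(x) g(x)` of two Laurent series, coefficients being multiplied by `β`. -/
def conv (β : A →ₗ[ℂ] B →ₗ[ℂ] C) : Lau A →ₗ[ℂ] Lau B →ₗ[ℂ] Lau C :=
  LinearMap.mk₂ ℂ
    (fun f g => HahnSeries.ofSuppBddBelow
      (fun n => ∑ᶠ i : ℤ, β (f.coeff i) (g.coeff (n - i))) (conv_bddBelow β f g))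
    (fun f f' g => by
      ext n
      simp only [HahnSeries.ofSuppBddBelow, HahnSeries.coeff_add', Pi.add_apply, map_add,
        LinearMap.add_apply]
      exact finsum_add_distrib (conv_finite β f g n) (conv_finite β f' g n))
    (fun c f g => by
      ext n
      simp only [HahnSeries.ofSuppBddBelow, HahnSeries.coeff_smul, map_smul,
        LinearMap.smul_apply]
      exact (smul_finsum c _).symm)
    (fun f g g' => by
      ext n
      simp only [HahnSeries.ofSuppBddBelow, HahnSeries.coeff_add', Pi.add_apply, map_add]
      exact finsum_add_distrib (conv_finite β f g n) (conv_finite β f g' n))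
    (fun c f g => by
      ext n
      simp only [HahnSeries.ofSuppBddBelow, HahnSeries.coeff_smul, map_smul]
      exact (smul_finsum c _).symm)

theorem conv_coeff (β : A →ₗ[ℂ] B →ₗ[ℂ] C) (f : Lau A) (g : Lau B) (n : ℤ) :
    (conv β f g).coeff n = ∑ᶠ i : ℤ, β (f.coeff i) (g.coeff (n - i)) := rfl

end Conv

section OneVariable

variable {U V W X F G : Type*} [AddCommGroup U] [Module ℂ U] [AddCommGroup V] [Module ℂ V]
  [AddCommGroup W] [Module ℂ W] [AddCommGroup X] [Module ℂ X] [AddCommGroup F] [Module ℂ F]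
  [AddCommGroup G] [Module ℂ G]

/-- The constant series, as a linear map `W → W((x))`. -/
def constL : W →ₗ[ℂ] Lau W where
  toFun w := HahnSeries.single 0 w
  map_add' := by simp
  map_smul' c w := by
    ext n
    by_cases h : n = 0 <;> simp [h]

/-- The product of a scalar Laurent series and a vector valued Laurent series. -/
def smulL : Lau ℂ →ₗ[ℂ] Lau W →ₗ[ℂ] Lau W := conv (LinearMap.lsmul ℂ W)

/-- The canonical embedding `W ⊗ ℂ((x)) → W((x))`, `w ⊗ f(x) ↦ f(x) w`. -/
def toLau : W ⊗[ℂ] Lau ℂ →ₗ[ℂ] Lau W :=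
  TensorProduct.lift ((smulL (W := W)).flip ∘ₗ constL)

/-- The vertex operator map `Y(·, x) : U → Hom(W, W ⊗ ℂ((x)))`, regarded as a map into
`Hom(W, W((x)))`. -/
def toOp (Y : U →ₗ[ℂ] W →ₗ[ℂ] W ⊗[ℂ] Lau ℂ) : U →ₗ[ℂ] W →ₗ[ℂ] Lau W :=
  Y.compr₂ toLau

/-- The extension of `Y(u, x) : W → X((x))` to `W ⊗ ℂ((x)) → X((x))`,
`w ⊗ f(x) ↦ f(x) Y(u, x) w`. -/
def extL (Y : U →ₗ[ℂ] W →ₗ[ℂ] Lau X) : U →ₗ[ℂ] W ⊗[ℂ] Lau ℂ →ₗ[ℂ] Lau X :=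
  (TensorProduct.lift.equiv (.id ℂ) W (Lau ℂ) (Lau X)).toLinearMap ∘ₗ
    Y.compr₂ (smulL (W := X)).flip

theorem extL_tmul (Y : U →ₗ[ℂ] W →ₗ[ℂ] Lau X) (y : U) (w : W) (f : Lau ℂ) :
    extL Y y (w ⊗ₜ f) = smulL f (Y y w) := rfl

/-- The product `Y₁(u, x) Y₂(v, x)` in one and the same variable, where
`Y₂(v, x) w ∈ W ⊗ ℂ((x))`. -/
def compOp (Y₁ : U →ₗ[ℂ] W →ₗ[ℂ] Lau X) (Y₂ : V →ₗ[ℂ] G →ₗ[ℂ] W ⊗[ℂ] Lau ℂ) :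
    U ⊗[ℂ] V →ₗ[ℂ] G →ₗ[ℂ] Lau X :=
  TensorProduct.lift
    (((LinearMap.llcomp ℂ G (W ⊗[ℂ] Lau ℂ) (Lau X)) ∘ₗ extL Y₁).compl₂ Y₂)

theorem compOp_tmul (Y₁ : U →ₗ[ℂ] W →ₗ[ℂ] Lau X) (Y₂ : V →ₗ[ℂ] G →ₗ[ℂ] W ⊗[ℂ] Lau ℂ)
    (y : U) (y' : V) (w : G) : compOp Y₁ Y₂ (y ⊗ₜ y') w = extL Y₁ y (Y₂ y' w) := rfl

/-- Tensor product of two vertex operator maps: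
`(u ⊗ v, w ⊗ w') ↦ Y₁(u, x) w ⊗ Y₂(v, x) w'`. -/
def tensorOp (Y₁ : U →ₗ[ℂ] W →ₗ[ℂ] Lau X) (Y₂ : V →ₗ[ℂ] G →ₗ[ℂ] Lau F) :
    U ⊗[ℂ] V →ₗ[ℂ] W ⊗[ℂ] G →ₗ[ℂ] Lau (X ⊗[ℂ] F) :=
  TensorProduct.curry
    (TensorProduct.lift (conv (TensorProduct.mk ℂ X F)) ∘ₗ
      TensorProduct.map (TensorProduct.lift Y₁) (TensorProduct.lift Y₂) ∘ₗ
      (TensorProduct.tensorTensorTensorComm ℂ U V W G).toLinearMap)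

theorem tensorOp_tmul (Y₁ : U →ₗ[ℂ] W →ₗ[ℂ] Lau X) (Y₂ : V →ₗ[ℂ] G →ₗ[ℂ] Lau F)
    (y : U) (y' : V) (w : W) (g : G) :
    tensorOp Y₁ Y₂ (y ⊗ₜ y') (w ⊗ₜ g) = conv (TensorProduct.mk ℂ X F) (Y₁ y w) (Y₂ y' g) := rfl

/-- Given `Y(·, x₂) : U → Hom(W, X((x₂)))`, a bilinear map `S` from `F × G` to a space of scalar
series in `x₁, x₂`, and a product `π` of such series with elements of `X((x₂))`,
this is the map `(u ⊗ f, w ⊗ g) ↦ S(f, g) Y(u, x₂) w`. -/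
def twistOp (Y : U →ₗ[ℂ] W →ₗ[ℂ] Lau X) (S : F →ₗ[ℂ] G →ₗ[ℂ] LL)
    (π : LL →ₗ[ℂ] Lau X →ₗ[ℂ] Lau (Lau X)) :
    (U ⊗[ℂ] F) ⊗[ℂ] (W ⊗[ℂ] G) →ₗ[ℂ] Lau (Lau X) :=
  TensorProduct.lift π.flip ∘ₗ
    TensorProduct.map (TensorProduct.lift Y) (TensorProduct.lift S) ∘ₗ
    (TensorProduct.tensorTensorTensorComm ℂ U F W G).toLinearMap

theorem twistOp_tmul (Y : U →ₗ[ℂ] W →ₗ[ℂ] Lau X) (S : F →ₗ[ℂ] G →ₗ[ℂ] LL)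
    (π : LL →ₗ[ℂ] Lau X →ₗ[ℂ] Lau (Lau X)) (y : U) (f : F) (w : W) (g : G) :
    twistOp Y S π ((y ⊗ₜ f) ⊗ₜ (w ⊗ₜ g)) = π (S f g) (Y y w) := rfl

/-- The product `ℂ((x₁))((x₂)) × X((x₂)) → X((x₁))((x₂))`. -/
def mulOuter : LL →ₗ[ℂ] Lau X →ₗ[ℂ] Lau (Lau X) :=
  conv ((smulL (W := X)).compl₂ constL) ∘ₗ toLL.symm.toLinearMap

/-- The product `ℂ((x₂))((x₁)) × X((x₂)) → X((x₂))((x₁))`. -/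
def mulInner : LL →ₗ[ℂ] Lau X →ₗ[ℂ] Lau (Lau X) :=
  (conv (smulL (W := X))).compl₂ constL ∘ₗ toLL.symm.toLinearMap

end OneVariable

theorem LL.smul_eq (c : ℂ) (F : LL) :
    c • F = toLL (HahnSeries.single 0 (HahnSeries.single 0 c)) * F := by
  have h : ∀ f : Lau (Lau ℂ), c • f = HahnSeries.C (HahnSeries.C c) * f := fun f => by
    ext; simp
  exact h F

instance : IsScalarTower ℂ LL LL :=
  ⟨fun c F G => by
    rw [smul_eq_mul, smul_eq_mul, LL.smul_eq, LL.smul_eq c (F * G), mul_assoc]⟩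

instance : SMulCommClass ℂ LL LL :=
  ⟨fun c F G => by
    rw [smul_eq_mul, smul_eq_mul, LL.smul_eq, LL.smul_eq, mul_left_comm]⟩

/-- `g(y)` as an element of `ℂ((x))((y))`. -/
def inOuter : Lau ℂ →ₗ[ℂ] LL where
  toFun g := toLL (g.map (HahnSeries.C : ℂ →+* Lau ℂ))
  map_add' f g := by rw [← map_add]; congr 1; ext; simp
  map_smul' c g := by
    refine LL.ext fun i j => ?_
    simp only [LL.coeff, map_smul, LinearEquiv.symm_apply_apply, RingHom.id_apply]
    by_cases hj : j = 0 <;> simp [hj]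

/-- `g(x)` as an element of `ℂ((x))((y))`. -/
def inInner : Lau ℂ →ₗ[ℂ] LL := toLL.toLinearMap ∘ₗ constL

/-- `f(x₁ - x₂) = ∑ₖ (-x₂)ᵏ f⁽ᵏ⁾(x₁) / k!` as an element of `ℂ((x₁))((x₂))`. -/
def subShift : Lau ℂ →ₗ[ℂ] LL where
  toFun f := toLL (HahnSeries.ofPowerSeries ℤ (Lau ℂ)
    (PowerSeries.mk fun k => ((-1 : ℂ) ^ k) • LaurentSeries.hasseDeriv ℂ k f))
  map_add' f g := by
    rw [← map_add, ← map_add]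
    congr 2
    ext k : 1
    simp
  map_smul' c f := by
    have : (PowerSeries.mk fun k => ((-1 : ℂ) ^ k) • LaurentSeries.hasseDeriv ℂ k (c • f)) =
        PowerSeries.C (HahnSeries.C c) *
          (PowerSeries.mk fun k => ((-1 : ℂ) ^ k) • LaurentSeries.hasseDeriv ℂ k f) := by
      ext k : 1
      simp only [PowerSeries.coeff_mk, PowerSeries.coeff_C_mul, map_smul, HahnSeries.C_mul_eq_smul]
      rw [smul_comm]
    rw [this, map_mul, HahnSeries.ofPowerSeries_C, RingHom.id_apply, LL.smul_eq]
    rfl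

/-- `(f, g) ↦ f(x₁ - x₂) g(x₁) ∈ ℂ((x₁))((x₂))`. -/
def subKernel : Lau ℂ →ₗ[ℂ] Lau ℂ →ₗ[ℂ] LL :=
  LinearMap.mk₂ ℂ (fun f g => subShift f * inInner g)
    (fun f f' g => by rw [map_add, add_mul])
    (fun c f g => by rw [map_smul, smul_mul_assoc])
    (fun f g g' => by rw [map_add, mul_add])
    (fun c f g => by rw [map_smul, mul_smul_comm])

/-! ### The ring `ℂ((x₁, x₂))` and its field of fractions -/

theorem mul_coeff_finsum {Γ R : Type*} [AddCommGroup Γ] [PartialOrder Γ]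
    [IsOrderedCancelAddMonoid Γ] [CommRing R] (f g : HahnSeries Γ R) (a : Γ) :
    (Function.support fun b => f.coeff b * g.coeff (a - b)).Finite ∧
    (f * g).coeff a = ∑ᶠ b, f.coeff b * g.coeff (a - b) := by
  classical
  set s := Finset.antidiagonal f.isPWO_support g.isPWO_support a with hs
  have hsub : (Function.support fun b => f.coeff b * g.coeff (a - b)) ⊆
      (s.image Prod.fst : Finset Γ) := by
    intro b hb
    have hb' : f.coeff b * g.coeff (a - b) ≠ 0 := hb
    rw [Finset.mem_coe, Finset.mem_image]
    refine ⟨(b, a - b), ?_, rfl⟩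
    rw [hs, Finset.mem_antidiagonal]
    exact ⟨left_ne_zero_of_mul hb', right_ne_zero_of_mul hb', by simp⟩
  refine ⟨(Finset.finite_toSet _).subset hsub, ?_⟩
  rw [finsum_eq_sum_of_support_subset _ hsub, HahnSeries.coeff_mul, Finset.sum_image]
  · refine Finset.sum_congr rfl fun ij hij => ?_
    rw [Finset.mem_antidiagonal] at hij
    rw [← hij.2.2, add_sub_cancel_left]
  · intro x hx y hy hxy
    rw [Finset.mem_coe, hs, Finset.mem_antidiagonal] at hx hy
    refine Prod.ext hxy (add_left_cancel (a := x.1) ?_)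
    rw [hx.2.2, hxy, hy.2.2]

theorem Lau2.bdd (f : Lau2) : ∃ N : ℤ, ∀ a, f.coeff a ≠ 0 → N ≤ a.1 ∧ N ≤ a.2 :=
  (isPWO_iff_boundedBelow _).1 f.isPWO_support

/-- The expansion `ι_{x₂,x₁} : ℂ((x₁, x₂)) → ℂ((x₂))((x₁))` (the outer variable is `x₁`). -/
def expand (f : Lau2) : LL :=
  toLL (HahnSeries.ofSuppBddBelow
    (fun m => (HahnSeries.ofSuppBddBelow (fun n => f.coeff (m, n)) (by
      obtain ⟨N, hN⟩ := f.bdd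
      exact ⟨N, fun n hn => (hN _ hn).2⟩) : Lau ℂ)) (by
    obtain ⟨N, hN⟩ := f.bdd
    refine ⟨N, fun m hm => ?_⟩
    by_contra h
    refine hm ?_
    ext n
    by_contra h'
    exact h (hN (m, n) h').1))

theorem expand_coeff (f : Lau2) (m n : ℤ) : (expand f).coeff m n = f.coeff (m, n) := rfl

theorem LL.mul_coeff (F G : LL) (m n : ℤ) :
    (F * G).coeff m n = ∑ᶠ i, ∑ᶠ j, F.coeff i j * G.coeff (m - i) (n - j) := by
  obtain ⟨h1, h2⟩ := mul_coeff_finsum (toLL.symm F) (toLL.symm G) m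
  have h3 := map_finsum (HahnSeries.coeff.addMonoidHom (R := ℂ) n) h1
  have h4 : (F * G).coeff m n = HahnSeries.coeff.addMonoidHom (R := ℂ) n
      (∑ᶠ i, (toLL.symm F).coeff i * (toLL.symm G).coeff (m - i)) := by
    rw [← h2]; rfl
  rw [h4]
  refine h3.trans (finsum_congr fun i => ?_)
  exact (mul_coeff_finsum ((toLL.symm F).coeff i) ((toLL.symm G).coeff (m - i)) n).2

theorem expand_mul (f g : Lau2) : expand (f * g) = expand f * expand g := by
  refine LL.ext fun m n => ?_
  rw [expand_coeff, (mul_coeff_finsum f g _).2, LL.mul_coeff,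
    finsum_curry _ (mul_coeff_finsum f g _).1]
  rfl

theorem expand_injective : Function.Injective expand := by
  intro f g h
  ext a
  exact congrArg (fun F : LL => F.coeff a.1 a.2) h

/-- `expand` as a ring homomorphism. -/
def expandHom : Lau2 →+* LL where
  toFun := expand
  map_one' := by
    refine LL.ext fun m n => ?_
    rw [expand_coeff, HahnSeries.coeff_one]
    change _ = ((1 : Lau (Lau ℂ)).coeff m).coeff n
    rw [HahnSeries.coeff_one]
    by_cases hm : m = 0 <;> simp [hm, HahnSeries.coeff_one]
  map_mul' := expand_mul
  map_zero' := by refine LL.ext fun m n => ?_; rw [expand_coeff]; rfl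
  map_add' f g := by refine LL.ext fun m n => ?_; rw [expand_coeff]; rfl

theorem expandHom_injective : Function.Injective expandHom := expand_injective

instance : IsDomain Lau2 := expandHom_injective.isDomain expandHom

/-- The embedding `ι_{x₂,x₁}` of the field `ℂ_*((x₁, x₂))` into `ℂ((x₂))((x₁))`. -/
def iota : Frac2 →+* LL := IsFractionRing.lift (A := Lau2) expandHom_injective

theorem iota_smul (c : ℂ) (F : Frac2) : iota (c • F) = c • iota F := by
  rw [Algebra.smul_def, map_mul, LL.smul_eq]
  congr 1
  have : algebraMap ℂ Frac2 c = algebraMap Lau2 Frac2 (HahnSeries.C c) := rfl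
  rw [this, iota, IsFractionRing.lift_algebraMap]
  refine LL.ext fun m n => ?_
  change (HahnSeries.C c : Lau2).coeff (m, n) =
    ((HahnSeries.single 0 (HahnSeries.single 0 c) : Lau (Lau ℂ)).coeff m).coeff n
  by_cases hm : m = 0 <;> by_cases hn : n = 0 <;>
    simp [hm, hn, HahnSeries.C_apply, HahnSeries.coeff_single]

/-- `f(x₁)` as an element of `ℂ((x₁, x₂))`. -/
def inFst : Lau ℂ →+* Lau2 :=
  HahnSeries.embDomainRingHom (AddMonoidHom.inl ℤ ℤ) (fun a b h => (Prod.ext_iff.1 h).1)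
    (fun a b => by simp)

/-- `f(x₂)` as an element of `ℂ((x₁, x₂))`. -/
def inSnd : Lau ℂ →+* Lau2 :=
  HahnSeries.embDomainRingHom (AddMonoidHom.inr ℤ ℤ) (fun a b h => (Prod.ext_iff.1 h).2)
    (fun a b => by simp)

/-- The partial derivative `∂/∂x₁` on `ℂ((x₁, x₂))`. -/
def pderiv₁ (f : Lau2) : Lau2 where
  coeff a := ((a.1 + 1 : ℤ) : ℂ) * f.coeff (a.1 + 1, a.2)
  isPWO_support' := by
    obtain ⟨N, hN⟩ := f.bdd
    refine (isPWO_iff_boundedBelow _).2 ⟨N - 1, fun a ha => ?_⟩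
    have := hN _ (right_ne_zero_of_mul ha)
    exact ⟨by linarith [this.1], by linarith [this.2]⟩

/-- The partial derivative `∂/∂x₂` on `ℂ((x₁, x₂))`. -/
def pderiv₂ (f : Lau2) : Lau2 where
  coeff a := ((a.2 + 1 : ℤ) : ℂ) * f.coeff (a.1, a.2 + 1)
  isPWO_support' := by
    obtain ⟨N, hN⟩ := f.bdd
    refine (isPWO_iff_boundedBelow _).2 ⟨N - 1, fun a ha => ?_⟩
    have := hN _ (right_ne_zero_of_mul ha)
    exact ⟨by linarith [this.1], by linarith [this.2]⟩

/-- The derivation `p(x₁) ∂/∂x₁ + p(x₂) ∂/∂x₂` of `ℂ((x₁, x₂))`. -/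
def phiDer (p : Lau ℂ) (f : Lau2) : Lau2 :=
  inFst p * pderiv₁ f + inSnd p * pderiv₂ f

/-! ### The algebra `ℂ_φ((x₁, x₂))` and the map `π_φ` -/

/-- `ℂ_φ((x₁, x₂))`: the set of `F ∈ ℂ_*((x₁, x₂))` with
`p(x₁) ∂F/∂x₁ = - p(x₂) ∂F/∂x₂`. For `F = f / g` this says `D(f) g = f D(g)` with
`D = p(x₁) ∂/∂x₁ + p(x₂) ∂/∂x₂`, by the quotient rule. -/
def Cphi (p : Lau ℂ) : Set Frac2 :=
  {F | ∃ f g : Lau2, g ≠ 0 ∧ F * algebraMap Lau2 Frac2 g = algebraMap Lau2 Frac2 f ∧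
    phiDer p f * g = f * phiDer p g}

/-- The series `e(z) ∈ ℂ((z))`, viewed as a series in the variables `(z, x)`. -/
def inZ (e : Lau ℂ) : Ser2 ℂ := fun a => if a.2 = 0 then e.coeff a.1 else 0

/-- For `F ∈ ℂ_*((x₁, x₂))` and `e ∈ ℂ((z))`: the relation `F(φ(x, z), x) = e(z)` in
`ℂ((x))((z))`. For `F = f / g` it says `f(φ(x, z), x) = e(z) g(φ(x, z), x)`. -/
def PhiValue (p : Lau ℂ) (F : Frac2) (e : Lau ℂ) : Prop :=
  ∃ f g : Lau2, g ≠ 0 ∧ F * algebraMap Lau2 Frac2 g = algebraMap Lau2 Frac2 f ∧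
    subst (phi p) f.coeff = fmul (inZ e) (subst (phi p) g.coeff)

/-- The graph `{(F, π_φ(F))}` of `π_φ : ℂ_φ((x₁, x₂)) → ℂ((z))`, `π_φ(F) = F(φ(x, z), x)`.
(The set is a linear subspace, so that taking the span does not enlarge it.) -/
def piGraph (p : Lau ℂ) : Submodule ℂ (Frac2 × Lau ℂ) :=
  Submodule.span ℂ {P | P.1 ∈ Cphi p ∧ PhiValue p P.1 P.2}

/-- `ℂ_φ((z)) = π_φ(ℂ_φ((x₁, x₂))) ⊆ ℂ((z))`. -/
def CphiZ (p : Lau ℂ) : Submodule ℂ (Lau ℂ) := (piGraph p).map (LinearMap.snd ℂ Frac2 (Lau ℂ))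

/-- The projection `(F, π_φ(F)) ↦ π_φ(F)` of the graph of `π_φ`; it is injective as `π_φ` is. -/
def graphSnd (p : Lau ℂ) : piGraph p →ₗ[ℂ] Lau ℂ :=
  LinearMap.snd ℂ Frac2 (Lau ℂ) ∘ₗ (piGraph p).subtype

/-- The inverse `π_φ⁻¹ : ℂ_φ((z)) → ℂ_φ((x₁, x₂))` of the injective map `π_φ`, extended to a
linear map on all of `ℂ((z))` (it is only used on `ℂ_φ((z))`). -/
def piInv (p : Lau ℂ) : Lau ℂ →ₗ[ℂ] Frac2 :=
  LinearMap.fst ℂ Frac2 (Lau ℂ) ∘ₗ (piGraph p).subtype ∘ₗ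
    LinearMap.leftInverse (K := ℂ) (V := piGraph p) (V' := Lau ℂ) (graphSnd p)

/-- `(F, g) ↦ ι_{x₂,x₁}(F(x₁, x₂)) g(x₁) ∈ ℂ((x₂))((x₁))`. -/
def iotaKernel : Frac2 →ₗ[ℂ] Lau ℂ →ₗ[ℂ] LL :=
  LinearMap.mk₂ ℂ (fun F g => iota F * inOuter g)
    (fun f f' g => by rw [map_add, add_mul])
    (fun c f g => by rw [iota_smul, smul_mul_assoc])
    (fun f g g' => by rw [map_add, mul_add])
    (fun c f g => by rw [map_smul, mul_smul_comm])

/-- `ℂ_Γ[x]`: the multiplicative monoid generated by the polynomials `x - γ`, `γ ∈ Γ`. -/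
def rootMonoid (Γ : Subgroup ℂˣ) : Submonoid (Polynomial ℂ) :=
  Submonoid.closure {q | ∃ γ ∈ Γ, q = Polynomial.X - Polynomial.C (γ : ℂ)}

/-- `q(x₁ / x₂) ∈ ℂ((x₁, x₂))`. -/
def evalFstDivSnd (q : Polynomial ℂ) : Lau2 :=
  q.eval₂ HahnSeries.C (HahnSeries.single (1, -1) 1)

/-- `q(x₂ / x₁) ∈ ℂ((x₁, x₂))`. -/
def evalSndDivFst (q : Polynomial ℂ) : Lau2 :=
  q.eval₂ HahnSeries.C (HahnSeries.single (-1, 1) 1)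

/-! ### Nonlocal vertex algebras and their modules -/

/-- A vertex operator map `Y(·, x) : V → Hom(V, V((x)))` and a vacuum vector. The coefficient of
`x ^ n` in `Y(u, x) v` is `(Y u v).coeff n`. -/
structure VOps (V : Type u) [AddCommGroup V] [Module ℂ V] where
  Y : V →ₗ[ℂ] V →ₗ[ℂ] Lau V
  vac : V

section Modules

variable {V : Type*} [AddCommGroup V] [Module ℂ V] {W : Type*} [AddCommGroup W] [Module ℂ W]
  {U : Type*} [AddCommGroup U] [Module ℂ U]

/-- The series `Y₁(u, x₁) Y₂(v, x₂) w`. -/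
def prodSer (Y₁ : U →ₗ[ℂ] W →ₗ[ℂ] Lau W) (Y₂ : V →ₗ[ℂ] W →ₗ[ℂ] Lau W) (u : U) (v : V) (w : W) :
    Ser2 W :=
  fun a => (Y₁ u ((Y₂ v w).coeff a.2)).coeff a.1

/-- The series `Y_W(Y(u, z) v, x) w` in the variables `(z, x)`. -/
def iterSer (Y : V →ₗ[ℂ] V →ₗ[ℂ] Lau V) (YW : V →ₗ[ℂ] W →ₗ[ℂ] Lau W) (u v : V) (w : W) :
    Ser2 W :=
  fun a => (YW ((Y u v).coeff a.1) w).coeff a.2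

/-- A module `(W, Y_W)` for a nonlocal vertex algebra: `Y_W(1, x) = 1` and for all `u, v` there is
`k` with `(x₁ - x₂)^k Y_W(u, x₁) Y_W(v, x₂) ∈ Hom(W, W((x₁, x₂)))` and
`((x₁ - x₂)^k Y_W(u, x₁) Y_W(v, x₂))|_{x₁ = x₂ + x₀} = x₀^k Y_W(Y(u, x₀) v, x₂)`. -/
structure IsModule (A : VOps V) (YW : V →ₗ[ℂ] W →ₗ[ℂ] Lau W) : Prop where
  vacuum : ∀ w, YW A.vac w = HahnSeries.single 0 w
  assoc : ∀ u v, ∃ k : ℕ, ∀ w,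
    let B := fmul ((HahnSeries.single (1, 0) 1 - HahnSeries.single (0, 1) 1 : Lau2) ^ k).coeff
      (prodSer YW YW u v w)
    IsLau2 B ∧ ∀ i j : ℤ, subst addPhi B (i, j) = iterSer A.Y YW u v w (i - k, j)

/-- Nonlocal vertex algebras: the vacuum acts as the identity, the creation property holds, and
the vertex operators satisfy the compatibility and associativity conditions. -/
structure IsNVA (A : VOps V) : Prop where
  isModule : IsModule A A.Y
  creation_neg : ∀ v, ∀ n < 0, (A.Y v A.vac).coeff n = 0
  creation_zero : ∀ v, (A.Y v A.vac).coeff 0 = v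

/-- `φ`-coordinated quasi modules, where `φ(x, z) = e^{z p(x) d/dx} x`. -/
structure IsPhiQuasiModule (p : Lau ℂ) (A : VOps V) (YW : V →ₗ[ℂ] W →ₗ[ℂ] Lau W) : Prop where
  vacuum : ∀ w, YW A.vac w = HahnSeries.single 0 w
  assoc : ∀ u v, ∃ f : Lau2, f ≠ 0 ∧ ∀ w,
    let B := fmul f.coeff (prodSer YW YW u v w)
    IsLau2 B ∧
      subst (phi p) B = fmul (subst (phi p) f.coeff) (iterSer A.Y YW u v w)

/-- Homomorphisms of nonlocal vertex algebras. -/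
structure IsHom (A : VOps V) (B : VOps W) (f : V →ₗ[ℂ] W) : Prop where
  map_vac : f A.vac = B.vac
  map_Y : ∀ u v n, f ((A.Y u v).coeff n) = (B.Y (f u) (f v)).coeff n

/-- The field `ℂ` as a nonlocal vertex algebra. -/
def scalarOps : VOps ℂ where
  Y := (LinearMap.mul ℂ ℂ).compr₂ constL
  vac := 1

/-- The tensor product of two nonlocal vertex algebras. -/
def tensorOps (A : VOps V) (B : VOps W) : VOps (V ⊗[ℂ] W) where
  Y := tensorOp A.Y B.Y
  vac := A.vac ⊗ₜ B.vac

variable {G : Type*} [Group G]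

/-- `(G, χ)`-module nonlocal vertex algebras: `R(g) 1 = 1` and
`R(g) Y(v, x) R(g)⁻¹ = Y(R(g) v, χ(g) x)`. -/
structure IsGNVA (χ : G →* ℂˣ) (A : VOps V) (R : Representation ℂ G V) : Prop extends IsNVA A where
  map_vac : ∀ g, R g A.vac = A.vac
  conj : ∀ g v w n, R g ((A.Y v (R g⁻¹ w)).coeff n) = (χ g : ℂ) ^ n • (A.Y (R g v) w).coeff n

/-- The compatibility `φ(x, χ(g) z) = χ_φ(g) φ(χ_φ(g)⁻¹ x, z)` of the two characters. -/
def CharCompatible (p : Lau ℂ) (χ χφ : G →* ℂˣ) : Prop :=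
  ∀ g, ∀ k n : ℤ, (χ g : ℂ) ^ k * (phi p).coeff k n =
    (χφ g : ℂ) * (((χφ g : ℂ)⁻¹) ^ n * (phi p).coeff k n)

/-- `(G, χ_φ)`-equivariant `φ`-coordinated quasi modules for a `(G, χ)`-module nonlocal vertex
algebra. -/
structure IsEquivPhiQuasiModule (p : Lau ℂ) (χφ : G →* ℂˣ) (A : VOps V) (R : Representation ℂ G V)
    (YW : V →ₗ[ℂ] W →ₗ[ℂ] Lau W) : Prop extends IsPhiQuasiModule p A YW where
  equivariant : ∀ g v w n, (YW (R g v) w).coeff n = ((χφ g : ℂ)⁻¹) ^ n • (YW v w).coeff n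
  quasi : ∀ u v, ∃ q ∈ rootMonoid χφ.range, ∀ w,
    IsLau2 (fmul (evalFstDivSnd q).coeff (prodSer YW YW u v w))

end Modules

/-! ### Nonlocal vertex bialgebras, smash products -/

section Bialgebra

variable {H : Type*} [AddCommGroup H] [Module ℂ H] [Coalgebra ℂ H]
  {V : Type*} [AddCommGroup V] [Module ℂ V] {W : Type*} [AddCommGroup W] [Module ℂ W]
  {G : Type*} [Group G]

/-- `(G, χ)`-module nonlocal vertex bialgebras. -/
structure IsGBialgebra (χ : G →* ℂˣ) (A : VOps H) (R : Representation ℂ G H) : Prop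
    extends IsGNVA χ A R where
  comul_hom : IsHom A (tensorOps A A) Coalgebra.comul
  counit_hom : IsHom A scalarOps Coalgebra.counit
  comul_equivariant : ∀ g, Coalgebra.comul ∘ₗ R g =
    TensorProduct.map (R g) (R g) ∘ₗ (Coalgebra.comul : H →ₗ[ℂ] H ⊗[ℂ] H)
  counit_equivariant : ∀ g, Coalgebra.counit ∘ₗ R g = (Coalgebra.counit : H →ₗ[ℂ] ℂ)

/-- `H`-module nonlocal vertex algebras. The condition `Y_V^H(h, x) v ∈ V ⊗ ℂ((x))` is built into
the type of `YVH`. The last condition is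
`Y_V^H(h, x₁) Y(u, x₂) v = ∑ Y(Y_V^H(h₍₁₎, x₁ - x₂) u, x₂) Y_V^H(h₍₂₎, x₁) v`. -/
structure IsModuleNVA (AH : VOps H) (AV : VOps V) (YVH : H →ₗ[ℂ] V →ₗ[ℂ] V ⊗[ℂ] Lau ℂ) : Prop
    extends IsNVA AV where
  isModule_H : IsModule AH (toOp YVH)
  act_vac : ∀ h, YVH h AV.vac = Coalgebra.counit (R := ℂ) h • (AV.vac ⊗ₜ 1)
  act_Y : ∀ h u v, ∀ m n : ℤ, prodSer (toOp YVH) AV.Y h u v (m, n) =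
    ((twistOp AV.Y subKernel mulOuter
      (TensorProduct.map (YVH.flip u) (YVH.flip v) (Coalgebra.comul (R := ℂ) h))).coeff n).coeff m

/-- `Ŷ_V^H(h, x₁, x₂) v = (1 ⊗ π_φ⁻¹) Y_V^H(h, x) v`. -/
def hatY (p : Lau ℂ) (YVH : H →ₗ[ℂ] V →ₗ[ℂ] V ⊗[ℂ] Lau ℂ) : H →ₗ[ℂ] V →ₗ[ℂ] V ⊗[ℂ] Frac2 :=
  YVH.compr₂ (LinearMap.lTensor V (piInv p))

/-- The inclusion `ℂ((x₁, x₂)) → ℂ_*((x₁, x₂))` as a linear map. -/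
def fracIncl : Lau2 →ₗ[ℂ] Frac2 where
  toFun := algebraMap Lau2 Frac2
  map_add' := map_add _
  map_smul' c f := by
    rw [Algebra.smul_def, ← HahnSeries.C_mul_eq_smul, map_mul]; rfl

/-- `φ`-compatible `H`-module nonlocal vertex algebras, for a `(G, χ)`-module nonlocal vertex
bialgebra `H`: `Y_V^H(h, z) v ∈ V ⊗ ℂ_φ((z))`, and for all `h, v` there is
`q(x) ∈ ℂ_{χ_φ(G)}[x]` with `q(x₂ / x₁) Ŷ_V^H(h, x₁, x₂) v ∈ V ⊗ ℂ((x₁, x₂))`. -/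
structure IsPhiCompatible (p : Lau ℂ) (χφ : G →* ℂˣ) (AH : VOps H) (AV : VOps V)
    (YVH : H →ₗ[ℂ] V →ₗ[ℂ] V ⊗[ℂ] Lau ℂ) : Prop extends IsModuleNVA AH AV YVH where
  mem_CphiZ : ∀ h v, YVH h v ∈ LinearMap.range (LinearMap.lTensor V (CphiZ p).subtype)
  quasi : ∀ h v, ∃ q ∈ rootMonoid χφ.range,
    LinearMap.lTensor V (LinearMap.mulLeft ℂ (algebraMap Lau2 Frac2 (evalSndDivFst q)))
      (hatY p YVH h v) ∈ LinearMap.range (LinearMap.lTensor V fracIncl)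

/-- `(G, χ_φ)`-equivariant `φ`-coordinated quasi `(H, V)`-modules. The condition
`Y_W^H(h, x) w ∈ W ⊗ ℂ((x))` is built into the type of `YWH`. The last condition is
`Y_W^H(h, x₁) Y_W^V(v, x₂) = ∑ Y_W^V(ι_{x₂,x₁} Ŷ_V^H(h₍₁₎, x₁, x₂) v, x₂) Y_W^H(h₍₂₎, x₁)`. -/
structure IsEquivPhiQuasiHVModule (p : Lau ℂ) (χφ : G →* ℂˣ) (AH : VOps H)
    (RH : Representation ℂ G H) (AV : VOps V) (RV : Representation ℂ G V)
    (YVH : H →ₗ[ℂ] V →ₗ[ℂ] V ⊗[ℂ] Lau ℂ) (YWH : H →ₗ[ℂ] W →ₗ[ℂ] W ⊗[ℂ] Lau ℂ)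
    (YWV : V →ₗ[ℂ] W →ₗ[ℂ] Lau W) : Prop where
  module_H : IsEquivPhiQuasiModule p χφ AH RH (toOp YWH)
  module_V : IsEquivPhiQuasiModule p χφ AV RV YWV
  act_Y : ∀ h v w, ∀ m n : ℤ, prodSer (toOp YWH) YWV h v w (m, n) =
    ((twistOp YWV iotaKernel mulInner
      (TensorProduct.map ((hatY p YVH).flip v) (YWH.flip w)
        (Coalgebra.comul (R := ℂ) h))).coeff m).coeff n

/-- The smash product `V ♯ H = V ⊗ H`:
`Y^♯(u ⊗ h, x)(v ⊗ k) = ∑ Y(u, x) Y_V^H(h₍₁₎, x) v ⊗ Y(h₍₂₎, x) k`. -/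
def smash (AV : VOps V) (AH : VOps H) (YVH : H →ₗ[ℂ] V →ₗ[ℂ] V ⊗[ℂ] Lau ℂ) :
    VOps (V ⊗[ℂ] H) where
  Y := tensorOp (compOp AV.Y YVH) AH.Y ∘ₗ (TensorProduct.assoc ℂ V H H).symm.toLinearMap ∘ₗ
    LinearMap.lTensor V Coalgebra.comul
  vac := AV.vac ⊗ₜ AH.vac

theorem smash_tmul (AV : VOps V) (AH : VOps H) (YVH : H →ₗ[ℂ] V →ₗ[ℂ] V ⊗[ℂ] Lau ℂ)
    (u v : V) (h k : H) {ι : Type*} (r : Coalgebra.Repr ℂ h ι) :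
    (smash AV AH YVH).Y (u ⊗ₜ h) (v ⊗ₜ k) = ∑ i ∈ r.index,
      conv (TensorProduct.mk ℂ V H) (extL AV.Y u (YVH (r.left i) v)) (AH.Y (r.right i) k) := by
  simp [smash, ← r.eq, TensorProduct.tmul_sum, tensorOp_tmul, compOp_tmul]

/-- `Y_W^♯(v ⊗ h, x) = Y_W^V(v, x) Y_W^H(h, x)`. -/
def sharp (YWV : V →ₗ[ℂ] W →ₗ[ℂ] Lau W) (YWH : H →ₗ[ℂ] W →ₗ[ℂ] W ⊗[ℂ] Lau ℂ) :
    V ⊗[ℂ] H →ₗ[ℂ] W →ₗ[ℂ] Lau W :=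
  compOp YWV YWH

end Bialgebra

end PhiCoord

end

open scoped TensorProduct

noncomputable section

namespace PhiCoord

/-! ### Calculus of products of Laurent series -/

/-! Let `Y` and `E` be the actions of V and H on W, and `D` the action of H on V. A product of two
sharp operators is Y(u,x₁)E(h,x₁)Y(v,x₂)E(k,x₂). The commutation relation moves E(h,x₁) to the right
of Y(v,x₂) at the cost of scalars in x₁, x₂. After denominators are cleared, what remains is a
finite sum of terms F(x₁,x₂) Y(u,x₁)Y(v',x₂) E(h',x₁)E(k,x₂). Associativity of `Y` and of `E`
applies to the two halves separately, because substitution is multiplicative (`subst_convSer`). The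
values F(φ(x,z),x) are, up to the cleared denominator, the coefficients of ∑ D(h₍₁₎,z)v ⊗ h₍₂₎, so
the result is the sharp operator of the smash product Y♯(u⊗h,z)(v⊗k). This is `assoc_sharp`, whose
core is `substRel_twist`.

Since `E` takes values in W ⊗ ℂ((x)), the one-variable product Y(u,x)E(h,x) is defined, and
E(h,x₁)E(k,x₂)w lies in W ⊗ ℂ((x₁,x₂)) without any denominator. Identities known only in W((x)) are
lifted to W ⊗ ℂ((x)) through the injection `toLau`. That π_φ can be inverted rests on
`substL_injective`.

The argument is run once for `Assoc T p M` and used three times: `True`, p = 1 and powers of x₁ - x₂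
(modules); `True`, the given p and all nonzero series (φ-coordinated quasi modules); `False` and the
series q(x₁/x₂) (the quasi condition, where no substitution is claimed). The matching relations
`Twist` are `twist_powers_subVar`, `twist_nonZeroDivisors` and `twist_rootSeries`.

Associativity of V♯H itself needs no second computation. Taking W = V in `assoc_sharp` gives an
associative action of V♯H on V. Tensoring it with H and pulling back along v ⊗ h ↦ ∑ (v ⊗ h₍₁₎) ⊗
h₍₂₎ gives exactly Y♯; this map is a homomorphism V♯H → (V♯H) ⊗ H because Δ is coassociative and a
homomorphism (`mapL_coact_smash`, `assoc_smash`). Creation comes from the counit, and the group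
action from equivariance of Δ. -/

theorem finsum_swap {α β M : Type*} [AddCommMonoid M] (f : α → β → M)
    (h : (Function.support fun x : α × β => f x.1 x.2).Finite) :
    ∑ᶠ a, ∑ᶠ b, f a b = ∑ᶠ b, ∑ᶠ a, f a b := by
  have h1 := finsum_curry (fun x : α × β => f x.1 x.2) h
  have h2 := finsum_curry (fun x : β × α => f x.2 x.1)
    ((h.preimage (Prod.swap_injective.injOn)).subset (fun x hx => hx))
  rw [← h1, ← h2]
  exact (finsum_comp_equiv (Equiv.prodComm β α) (f := fun x : α × β => f x.1 x.2)).symm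

section ConvCalculus

variable {A B C D E F : Type*} [AddCommGroup A] [Module ℂ A] [AddCommGroup B] [Module ℂ B]
  [AddCommGroup C] [Module ℂ C] [AddCommGroup D] [Module ℂ D] [AddCommGroup E] [Module ℂ E]
  [AddCommGroup F] [Module ℂ F]

theorem coeff_eq_zero_of_lt {A : Type*} [Zero A] {f : HahnSeries ℤ A} {i : ℤ} (h : f.coeff i ≠ 0) :
    f.order ≤ i := by
  by_contra hi
  exact h (HahnSeries.coeff_eq_zero_of_lt_order (not_le.mp hi))

/-- Both sides are the same double sum of triple products. With four unrelated bilinear maps it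
covers associativity of scalars, of actions, and of the nested products used below. -/
theorem conv_assoc (β : B →ₗ[ℂ] C →ₗ[ℂ] D) (γ : A →ₗ[ℂ] E →ₗ[ℂ] B) (δ : A →ₗ[ℂ] F →ₗ[ℂ] D)
    (ε : E →ₗ[ℂ] C →ₗ[ℂ] F) (h : ∀ a e c, β (γ a e) c = δ a (ε e c))
    (f : Lau A) (g : Lau E) (k : Lau C) :
    conv β (conv γ f g) k = conv δ f (conv ε g k) := by
  ext n
  rw [conv_coeff, conv_coeff]
  have h1 : ∀ i, β ((conv γ f g).coeff i) (k.coeff (n - i)) =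
      ∑ᶠ j, δ (f.coeff j) (ε (g.coeff (i - j)) (k.coeff (n - i))) := fun i => by
    rw [conv_coeff]
    refine (map_finsum (β.flip (k.coeff (n - i))) (conv_finite γ f g i)).trans ?_
    exact finsum_congr fun j => h _ _ _
  have h2 : ∀ j, δ (f.coeff j) ((conv ε g k).coeff (n - j)) =
      ∑ᶠ i, δ (f.coeff j) (ε (g.coeff (i - j)) (k.coeff (n - i))) := fun j => by
    rw [conv_coeff]
    refine (map_finsum (δ (f.coeff j)) (conv_finite ε g k (n - j))).trans ?_
    rw [← finsum_comp_equiv (Equiv.subRight j)]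
    refine finsum_congr fun i => ?_
    simp only [Equiv.subRight_apply]
    rw [show n - j - (i - j) = n - i by ring]
  rw [finsum_congr h1, finsum_congr h2]
  -- A nonzero term needs all three exponents to be at least the respective orders, which confines
  -- both indices to intervals.
  refine finsum_swap _ (((Set.finite_Icc (f.order + g.order) (n - k.order)).prod
    (Set.finite_Icc f.order (n - k.order - g.order))).subset fun x hx => ?_)
  have hf := coeff_eq_zero_of_lt (f := f) (i := x.2) fun h0 => hx (by simp [h0])
  have hg := coeff_eq_zero_of_lt (f := g) (i := x.1 - x.2) fun h0 => hx (by simp [h0])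
  have hk := coeff_eq_zero_of_lt (f := k) (i := n - x.1) fun h0 => hx (by simp [h0])
  simp only [Set.mem_prod, Set.mem_Icc]
  lia

theorem conv_comm (β : A →ₗ[ℂ] B →ₗ[ℂ] C) (γ : B →ₗ[ℂ] A →ₗ[ℂ] C) (h : ∀ a b, β a b = γ b a)
    (f : Lau A) (g : Lau B) : conv β f g = conv γ g f := by
  ext n
  rw [conv_coeff, conv_coeff, ← finsum_comp_equiv (Equiv.subLeft n)]
  refine finsum_congr fun i => ?_
  simp [h]

theorem conv_left_comm (δ : A →ₗ[ℂ] D →ₗ[ℂ] F) (ε : B →ₗ[ℂ] C →ₗ[ℂ] D) (δ' : B →ₗ[ℂ] E →ₗ[ℂ] F)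
    (ε' : A →ₗ[ℂ] C →ₗ[ℂ] E) (h : ∀ a b c, δ a (ε b c) = δ' b (ε' a c))
    (f : Lau A) (g : Lau B) (k : Lau C) :
    conv δ f (conv ε g k) = conv δ' g (conv ε' f k) := by
  ext n
  rw [conv_coeff, conv_coeff]
  have h1 : ∀ i, δ (f.coeff i) ((conv ε g k).coeff (n - i)) =
      ∑ᶠ j, δ (f.coeff i) (ε (g.coeff j) (k.coeff (n - i - j))) := fun i => by
    rw [conv_coeff]
    exact (map_finsum (δ (f.coeff i)) (conv_finite ε g k (n - i)))
  have h2 : ∀ j, δ' (g.coeff j) ((conv ε' f k).coeff (n - j)) =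
      ∑ᶠ i, δ (f.coeff i) (ε (g.coeff j) (k.coeff (n - i - j))) := fun j => by
    rw [conv_coeff]
    refine (map_finsum (δ' (g.coeff j)) (conv_finite ε' f k (n - j))).trans ?_
    refine finsum_congr fun i => ?_
    rw [h, sub_right_comm]
  rw [finsum_congr h1, finsum_congr h2]
  refine finsum_swap _ (((Set.finite_Icc f.order (n - k.order - g.order)).prod
    (Set.finite_Icc g.order (n - k.order - f.order))).subset fun x hx => ?_)
  have hf := coeff_eq_zero_of_lt (f := f) (i := x.1) fun h0 => hx (by simp [h0])
  have hg := coeff_eq_zero_of_lt (f := g) (i := x.2) fun h0 => hx (by simp [h0])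
  have hk := coeff_eq_zero_of_lt (f := k) (i := n - x.1 - x.2) fun h0 => hx (by simp [h0])
  simp only [Set.mem_prod, Set.mem_Icc]
  lia

/-- The coefficientwise application of a linear map to a Laurent series. -/
def mapL : (A →ₗ[ℂ] B) →ₗ[ℂ] Lau A →ₗ[ℂ] Lau B :=
  LinearMap.mk₂ ℂ (fun S f => f.map S)
    (fun S S' f => by ext; simp) (fun c S f => by ext; simp)
    (fun S f f' => by ext; simp) (fun c S f => by ext; simp)

@[simp] theorem mapL_coeff (S : A →ₗ[ℂ] B) (f : Lau A) (n : ℤ) :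
    (mapL S f).coeff n = S (f.coeff n) := rfl

@[simp] theorem constL_coeff_zero (a : A) : (constL a).coeff 0 = a := by
  simp [constL]

theorem constL_coeff (a : A) (n : ℤ) : (constL a).coeff n = if n = 0 then a else 0 := by
  simp [constL, HahnSeries.coeff_single]

theorem mapL_mapL (S : B →ₗ[ℂ] C) (S' : A →ₗ[ℂ] B) (f : Lau A) :
    mapL S (mapL S' f) = mapL (S ∘ₗ S') f := rfl

@[simp] theorem mapL_constL (S : A →ₗ[ℂ] B) (a : A) : mapL S (constL a) = constL (S a) := by
  ext n
  simp only [mapL_coeff, constL_coeff]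
  split_ifs <;> simp

theorem mapL_injective {S : A →ₗ[ℂ] B} (hS : Function.Injective S) :
    Function.Injective (mapL S) := fun f g h => by
  ext n
  exact hS (congrArg (fun k : Lau B => k.coeff n) h)

theorem mapL_conv (S : C →ₗ[ℂ] D) (β : A →ₗ[ℂ] B →ₗ[ℂ] C) (f : Lau A) (g : Lau B) :
    mapL S (conv β f g) = conv (β.compr₂ S) f g := by
  ext n
  rw [mapL_coeff, conv_coeff, conv_coeff]
  exact map_finsum S (conv_finite β f g n)

theorem conv_mapL_left (β : B →ₗ[ℂ] C →ₗ[ℂ] D) (S : A →ₗ[ℂ] B) (f : Lau A) (g : Lau C) :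
    conv β (mapL S f) g = conv (β ∘ₗ S) f g := rfl

theorem conv_mapL_right (β : A →ₗ[ℂ] C →ₗ[ℂ] D) (S : B →ₗ[ℂ] C) (f : Lau A) (g : Lau B) :
    conv β f (mapL S g) = conv (β.compl₂ S) f g := rfl

theorem conv_constL_left (β : A →ₗ[ℂ] B →ₗ[ℂ] C) (a : A) (g : Lau B) :
    conv β (constL a) g = mapL (β a) g := by
  ext n
  rw [conv_coeff, finsum_eq_single _ 0 (fun i hi => by simp [constL_coeff, hi])]
  simp

theorem conv_constL_right (β : A →ₗ[ℂ] B →ₗ[ℂ] C) (f : Lau A) (b : B) :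
    conv β f (constL b) = mapL (β.flip b) f := by
  rw [conv_comm β β.flip (fun _ _ => rfl), conv_constL_left]

theorem conv_mul (f g : Lau ℂ) : conv (LinearMap.mul ℂ ℂ) f g = f * g := by
  ext n
  rw [conv_coeff, (mul_coeff_finsum f g n).2]
  rfl

theorem conv_conv_mul (f g : Lau (Lau ℂ)) : conv (conv (LinearMap.mul ℂ ℂ)) f g = f * g := by
  refine HahnSeries.ext (funext fun n => ?_)
  rw [conv_coeff, (mul_coeff_finsum f g n).2]
  exact finsum_congr fun i => conv_mul _ _

@[simp] theorem smulL_one (f : Lau A) : smulL 1 f = f := by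
  have : (1 : Lau ℂ) = constL 1 := rfl
  rw [smulL, this, conv_constL_left]
  ext; simp

theorem smulL_smulL (a b : Lau ℂ) (f : Lau A) : smulL a (smulL b f) = smulL (a * b) f := by
  rw [← conv_mul]
  exact (conv_assoc _ _ _ _ (fun a b c => mul_smul a b c) a b f).symm

theorem mapL_smulL (S : A →ₗ[ℂ] B) (a : Lau ℂ) (f : Lau A) :
    mapL S (smulL a f) = smulL a (mapL S f) := by
  rw [smulL, mapL_conv, smulL, conv_mapL_right]
  have : (LinearMap.lsmul ℂ A).compr₂ S = (LinearMap.lsmul ℂ B).compl₂ S :=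
    LinearMap.ext₂ fun c x => map_smul S c x
  rw [this]

theorem conv_smulL_left (β : A →ₗ[ℂ] B →ₗ[ℂ] C) (a : Lau ℂ) (f : Lau A) (g : Lau B) :
    conv β (smulL a f) g = smulL a (conv β f g) :=
  conv_assoc _ _ _ _ (fun a b c => by simp) a f g

theorem conv_smulL_right (β : A →ₗ[ℂ] B →ₗ[ℂ] C) (a : Lau ℂ) (f : Lau A) (g : Lau B) :
    conv β f (smulL a g) = smulL a (conv β f g) :=
  conv_left_comm _ _ _ _ (fun a b c => by simp) f a g

/-- The action of `ℂ((x))((y))` on `A((x))((y))`. -/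
def act : Lau (Lau ℂ) →ₗ[ℂ] Lau (Lau A) →ₗ[ℂ] Lau (Lau A) := conv smulL

/-- The product of `A((x))((y))` and `B((x))((y))` coming from a bilinear map. -/
def conv₂ (β : A →ₗ[ℂ] B →ₗ[ℂ] C) : Lau (Lau A) →ₗ[ℂ] Lau (Lau B) →ₗ[ℂ] Lau (Lau C) :=
  conv (conv β)

theorem act_act (F G : Lau (Lau ℂ)) (f : Lau (Lau A)) : act F (act G f) = act (F * G) f := by
  rw [← conv_conv_mul]
  refine (conv_assoc _ _ _ _ (fun a b c => ?_) F G f).symm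
  rw [smulL_smulL, conv_mul]

theorem act_mul (F G : Lau (Lau ℂ)) : act F G = F * G := by
  rw [← conv_conv_mul]; rfl

theorem conv₂_act_left (β : A →ₗ[ℂ] B →ₗ[ℂ] C) (F : Lau (Lau ℂ)) (f : Lau (Lau A))
    (g : Lau (Lau B)) : conv₂ β (act F f) g = act F (conv₂ β f g) :=
  conv_assoc _ _ _ _ (fun a b c => conv_smulL_left β a b c) F f g

theorem conv₂_act_right (β : A →ₗ[ℂ] B →ₗ[ℂ] C) (F : Lau (Lau ℂ)) (f : Lau (Lau A))
    (g : Lau (Lau B)) : conv₂ β f (act F g) = act F (conv₂ β f g) :=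
  conv_left_comm _ _ _ _ (fun a b c => conv_smulL_right β b a c) f F g

end ConvCalculus

/-! ### Doubly infinite series -/

theorem IsLau2.add {A : Type*} [AddCommGroup A] {f g : Ser2 A} (hf : IsLau2 f) (hg : IsLau2 g) : IsLau2 (f + g) := by
  obtain ⟨N, hN⟩ := hf
  obtain ⟨M, hM⟩ := hg
  refine ⟨min N M, fun a ha => ?_⟩
  by_cases h : f a = 0
  · have := hM a (fun h' => ha (by simp [h, h']))
    lia
  · have := hN a h
    lia

theorem IsLau2.zero {A : Type*} [AddCommGroup A] : IsLau2 (0 : Ser2 A) := ⟨0, fun _ ha => absurd rfl ha⟩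

section Ser

variable {A B C : Type*} [AddCommGroup A] [Module ℂ A] [AddCommGroup B] [Module ℂ B]
  [AddCommGroup C] [Module ℂ C]

/-- The series in `A((x₂))((x₁))` underlying an iterated Laurent series; the outer variable comes
first. -/
def ser₁ : Lau (Lau A) →ₗ[ℂ] Ser2 A where
  toFun S a := (S.coeff a.1).coeff a.2
  map_add' S T := by ext; simp
  map_smul' c S := by ext; simp

/-- The series in `A((x₁))((x₂))` underlying an iterated Laurent series; the outer variable comes
second. -/
def ser₂ : Lau (Lau A) →ₗ[ℂ] Ser2 A where
  toFun S a := (S.coeff a.2).coeff a.1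
  map_add' S T := by ext; simp
  map_smul' c S := by ext; simp

theorem ser₁_apply (S : Lau (Lau A)) (a : ℤ × ℤ) : ser₁ S a = (S.coeff a.1).coeff a.2 := rfl

theorem ser₂_apply (S : Lau (Lau A)) (a : ℤ × ℤ) : ser₂ S a = (S.coeff a.2).coeff a.1 := rfl

theorem ser₁_injective : Function.Injective (ser₁ (A := A)) := fun S T h => by
  ext i j
  exact congrFun h (i, j)

theorem ser₂_injective : Function.Injective (ser₂ (A := A)) := fun S T h => by
  ext i j
  exact congrFun h (j, i)

/-- The product of two doubly infinite series. It is used only where every coefficient of the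
product is a finite sum. -/
def convSer (β : A →ₗ[ℂ] B →ₗ[ℂ] C) (f : Ser2 A) (g : Ser2 B) : Ser2 C :=
  fun a => ∑ᶠ b : ℤ × ℤ, β (f b) (g (a - b))

/-- The lower bound of the inner exponent depends on the outer one, so no rectangle is given in
advance. The outer exponent is bounded first, and each slice is then finite. -/
theorem convSer_ser₁_finite (β : A →ₗ[ℂ] B →ₗ[ℂ] C) (S : Lau (Lau A)) (T : Lau (Lau B))
    (a : ℤ × ℤ) : (Function.support fun b => β (ser₁ S b) (ser₁ T (a - b))).Finite := by
  refine ((Set.finite_Icc S.order (a.1 - T.order)).biUnion (t := fun i =>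
    Prod.mk i '' (Function.support fun j => β ((S.coeff i).coeff j)
      ((T.coeff (a.1 - i)).coeff (a.2 - j)))) fun i _ => (conv_finite β _ _ _).image _).subset
    fun b hb => ?_
  simp only [Set.mem_iUnion]
  refine ⟨b.1, ?_, b.2, hb, rfl⟩
  have hS := coeff_eq_zero_of_lt (f := S) (i := b.1) fun h0 => hb (by simp [ser₁_apply, h0])
  have hT := coeff_eq_zero_of_lt (f := T) (i := a.1 - b.1) fun h0 => hb (by simp [ser₁_apply, h0])
  exact ⟨hS, by lia⟩

theorem ser₁_conv₂ (β : A →ₗ[ℂ] B →ₗ[ℂ] C) (S : Lau (Lau A)) (T : Lau (Lau B)) :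
    ser₁ (conv₂ β S T) = convSer β (ser₁ S) (ser₁ T) := by
  ext a
  rw [convSer, finsum_curry _ (convSer_ser₁_finite β S T a), ser₁_apply, conv₂, conv_coeff]
  refine (map_finsum (HahnSeries.coeff.addMonoidHom (R := C) a.2)
    (conv_finite (conv β) S T a.1)).trans (finsum_congr fun i => ?_)
  exact conv_coeff β _ _ _

theorem ser₂_eq (S : Lau (Lau A)) (a : ℤ × ℤ) : ser₂ S a = ser₁ S a.swap := rfl

theorem ser₂_conv₂ (β : A →ₗ[ℂ] B →ₗ[ℂ] C) (S : Lau (Lau A)) (T : Lau (Lau B)) :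
    ser₂ (conv₂ β S T) = convSer β (ser₂ S) (ser₂ T) := by
  ext a
  rw [ser₂_eq, ser₁_conv₂, convSer, ← finsum_comp_equiv (Equiv.prodComm ℤ ℤ)]
  rfl

theorem ser₁_act (F : Lau (Lau ℂ)) (S : Lau (Lau A)) : ser₁ (act F S) = fmul (ser₁ F) (ser₁ S) :=
  ser₁_conv₂ _ _ _

theorem ser₂_act (F : Lau (Lau ℂ)) (S : Lau (Lau A)) : ser₂ (act F S) = fmul (ser₂ F) (ser₂ S) :=
  ser₂_conv₂ _ _ _

/-- A series whose exponents are bounded below as required, as an element of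
`A((x₂))((x₁))`. -/
theorem exists_ser₁ (f : Ser2 A) (N : ℤ) (M : ℤ → ℤ) (h : ∀ a, f a ≠ 0 → N ≤ a.1 ∧ M a.1 ≤ a.2) :
    ∃ S, ser₁ S = f := by
  refine ⟨HahnSeries.ofSuppBddBelow (fun i => HahnSeries.ofSuppBddBelow (fun j => f (i, j))
    ⟨M i, fun j hj => (h _ hj).2⟩) ⟨N, fun i hi => ?_⟩, rfl⟩
  by_contra hN
  refine hi ?_
  ext j
  by_contra hj
  exact hN (h (i, j) hj).1

theorem IsLau2.exists_ser₂ {f : Ser2 A} (h : IsLau2 f) : ∃ S, ser₂ S = f := by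
  obtain ⟨N, hN⟩ := h
  obtain ⟨S, hS⟩ := PhiCoord.exists_ser₁ (fun a => f a.swap) N (fun _ => N)
    (fun a ha => (hN _ ha).symm)
  refine ⟨S, ?_⟩
  ext a
  rw [ser₂_eq, hS]
  simp

theorem IsLau2.convSer (β : A →ₗ[ℂ] B →ₗ[ℂ] C) {f : Ser2 A} {g : Ser2 B} (hf : IsLau2 f)
    (hg : IsLau2 g) : IsLau2 (convSer β f g) := by
  obtain ⟨N, hN⟩ := hf
  obtain ⟨M, hM⟩ := hg
  refine ⟨N + M, fun a ha => ?_⟩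
  obtain ⟨b, hb⟩ := not_forall.1 fun h0 => ha (finsum_eq_zero_of_forall_eq_zero h0)
  have h1 := hN b fun h0 => hb (by simp [h0])
  have h2 := hM (a - b) fun h0 => hb (by simp [h0])
  simp only [Prod.fst_sub, Prod.snd_sub] at h2
  lia

end Ser

/-! ### The exponential of a derivation of `ℂ((x))` -/

/-- Higher Leibniz rule, by induction with Pascal's recursion. It is what makes the exponential of a
derivation multiplicative. -/
theorem iterate_leibniz {R : Type*} [CommRing R] (D : R →+ R)
    (hD : ∀ f g, D (f * g) = D f * g + f * D g) (n : ℕ) (f g : R) :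
    D^[n] (f * g) =
      ∑ ij ∈ Finset.HasAntidiagonal.antidiagonal n, (n.choose ij.1 : R) * (D^[ij.1] f * D^[ij.2] g) := by
  induction n with
  | zero => simp
  | succ n ih =>
    rw [Finset.sum_antidiagonal_choose_succ_mul (fun i j => D^[i] f * D^[j] g),
      Function.iterate_succ_apply', ih, map_sum, ← Finset.sum_add_distrib]
    refine Finset.sum_congr rfl fun ij hij => ?_
    have hc : ∀ (m : ℕ) (x : R), D (m * x) = m * D x := fun m x => by
      rw [← nsmul_eq_mul, map_nsmul, nsmul_eq_mul]
    rw [Finset.HasAntidiagonal.mem_antidiagonal] at hij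
    rw [hc, hD, ← Function.iterate_succ_apply' D, ← Function.iterate_succ_apply' D,
      Nat.choose_symm_of_eq_add hij.symm]
    ring

theorem derivative_coeff (f : Lau ℂ) (n : ℤ) :
    (LaurentSeries.derivative ℂ f).coeff n = ((n + 1 : ℤ) : ℂ) * f.coeff (n + 1) := by
  simp [LaurentSeries.derivative_apply, LaurentSeries.hasseDeriv_coeff]

theorem derivative_mul (f g : Lau ℂ) : LaurentSeries.derivative ℂ (f * g) =
    LaurentSeries.derivative ℂ f * g + f * LaurentSeries.derivative ℂ g := by
  ext n
  rw [HahnSeries.coeff_add, derivative_coeff, (mul_coeff_finsum f g _).2,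
    (mul_coeff_finsum _ g _).2, (mul_coeff_finsum f _ _).2, ← smul_eq_mul, smul_finsum,
    ← finsum_comp_equiv (Equiv.subRight (1 : ℤ)) (f := fun i =>
      (LaurentSeries.derivative ℂ f).coeff i * g.coeff (n - i)), ← finsum_add_distrib]
  · refine finsum_congr fun i => ?_
    simp only [Equiv.subRight_apply, derivative_coeff, smul_eq_mul]
    rw [show i - 1 + 1 = i by ring, show n - (i - 1) = n + 1 - i by ring,
      show n - i + 1 = n + 1 - i by ring]
    push_cast
    ring
  · exact (mul_coeff_finsum (LaurentSeries.derivative ℂ f) g n).1.preimage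
      ((Equiv.subRight (1 : ℤ)).injective.injOn)
  · exact (mul_coeff_finsum f (LaurentSeries.derivative ℂ g) n).1

/-- The derivation `p(x) d/dx` of `ℂ((x))`. -/
def vecField (p : Lau ℂ) : Lau ℂ →ₗ[ℂ] Lau ℂ where
  toFun f := p * LaurentSeries.derivative ℂ f
  map_add' f g := by rw [map_add, mul_add]
  map_smul' c f := by
    rw [map_smul, ← HahnSeries.C_mul_eq_smul, ← HahnSeries.C_mul_eq_smul, mul_left_comm]
    rfl

theorem vecField_apply (p f : Lau ℂ) : vecField p f = p * LaurentSeries.derivative ℂ f := rfl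

theorem vecField_mul (p f g : Lau ℂ) :
    vecField p (f * g) = vecField p f * g + f * vecField p g := by
  simp only [vecField_apply, derivative_mul]
  ring

/-- The power series `e^{z p(x) d/dx} f(x)` in `z`. -/
def expSeries (p f : Lau ℂ) : PowerSeries (Lau ℂ) :=
  PowerSeries.mk fun k => ((k.factorial : ℂ)⁻¹) • (vecField p)^[k] f

/-- Divided by k!, the binomial coefficients of the Leibniz rule become 1/(i! j!), which is the
Cauchy product in z. -/
theorem expSeries_mul (p f g : Lau ℂ) : expSeries p (f * g) = expSeries p f * expSeries p g := by
  ext k : 1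
  rw [PowerSeries.coeff_mul, expSeries, PowerSeries.coeff_mk,
    show ⇑(vecField p) = ⇑(vecField p).toAddMonoidHom from rfl,
    iterate_leibniz (vecField p).toAddMonoidHom (vecField_mul p), Finset.smul_sum]
  refine Finset.sum_congr rfl fun ij hij => ?_
  rw [Finset.HasAntidiagonal.mem_antidiagonal] at hij
  have hmul : ∀ (c d : ℂ) (u v : Lau ℂ), (c • u) * (d • v) = (c * d) • (u * v) := fun c d u v => by
    rw [← HahnSeries.C_mul_eq_smul, ← HahnSeries.C_mul_eq_smul, ← HahnSeries.C_mul_eq_smul,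
      map_mul]
    ring
  simp only [expSeries, PowerSeries.coeff_mk]
  rw [← nsmul_eq_mul, ← Nat.cast_smul_eq_nsmul ℂ, smul_smul, hmul]
  congr 1
  rw [← hij, Nat.choose_eq_factorial_div_factorial (Nat.le_add_right _ _), Nat.add_sub_cancel_left]
  have h := Nat.factorial_ne_zero (ij.1 + ij.2)
  have h1 := Nat.factorial_ne_zero ij.1
  have h2 := Nat.factorial_ne_zero ij.2
  rw [Nat.cast_div (Nat.factorial_mul_factorial_dvd_factorial_add _ _) (by positivity)]
  push_cast
  field_simp

theorem vecField_one (p : Lau ℂ) : vecField p 1 = 0 := by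
  have := vecField_mul p 1 1
  simpa using this

/-- The ring homomorphism `f(x) ↦ e^{z p(x) d/dx} f(x)` from `ℂ((x))` to `ℂ((x))((z))`. -/
def expHom (p : Lau ℂ) : Lau ℂ →+* LL where
  toFun f := toLL (HahnSeries.ofPowerSeries ℤ (Lau ℂ) (expSeries p f))
  map_one' := by
    have : expSeries p 1 = 1 := by
      ext k : 1
      rw [expSeries, PowerSeries.coeff_mk, PowerSeries.coeff_one]
      rcases k with _ | k
      · simp
      · rw [Function.iterate_succ_apply, vecField_one, iterate_map_zero]
        simp
    rw [this, map_one]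
    rfl
  map_mul' f g := by
    rw [expSeries_mul, map_mul]
    rfl
  map_zero' := by
    have : expSeries p 0 = 0 := by
      ext k : 1
      simp [expSeries, iterate_map_zero]
    rw [this, map_zero, map_zero]
  map_add' f g := by
    have : expSeries p (f + g) = expSeries p f + expSeries p g := by
      ext k : 1
      simp [expSeries, iterate_map_add]
    rw [this, map_add, map_add]

theorem expHom_coeff_nat (p f : Lau ℂ) (k : ℕ) (n : ℤ) :
    (expHom p f).coeff k n = ((k.factorial : ℂ)⁻¹) * ((vecField p)^[k] f).coeff n := by
  change ((HahnSeries.ofPowerSeries ℤ (Lau ℂ) (expSeries p f)).coeff k).coeff n = _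
  rw [HahnSeries.ofPowerSeries_apply_coeff]
  simp [expSeries]

theorem expHom_coeff_neg (p f : Lau ℂ) {k : ℤ} (hk : k < 0) (n : ℤ) :
    (expHom p f).coeff k n = 0 := by
  change ((HahnSeries.ofPowerSeries ℤ (Lau ℂ) (expSeries p f)).coeff k).coeff n = _
  rw [PowerSeries.coeff_coe, if_pos hk]
  rfl

theorem phi_eq_expHom (p : Lau ℂ) : phi p = expHom p (HahnSeries.single 1 1) := rfl

theorem phi_ne_zero (p : Lau ℂ) : phi p ≠ 0 := by
  rw [phi_eq_expHom, Ne, map_eq_zero]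
  simp

theorem single_one_zpow (m : ℤ) :
    (HahnSeries.single 1 1 : Lau ℂ) ^ m = HahnSeries.single m 1 :=
  (RatFunc.single_zpow m).symm

/-- A ring homomorphism between fields respects negative powers too, so every power of φ is read off
from iterates of p d/dx on a monomial. -/
theorem phi_zpow (p : Lau ℂ) (m : ℤ) : phi p ^ m = expHom p (HahnSeries.single m 1) := by
  rw [phi_eq_expHom, ← map_zpow₀, single_one_zpow]

theorem phi_zpow_coeff_nat (p : Lau ℂ) (m : ℤ) (k : ℕ) (n : ℤ) : (phi p ^ m).coeff k n =
    ((k.factorial : ℂ)⁻¹) * ((vecField p)^[k] (HahnSeries.single m 1)).coeff n := by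
  rw [phi_zpow, expHom_coeff_nat]

theorem phi_zpow_coeff_neg (p : Lau ℂ) (m : ℤ) {k : ℤ} (hk : k < 0) (n : ℤ) :
    (phi p ^ m).coeff k n = 0 := by
  rw [phi_zpow, expHom_coeff_neg _ _ hk]

theorem phi_zpow_coeff_zero (p : Lau ℂ) (m n : ℤ) :
    (phi p ^ m).coeff 0 n = if n = m then 1 else 0 := by
  have := phi_zpow_coeff_nat p m 0 n
  simpa [HahnSeries.coeff_single] using this

/-- The derivative lowers the order by at most one and multiplication by p shifts it by the order of
p. -/
theorem vecField_coeff_eq_zero (p : Lau ℂ) {f : Lau ℂ} {N : ℤ} (h : ∀ n < N, f.coeff n = 0) (n : ℤ)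
    (hn : n < N - 1 + p.order) : (vecField p f).coeff n = 0 := by
  rw [vecField_apply, (mul_coeff_finsum _ _ _).2]
  refine finsum_eq_zero_of_forall_eq_zero fun i => ?_
  by_cases hi : i < p.order
  · rw [HahnSeries.coeff_eq_zero_of_lt_order hi, zero_mul]
  · rw [derivative_coeff, h _ (by lia), mul_zero, mul_zero]

/-- The powers of `φ` are `φ ^ m = x ^ m + ∑_{k > 0} z ^ k O(x ^ (m - c k))`. -/
theorem phi_bound (p : Lau ℂ) : ∃ c : ℤ, 0 ≤ c ∧ ∀ m k n : ℤ, (phi p ^ m).coeff k n ≠ 0 →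
    0 ≤ k ∧ m - c * k ≤ n := by
  -- Each application of p d/dx costs at most 1 - ord p in x-order. The maximum with 0 keeps the
  -- slope nonnegative, as the later box estimates require.
  refine ⟨max 0 (1 - p.order), le_max_left _ _, fun m k n h => ?_⟩
  have hk : 0 ≤ k := by
    by_contra hk
    exact h (phi_zpow_coeff_neg p m (not_le.mp hk) n)
  refine ⟨hk, ?_⟩
  obtain ⟨k, rfl⟩ := Int.eq_ofNat_of_zero_le hk
  by_contra hn
  refine h ?_
  rw [phi_zpow_coeff_nat]
  have key : ∀ (k : ℕ) (n : ℤ), n < m - max 0 (1 - p.order) * k →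
      ((vecField p)^[k] (HahnSeries.single m (1 : ℂ))).coeff n = 0 := by
    intro k
    induction k with
    | zero =>
      intro n hn
      refine HahnSeries.coeff_single_of_ne ?_
      rintro rfl
      simp at hn
    | succ k ih =>
      intro n hn
      rw [Function.iterate_succ_apply']
      refine vecField_coeff_eq_zero p ih n ?_
      have := le_max_right 0 (1 - p.order)
      push_cast at hn
      linarith
  rw [key k n (not_le.mp hn), mul_zero]

/-! ### Substitution is multiplicative -/

section Subst

variable {A B C : Type*} [AddCommGroup A] [Module ℂ A] [AddCommGroup B] [Module ℂ B]
  [AddCommGroup C] [Module ℂ C]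

/-- The coefficient of `z ^ a.1 * x ^ a.2` in `φ(x, z) ^ d.1 * x ^ d.2`. -/
def substCoeff (φ : LL) (d a : ℤ × ℤ) : ℂ := (φ ^ d.1).coeff a.1 (a.2 - d.2)

theorem subst_apply (φ : LL) (f : Ser2 A) (a : ℤ × ℤ) :
    subst φ f a = ∑ᶠ d, substCoeff φ d a • f d := rfl

variable {φ : LL} {c : ℤ} (hc : 0 ≤ c)
  (hφ : ∀ m k n : ℤ, (φ ^ m).coeff k n ≠ 0 → 0 ≤ k ∧ m - c * k ≤ n)

include hφ

theorem substCoeff_ne_zero {d a : ℤ × ℤ} (h : substCoeff φ d a ≠ 0) :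
    0 ≤ a.1 ∧ d.1 + d.2 - c * a.1 ≤ a.2 := by
  have := hφ _ _ _ h
  exact ⟨this.1, by linarith [this.2]⟩

/-- The two exponents are bounded below by the support of f, and their sum is bounded above by the
growth of φ: only a triangle contributes. -/
theorem subst_finite {f : Ser2 A} (hf : IsLau2 f) (a : ℤ × ℤ) :
    (Function.support fun d => substCoeff φ d a • f d).Finite := by
  obtain ⟨N, hN⟩ := hf
  refine (Set.finite_Icc ((N, N) : ℤ × ℤ) (a.2 + c * a.1 - N, a.2 + c * a.1 - N)).subset
    fun d hd => ?_
  have h1 := substCoeff_ne_zero hφ (d := d) (a := a) fun h0 => hd (by simp [h0])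
  have h2 := hN d fun h0 => hd (by simp [h0])
  simp only [Set.mem_Icc, Prod.le_def]
  refine ⟨h2, ?_, ?_⟩ <;> linarith

theorem subst_add {f g : Ser2 A} (hf : IsLau2 f) (hg : IsLau2 g) :
    subst φ (f + g) = subst φ f + subst φ g := by
  ext a
  simp only [Pi.add_apply, subst_apply, smul_add]
  exact finsum_add_distrib (subst_finite hφ hf a) (subst_finite hφ hg a)

theorem exists_ser₁_subst {f : Ser2 A} (hf : IsLau2 f) : ∃ S, ser₁ S = subst φ f := by
  obtain ⟨N, hN⟩ := hf
  refine PhiCoord.exists_ser₁ _ 0 (fun k => 2 * N - c * k) fun a ha => ?_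
  obtain ⟨d, hd⟩ := not_forall.1 fun h0 => ha (finsum_eq_zero_of_forall_eq_zero h0)
  have h1 := substCoeff_ne_zero hφ (d := d) (a := a)
    fun h0 => hd (by simp only [substCoeff] at h0; simp [h0])
  have h2 := hN d fun h0 => hd (by simp [h0])
  exact ⟨h1.1, by linarith⟩

include hc

/-- For a fixed total exponent a, all indices entering a product of two substitutions lie in one
finite box. This licenses every rearrangement in `subst_convSer`. -/
theorem substCoeff_bound {N : ℤ} {a b d e : ℤ × ℤ} (hd : N ≤ d.1 ∧ N ≤ d.2)
    (he : N ≤ e.1 ∧ N ≤ e.2) (h1 : substCoeff φ d b ≠ 0) (h2 : substCoeff φ e (a - b) ≠ 0) :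
    b ∈ Set.Icc ((0, 2 * N - c * a.1) : ℤ × ℤ) (a.1, a.2 + c * a.1 - 2 * N) ∧
    d ∈ Set.Icc ((N, N) : ℤ × ℤ) (a.2 + c * a.1 - 3 * N, a.2 + c * a.1 - 3 * N) ∧
    e ∈ Set.Icc ((N, N) : ℤ × ℤ) (a.2 + c * a.1 - 3 * N, a.2 + c * a.1 - 3 * N) := by
  obtain ⟨hb, hdb⟩ := substCoeff_ne_zero hφ h1
  obtain ⟨hab, heb⟩ := substCoeff_ne_zero hφ h2
  simp only [Prod.fst_sub, Prod.snd_sub] at hab heb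
  have hcb := mul_nonneg hc hb
  have hcab := mul_nonneg hc hab
  have hcc : c * (a.1 - b.1) = c * a.1 - c * b.1 := by ring
  simp only [Set.mem_Icc, Prod.le_def]
  refine ⟨⟨⟨hb, ?_⟩, ?_, ?_⟩, ⟨⟨?_, ?_⟩, ?_, ?_⟩, ⟨?_, ?_⟩, ?_, ?_⟩ <;> linarith

theorem substCoeff_add (h0 : φ ≠ 0) (d e a : ℤ × ℤ) :
    (Function.support fun b => substCoeff φ d b * substCoeff φ e (a - b)).Finite ∧
    substCoeff φ (d + e) a = ∑ᶠ b, substCoeff φ d b * substCoeff φ e (a - b) := by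
  set N := min (min d.1 d.2) (min e.1 e.2) with hN
  have hfin : (Function.support fun b => substCoeff φ d b * substCoeff φ e (a - b)).Finite := by
    refine (Set.finite_Icc ((0, 2 * N - c * a.1) : ℤ × ℤ)
      (a.1, a.2 + c * a.1 - 2 * N)).subset fun b hb => ?_
    exact (substCoeff_bound hc hφ (N := N) (by lia) (by lia) (left_ne_zero_of_mul hb)
      (right_ne_zero_of_mul hb)).1
  refine ⟨hfin, ?_⟩
  rw [finsum_curry _ hfin, substCoeff, Prod.fst_add, zpow_add₀ h0, LL.mul_coeff]
  refine finsum_congr fun i => ?_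
  rw [← finsum_comp_equiv (Equiv.subRight d.2)]
  refine finsum_congr fun j => ?_
  simp only [substCoeff, Equiv.subRight_apply, Prod.fst_sub, Prod.snd_sub, Prod.snd_add]
  congr 2
  ring

/-- Both sides are sums of one kernel K over a pair of monomials and a splitting of the exponent a.
Summing over splittings first gives the left side by the law for powers of φ (`substCoeff_add`);
summing over monomials first gives the right side. -/
theorem subst_convSer (h0 : φ ≠ 0) (β : A →ₗ[ℂ] B →ₗ[ℂ] C) {f : Ser2 A} {g : Ser2 B}
    (hf : IsLau2 f) (hg : IsLau2 g) :
    subst φ (convSer β f g) = convSer β (subst φ f) (subst φ g) := by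
  ext a
  have hN : ∃ N : ℤ, (∀ d, f d ≠ 0 → N ≤ d.1 ∧ N ≤ d.2) ∧ ∀ d, g d ≠ 0 → N ≤ d.1 ∧ N ≤ d.2 := by
    obtain ⟨N, hN⟩ := hf
    obtain ⟨M, hM⟩ := hg
    exact ⟨min N M, fun d hd => by have := hN d hd; lia, fun d hd => by have := hM d hd; lia⟩
  obtain ⟨N, hNf, hNg⟩ := hN
  set K : ℤ × ℤ → (ℤ × ℤ) × (ℤ × ℤ) → C := fun b x =>
    (substCoeff φ x.1 b * substCoeff φ x.2 (a - b)) • β (f x.1) (g x.2) with hK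
  have hbox : ∀ b x, K b x ≠ 0 →
      b ∈ Set.Icc ((0, 2 * N - c * a.1) : ℤ × ℤ) (a.1, a.2 + c * a.1 - 2 * N) ∧
      x.1 ∈ Set.Icc ((N, N) : ℤ × ℤ) (a.2 + c * a.1 - 3 * N, a.2 + c * a.1 - 3 * N) ∧
      x.2 ∈ Set.Icc ((N, N) : ℤ × ℤ) (a.2 + c * a.1 - 3 * N, a.2 + c * a.1 - 3 * N) := by
    intro b x hx
    exact substCoeff_bound hc hφ (hNf _ fun h => hx (by simp [hK, h]))
      (hNg _ fun h => hx (by simp [hK, h])) (fun h => hx (by simp [hK, h]))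
      (fun h => hx (by simp [hK, h]))
  have hfin : (Function.support fun y : (ℤ × ℤ) × (ℤ × ℤ) × (ℤ × ℤ) => K y.1 y.2).Finite :=
    ((Set.finite_Icc _ _).prod ((Set.finite_Icc _ _).prod (Set.finite_Icc _ _))).subset
      fun y hy => hbox y.1 y.2 hy
  have hfin₁ : ∀ b, (Function.support (K b)).Finite := fun b =>
    (hfin.image Prod.snd).subset fun x hx => ⟨(b, x), hx, rfl⟩
  have hright : convSer β (subst φ f) (subst φ g) a = ∑ᶠ b, ∑ᶠ x, K b x := by
    refine finsum_congr fun b => ?_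
    rw [finsum_curry _ (hfin₁ b), subst_apply, subst_apply]
    refine (map_finsum (β.flip _) (subst_finite hφ hf b)).trans (finsum_congr fun d => ?_)
    refine (map_finsum (β _) (subst_finite hφ hg (a - b))).trans (finsum_congr fun e => ?_)
    simp only [map_smul, LinearMap.smul_apply, smul_smul, hK]
    rw [mul_comm]
  have hsum : ∀ x, substCoeff φ (x.1 + x.2) a • β (f x.1) (g x.2) = ∑ᶠ b, K b x := by
    intro x
    obtain ⟨h1, h2⟩ := substCoeff_add hc hφ h0 x.1 x.2 a
    rw [h2]
    exact map_finsum ((LinearMap.toSpanSingleton ℂ C (β (f x.1) (g x.2)))) h1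
  have hleft : subst φ (convSer β f g) a = ∑ᶠ x, ∑ᶠ b, K b x := by
    have hfin₂ : (Function.support fun x : (ℤ × ℤ) × (ℤ × ℤ) => ∑ᶠ b, K b x).Finite := by
      refine (hfin.image Prod.snd).subset fun x hx => ?_
      obtain ⟨b, hb⟩ := not_forall.1 fun h => hx (finsum_eq_zero_of_forall_eq_zero h)
      exact ⟨(b, x), hb, rfl⟩
    rw [finsum_curry _ hfin₂, subst_apply]
    have h1 : ∀ d, substCoeff φ d a • convSer β f g d =
        ∑ᶠ b, substCoeff φ d a • β (f b) (g (d - b)) := fun d => smul_finsum _ _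
    -- After the exchange the inner sum runs over total exponents; translating by the first exponent
    -- turns it into a sum over the second.
    rw [finsum_congr h1, finsum_swap]
    · refine finsum_congr fun d => ?_
      rw [← finsum_comp_equiv (Equiv.addLeft d)]
      refine finsum_congr fun e => ?_
      rw [← hsum]
      simp
    · refine (hfin₂.image fun x => (x.1 + x.2, x.1)).subset fun y hy => ?_
      refine ⟨(y.2, y.1 - y.2), ?_, by simp⟩
      rw [Function.mem_support, ← hsum]
      simpa using hy
  rw [hleft, hright]
  exact (finsum_swap _ hfin).symm

end Subst

/-! ### Scalar series in two variables -/

theorem Lau2.coeff_mul' (f g : Lau2) :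
    (f * g).coeff = convSer (LinearMap.mul ℂ ℂ) f.coeff g.coeff :=
  funext fun a => (mul_coeff_finsum f g a).2

theorem Lau2.coeff_one' : (1 : Lau2).coeff = ser₂ (1 : Lau (Lau ℂ)) := by
  ext a
  change ((HahnSeries.single 0 1 : Lau2).coeff a) = (((constL (constL 1) : Lau (Lau ℂ)).coeff a.2)).coeff a.1
  rw [HahnSeries.coeff_single, constL_coeff]
  by_cases h2 : a.2 = 0 <;> by_cases h1 : a.1 = 0 <;> simp [h1, h2, constL_coeff, Prod.ext_iff]

/-- The embedding `ι_{x₁,x₂}` of `ℂ((x₁, x₂))` into `ℂ((x₁))((x₂))`. -/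
def expand₂ : Lau2 →ₗ[ℂ] Lau (Lau ℂ) where
  toFun f := (IsLau2.exists_ser₂ f.bdd).choose
  map_add' f g := ser₂_injective <| by
    rw [(IsLau2.exists_ser₂ (f + g).bdd).choose_spec, map_add,
      (IsLau2.exists_ser₂ f.bdd).choose_spec, (IsLau2.exists_ser₂ g.bdd).choose_spec]
    rfl
  map_smul' c f := ser₂_injective <| by
    rw [(IsLau2.exists_ser₂ (c • f).bdd).choose_spec, map_smul,
      (IsLau2.exists_ser₂ f.bdd).choose_spec]
    rfl

theorem ser₂_expand₂ (f : Lau2) : ser₂ (expand₂ f) = f.coeff :=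
  (IsLau2.exists_ser₂ f.bdd).choose_spec

theorem expand₂_mul (f g : Lau2) : expand₂ (f * g) = expand₂ f * expand₂ g := ser₂_injective <| by
  rw [← conv_conv_mul, ← conv₂, ser₂_conv₂, ser₂_expand₂, ser₂_expand₂, ser₂_expand₂,
    Lau2.coeff_mul']

theorem expand₂_one : expand₂ 1 = 1 := ser₂_injective <| by
  rw [ser₂_expand₂, Lau2.coeff_one']

theorem ser₂_act_expand₂ {W : Type*} [AddCommGroup W] [Module ℂ W] (f : Lau2) (S : Lau (Lau W)) :
    ser₂ (act (expand₂ f) S) = fmul f.coeff (ser₂ S) := by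
  rw [ser₂_act, ser₂_expand₂]

/-- The substitution `f(x₁, x₂) ↦ f(φ(x, z), x)` as a map from `ℂ((x₁, x₂))` to
`ℂ((x))((z))`. -/
def substL (p : Lau ℂ) : Lau2 →ₗ[ℂ] Lau (Lau ℂ) where
  toFun f := (exists_ser₁_subst (phi_bound p).choose_spec.2 f.bdd).choose
  map_add' f g := ser₁_injective <| by
    rw [(exists_ser₁_subst (phi_bound p).choose_spec.2 (f + g).bdd).choose_spec, map_add,
      (exists_ser₁_subst (phi_bound p).choose_spec.2 f.bdd).choose_spec,
      (exists_ser₁_subst (phi_bound p).choose_spec.2 g.bdd).choose_spec]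
    exact subst_add (phi_bound p).choose_spec.2 f.bdd g.bdd
  map_smul' c f := ser₁_injective <| by
    rw [(exists_ser₁_subst (phi_bound p).choose_spec.2 (c • f).bdd).choose_spec, map_smul,
      (exists_ser₁_subst (phi_bound p).choose_spec.2 f.bdd).choose_spec]
    ext a
    simp only [subst_apply, RingHom.id_apply, Pi.smul_apply, HahnSeries.coeff_smul]
    rw [smul_finsum]
    exact finsum_congr fun d => smul_comm _ _ _

theorem ser₁_substL (p : Lau ℂ) (f : Lau2) : ser₁ (substL p f) = subst (phi p) f.coeff :=
  (exists_ser₁_subst (phi_bound p).choose_spec.2 f.bdd).choose_spec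

theorem substL_mul (p : Lau ℂ) (f g : Lau2) : substL p (f * g) = substL p f * substL p g :=
  ser₁_injective <| by
    obtain ⟨c, hc, hφ⟩ := phi_bound p
    rw [← conv_conv_mul, ← conv₂, ser₁_conv₂, ser₁_substL, ser₁_substL, ser₁_substL,
      Lau2.coeff_mul', subst_convSer hc hφ (phi_ne_zero p) _ f.bdd g.bdd]

theorem substL_single (p : Lau ℂ) (d : ℤ × ℤ) :
    ser₁ (substL p (HahnSeries.single d 1)) = fun a => substCoeff (phi p) d a := by
  ext a
  rw [ser₁_substL, subst_apply, finsum_eq_single _ d fun e he => by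
    rw [HahnSeries.coeff_single_of_ne he, smul_zero]]
  simp

theorem substL_one (p : Lau ℂ) : substL p 1 = 1 := by
  refine ser₁_injective ?_
  have : (1 : Lau2) = HahnSeries.single (0, 0) 1 := rfl
  rw [this, substL_single]
  ext a
  change (phi p ^ (0 : ℤ)).coeff a.1 (a.2 - 0) = (1 : LL).coeff a.1 a.2
  rw [zpow_zero, sub_zero]

theorem substL_pow (p : Lau ℂ) (f : Lau2) (n : ℕ) : substL p (f ^ n) = substL p f ^ n := by
  induction n with
  | zero => rw [pow_zero, pow_zero, substL_one]
  | succ n ih => rw [pow_succ, pow_succ, substL_mul, ih]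

/-! ### Injectivity of the substitution -/

section Injective

variable {p : Lau ℂ}

/-- The operator `x₁ ∂/∂x₁ - m` on `ℂ((x₁, x₂))`. -/
def euler (m : ℤ) (f : Lau2) : Lau2 where
  coeff a := ((a.1 - m : ℤ) : ℂ) * f.coeff a
  isPWO_support' := f.isPWO_support.mono fun _ ha => right_ne_zero_of_mul ha

/-- Coefficient form of ∂φᵐ/∂z = m (p(φ)/φ) φᵐ. The factor p(φ)/φ is the image of p(x)/x under
`expHom` and does not depend on m. -/
theorem phi_zpow_succ_coeff (p : Lau ℂ) (m k n : ℤ) : ((k + 1 : ℤ) : ℂ) * (phi p ^ m).coeff (k + 1) n =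
    (m : ℂ) * (expHom p (p * HahnSeries.single (-1) 1) * phi p ^ m).coeff k n := by
  have hmul : expHom p (p * HahnSeries.single (-1) 1) * phi p ^ m =
      expHom p (p * HahnSeries.single (m - 1) 1) := by
    rw [phi_zpow, ← map_mul, mul_assoc, HahnSeries.single_mul_single, mul_one, neg_add_eq_sub]
  rw [hmul]
  rcases lt_or_ge k 0 with hk | hk
  · rw [expHom_coeff_neg _ _ hk, mul_zero]
    rcases lt_or_ge (k + 1) 0 with hk' | hk'
    · rw [phi_zpow_coeff_neg _ _ hk', mul_zero]
    · rw [show k + 1 = 0 by lia, Int.cast_zero, zero_mul]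
  · obtain ⟨k, rfl⟩ := Int.eq_ofNat_of_zero_le hk
    have h1 : vecField p (HahnSeries.single m 1) =
        (m : ℂ) • (p * HahnSeries.single (m - 1) 1) := by
      have : LaurentSeries.derivative ℂ (HahnSeries.single m (1 : ℂ)) =
          HahnSeries.C (m : ℂ) * HahnSeries.single (m - 1) 1 := by
        ext n
        rw [derivative_coeff, HahnSeries.C_mul_eq_smul, HahnSeries.coeff_smul]
        by_cases h : n = m - 1
        · subst h
          simp
        · rw [HahnSeries.coeff_single_of_ne (by lia), HahnSeries.coeff_single_of_ne h]
          simp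
      rw [vecField_apply, this, ← HahnSeries.C_mul_eq_smul]
      ring
    have hit : ∀ (c : ℂ) (f : Lau ℂ), (vecField p)^[k] (c • f) = c • (vecField p)^[k] f :=
      fun c f => by rw [← Module.End.coe_pow, map_smul]
    have h2 : ((k : ℤ) + 1) = ((k + 1 : ℕ) : ℤ) := by push_cast; rfl
    rw [expHom_coeff_nat, h2, phi_zpow_coeff_nat, Function.iterate_succ_apply, h1, hit,
      HahnSeries.coeff_smul, Nat.factorial_succ]
    push_cast
    have h3 : ((k : ℂ) + 1) ≠ 0 := by exact_mod_cast Nat.succ_ne_zero k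
    have h4 : (k.factorial : ℂ) ≠ 0 := by exact_mod_cast Nat.factorial_ne_zero k
    rw [smul_eq_mul]
    field_simp

/-- Multiplication by F can be carried out monomial by monomial in f: only finitely many exponents
of F can meet a given coefficient, so the sums may be exchanged. -/
theorem mul_substL_coeff (F : Lau (Lau ℂ)) (f : Lau2) (k n : ℤ) :
    ser₁ (F * substL p f) (k, n) =
      ∑ᶠ d : ℤ × ℤ, (toLL F * phi p ^ d.1).coeff k (n - d.2) * f.coeff d := by
  obtain ⟨c, hc, hφ⟩ := phi_bound p
  obtain ⟨N, hN⟩ := f.bdd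
  have hsupp : ∀ b d, F.coeff b.1 ≠ 0 → ser₁ F b ≠ 0 →
      substCoeff (phi p) d ((k, n) - b) * f.coeff d ≠ 0 →
      b.1 ∈ Set.Icc F.order k ∧ b.2 ∈ Set.Icc (F.coeff b.1).order (n + c * (k - b.1) - 2 * N) := by
    intro b d hF hb hd
    have h1 := substCoeff_ne_zero hφ (left_ne_zero_of_mul hd)
    have h2 := hN d (right_ne_zero_of_mul hd)
    have h3 := coeff_eq_zero_of_lt hF
    have h4 := coeff_eq_zero_of_lt (f := F.coeff b.1) (i := b.2) hb
    simp only [Prod.fst_sub, Prod.snd_sub] at h1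
    exact ⟨⟨h3, by lia⟩, h4, by linarith⟩
  set S : Set (ℤ × ℤ) := ⋃ i ∈ Set.Icc F.order k,
    Prod.mk i '' Set.Icc (F.coeff i).order (n + c * (k - i) - 2 * N) with hS
  have hSfin : S.Finite := (Set.finite_Icc _ _).biUnion fun i _ => (Set.finite_Icc _ _).image _
  have hmem : ∀ b d, ser₁ F b * (substCoeff (phi p) d ((k, n) - b) * f.coeff d) ≠ 0 → b ∈ S := by
    intro b d h
    have hb := left_ne_zero_of_mul h
    have hF : F.coeff b.1 ≠ 0 := fun h0 => hb (by rw [ser₁_apply, h0]; rfl)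
    obtain ⟨h1, h2⟩ := hsupp b d hF hb (right_ne_zero_of_mul h)
    simp only [hS, Set.mem_iUnion]
    exact ⟨b.1, h1, b.2, h2, rfl⟩
  have hfin : (Function.support fun x : (ℤ × ℤ) × (ℤ × ℤ) =>
      ser₁ F x.1 * (substCoeff (phi p) x.2 ((k, n) - x.1) * f.coeff x.2)).Finite := by
    refine (hSfin.biUnion (t := fun b => Prod.mk b '' (Function.support fun d =>
      substCoeff (phi p) d ((k, n) - b) • f.coeff d))
      fun b _ => (subst_finite hφ f.bdd _).image _).subset fun x hx => ?_
    simp only [Set.mem_iUnion]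
    exact ⟨x.1, hmem x.1 x.2 hx, x.2, right_ne_zero_of_mul hx, rfl⟩
  rw [← conv_conv_mul, ← conv₂, ser₁_conv₂, convSer]
  have h1 : ∀ b, LinearMap.mul ℂ ℂ (ser₁ F b) (ser₁ (substL p f) ((k, n) - b)) =
      ∑ᶠ d, ser₁ F b * (substCoeff (phi p) d ((k, n) - b) * f.coeff d) := fun b => by
    rw [ser₁_substL, subst_apply]
    exact smul_finsum (ser₁ F b) _
  rw [finsum_congr h1, finsum_swap _ hfin]
  refine finsum_congr fun d => ?_
  have h2 : ∀ b, ser₁ F b * (substCoeff (phi p) d ((k, n) - b) * f.coeff d) =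
      f.coeff d * (ser₁ F b * substCoeff (phi p) d ((k, n) - b)) := fun b => by ring
  rw [finsum_congr h2]
  by_cases h0 : f.coeff d = 0
  · simp [h0]
  refine (smul_finsum (f.coeff d) _).symm.trans ?_
  rw [smul_eq_mul, mul_comm]
  congr 1
  rw [finsum_curry, LL.mul_coeff]
  · refine finsum_congr fun i => finsum_congr fun j => ?_
    simp only [substCoeff, Prod.fst_sub, Prod.snd_sub]
    rw [sub_right_comm]
    rfl
  · refine hSfin.subset fun b hb => hmem b d ?_
    exact mul_ne_zero (left_ne_zero_of_mul hb) (mul_ne_zero (right_ne_zero_of_mul hb) h0)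

/-- Differentiating f(φ,x) = 0 in z gives (p(φ)/φ) · (x₁∂₁f)(φ,x) = 0. For p ≠ 0 the first factor is
a nonzero element of a field, so the second vanishes; subtracting a multiple of f handles general m.
-/
theorem substL_euler_eq_zero (hp : p ≠ 0) {f : Lau2} (hf : substL p f = 0) (m : ℤ) :
    substL p (euler m f) = 0 := by
  have h0 : euler m f = euler 0 f - (m : ℂ) • f := by
    ext a
    simp only [euler, HahnSeries.coeff_sub', Pi.sub_apply, HahnSeries.coeff_smul, smul_eq_mul]
    push_cast
    ring
  rw [h0, map_sub, map_smul, hf, smul_zero]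
  refine (sub_zero (substL p (euler 0 f))).trans ?_
  set ψ : Lau (Lau ℂ) := toLL.symm (expHom p (p * HahnSeries.single (-1) 1)) with hψ
  have hne : ψ ≠ 0 := by
    intro h
    have h1 : expHom p (p * HahnSeries.single (-1) 1) = 0 := h
    rw [map_eq_zero, mul_eq_zero] at h1
    rcases h1 with h1 | h1
    · exact hp h1
    · simp at h1
  have hmul : ψ * substL p (euler 0 f) = 0 := by
    refine ser₁_injective (funext fun a => ?_)
    rw [show a = (a.1, a.2) from rfl, mul_substL_coeff]
    have h2 : ∀ d : ℤ × ℤ, (toLL ψ * phi p ^ d.1).coeff a.1 (a.2 - d.2) * (euler 0 f).coeff d =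
        ((a.1 + 1 : ℤ) : ℂ) * (substCoeff (phi p) d (a.1 + 1, a.2) * f.coeff d) := fun d => by
      rw [← mul_assoc, substCoeff, phi_zpow_succ_coeff]
      simp only [euler, sub_zero]
      rw [hψ, LinearEquiv.apply_symm_apply]
      ring
    rw [finsum_congr h2]
    refine (smul_finsum ((a.1 + 1 : ℤ) : ℂ) _).symm.trans ?_
    have h3 := congrArg (fun S => ser₁ S (a.1 + 1, a.2)) hf
    simp only [ser₁_substL, subst_apply, smul_eq_mul] at h3
    rw [h3]
    simp
  rcases (mul_eq_zero (M₀ := LL)).1 hmul with h | h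
  · exact absurd h hne
  · exact h

/-- At z = 0 only the sum of the coefficients along an antidiagonal is visible. As the kernel is
stable under x₁∂₁ - m, a product of such operators isolates a single monomial of that antidiagonal.
-/
theorem substL_injective (hp : p ≠ 0) : Function.Injective (substL p) := by
  rw [injective_iff_map_eq_zero]
  intro f hf
  obtain ⟨N, hN⟩ := f.bdd
  ext a
  rw [HahnSeries.coeff_zero]
  have key : ∀ s : Finset ℤ, ∃ g : Lau2, substL p g = 0 ∧
      ∀ d, g.coeff d = (∏ m ∈ s, ((d.1 - m : ℤ) : ℂ)) * f.coeff d := by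
    intro s
    induction s using Finset.induction_on with
    | empty => exact ⟨f, hf, by simp⟩
    | insert m s hm ih =>
      obtain ⟨g, hg, hgs⟩ := ih
      refine ⟨euler m g, substL_euler_eq_zero hp hg m, fun d => ?_⟩
      rw [Finset.prod_insert hm, mul_assoc, ← hgs]
      rfl
  -- On the antidiagonal through a, both exponents are at least N, so the first is at most a.1 + a.2
  -- - N. Every value other than a.1 is annihilated.
  obtain ⟨g, hg, hgs⟩ := key ((Finset.Icc N (a.1 + a.2 - N)).erase a.1)
  have h1 := congrArg (fun S => ser₁ S (0, a.1 + a.2)) hg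
  simp only [ser₁_substL, subst_apply] at h1
  rw [finsum_eq_single _ a, hgs] at h1
  · simp only [substCoeff, phi_zpow_coeff_zero, add_sub_cancel_right, if_true, one_smul] at h1
    refine (mul_eq_zero.1 (h1.trans rfl)).resolve_left (Finset.prod_ne_zero_iff.2 fun m hm => ?_)
    rw [Int.cast_ne_zero]
    have := Finset.ne_of_mem_erase hm
    lia
  · intro d hd
    rw [hgs]
    by_contra h
    have hf' : f.coeff d ≠ 0 := fun h0 => h (by simp [h0])
    have hΦ : substCoeff (phi p) d (0, a.1 + a.2) ≠ 0 := fun h0 => h (by simp [h0])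
    have hprod : (∏ m ∈ (Finset.Icc N (a.1 + a.2 - N)).erase a.1, ((d.1 - m : ℤ) : ℂ)) ≠ 0 :=
      fun h0 => h (by rw [h0, zero_mul, smul_zero])
    simp only [substCoeff, phi_zpow_coeff_zero, ne_eq, ite_eq_right_iff, one_ne_zero, imp_false,
      not_not] at hΦ
    have := hN d hf'
    refine Finset.prod_ne_zero_iff.1 hprod d.1 ?_ (by simp)
    rw [Finset.mem_erase, Finset.mem_Icc]
    refine ⟨fun h1 => hd (Prod.ext h1 (by lia)), by lia, by lia⟩

end Injective

/-! ### The case `p = 1` -/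

/-- Ordinary associativity with x₁ = x₂ + z thus becomes the instance p = 1 of the φ-coordinated
one. -/
theorem phi_one : phi 1 = addPhi := by
  have hx : vecField 1 (HahnSeries.single 1 1) = 1 := by
    ext n
    rw [vecField_apply, one_mul, derivative_coeff, HahnSeries.coeff_one, HahnSeries.coeff_single]
    by_cases h : n = 0 <;> simp [h]
  refine LL.ext fun k n => ?_
  change _ = ((HahnSeries.single 0 (HahnSeries.single 1 1) +
    HahnSeries.single 1 (HahnSeries.single 0 1) : Lau (Lau ℂ)).coeff k).coeff n
  rw [HahnSeries.coeff_add, HahnSeries.coeff_add, phi_eq_expHom]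
  rcases lt_or_ge k 0 with hk | hk
  · rw [expHom_coeff_neg _ _ hk, HahnSeries.coeff_single_of_ne (by lia),
      HahnSeries.coeff_single_of_ne (by lia)]
    simp
  · obtain ⟨k, rfl⟩ := Int.eq_ofNat_of_zero_le hk
    rw [expHom_coeff_nat]
    rcases k with _ | _ | k
    · simp [HahnSeries.coeff_single_of_ne]
    · simp [hx, HahnSeries.coeff_single_of_ne, HahnSeries.coeff_one]
    · rw [Function.iterate_succ_apply, Function.iterate_succ_apply, hx, vecField_one,
        iterate_map_zero, HahnSeries.coeff_single_of_ne (by push_cast; lia),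
        HahnSeries.coeff_single_of_ne (by push_cast; lia)]
      simp

/-- The polynomial `x₁ - x₂`. -/
def subVar : Lau2 := HahnSeries.single (1, 0) 1 - HahnSeries.single (0, 1) 1

/-- With this, the factor x₀ᵏ in the module axiom is the substituted value of (x₁ - x₂)ᵏ, as the
uniform notion `AssocAt` requires. -/
theorem substL_subVar : substL 1 subVar = HahnSeries.single 1 1 := by
  refine ser₁_injective (funext fun a => ?_)
  rw [subVar, map_sub, map_sub, substL_single, substL_single, Pi.sub_apply, substCoeff, substCoeff,
    zpow_one, zpow_zero, phi_one]
  have h1 : (1 : LL).coeff a.1 (a.2 - 1) = if a.1 = 0 then if a.2 = 1 then 1 else 0 else 0 := by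
    change ((1 : Lau (Lau ℂ)).coeff a.1).coeff (a.2 - 1) = _
    rw [HahnSeries.coeff_one]
    by_cases h : a.1 = 0 <;> simp [h, HahnSeries.coeff_one, sub_eq_zero]
  have h2 : addPhi.coeff a.1 (a.2 - 0) = (if a.1 = 0 then if a.2 = 1 then 1 else 0 else 0) +
      ((HahnSeries.single 1 1 : Lau (Lau ℂ)).coeff a.1).coeff a.2 := by
    change ((HahnSeries.single 0 (HahnSeries.single 1 1) +
      HahnSeries.single 1 (HahnSeries.single 0 1) : Lau (Lau ℂ)).coeff a.1).coeff (a.2 - 0) = _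
    rw [HahnSeries.coeff_add, HahnSeries.coeff_add, sub_zero]
    congr 1
    by_cases h : a.1 = 0 <;> simp [h, HahnSeries.coeff_single]
  rw [h2, h1, add_sub_cancel_left]
  rfl

theorem single_pow_one (k : ℕ) :
    (HahnSeries.single 1 1 : Lau (Lau ℂ)) ^ k = HahnSeries.single (k : ℤ) 1 := by
  simp

theorem act_single {W : Type*} [AddCommGroup W] [Module ℂ W] (k : ℤ) (S : Lau (Lau W)) (i : ℤ) :
    (act (HahnSeries.single k 1) S).coeff i = S.coeff (i - k) := by
  rw [act, conv_coeff, finsum_eq_single _ k fun j hj => by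
    rw [HahnSeries.coeff_single_of_ne hj]; simp]
  simp

/-- Taylor's formula f(x₁ - x₂) = exp(-x₂ d/dx₁) f(x₁); multiplicativity of the shift then comes for
free. -/
theorem subShift_eq_expHom (f : Lau ℂ) : subShift f = expHom (-1) f := by
  have h : ∀ k : ℕ, (vecField (-1))^[k] f =
      ((-1 : ℂ) ^ k) • (LaurentSeries.derivative ℂ)^[k] f := by
    intro k
    induction k with
    | zero => simp
    | succ k ih =>
      have hC : (-1 : Lau ℂ) = HahnSeries.C (-1) := by rw [map_neg, map_one]
      rw [Function.iterate_succ_apply', ih, vecField_apply, map_smul, Function.iterate_succ_apply',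
        hC, HahnSeries.C_mul_eq_smul, smul_smul, pow_succ']
  refine LL.ext fun k n => ?_
  change ((HahnSeries.ofPowerSeries ℤ (Lau ℂ) (PowerSeries.mk fun k =>
    ((-1 : ℂ) ^ k) • LaurentSeries.hasseDeriv ℂ k f)).coeff k).coeff n = _
  rcases lt_or_ge k 0 with hk | hk
  · rw [expHom_coeff_neg _ _ hk, PowerSeries.coeff_coe, if_pos hk]
    rfl
  · obtain ⟨k, rfl⟩ := Int.eq_ofNat_of_zero_le hk
    rw [expHom_coeff_nat, h, LaurentSeries.derivative_iterate, ← Nat.cast_smul_eq_nsmul ℂ]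
    rw [HahnSeries.ofPowerSeries_apply_coeff, PowerSeries.coeff_mk]
    have h4 : (k.factorial : ℂ) ≠ 0 := by exact_mod_cast Nat.factorial_ne_zero k
    simp only [HahnSeries.coeff_smul, smul_eq_mul]
    field_simp

/-- The embedding `e(z) ↦ e(z)` of `ℂ((z))` into `ℂ((x))((z))`. -/
def zSer : Lau ℂ →ₗ[ℂ] Lau (Lau ℂ) := mapL constL

theorem ser₁_zSer (e : Lau ℂ) : ser₁ (zSer e) = inZ e := by
  ext a
  simp only [ser₁_apply, zSer, mapL_coeff, constL_coeff, inZ]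

theorem smulL_constL {W : Type*} [AddCommGroup W] [Module ℂ W] (c : ℂ) (f : Lau W) :
    smulL (constL c) f = c • f := by
  rw [smulL, conv_constL_left]
  ext; simp

theorem act_zSer {W : Type*} [AddCommGroup W] [Module ℂ W] (e : Lau ℂ) (S : Lau (Lau W)) :
    act (zSer e) S = smulL e S := by
  rw [act, zSer, conv_mapL_left]
  have : smulL (W := W) ∘ₗ constL = LinearMap.lsmul ℂ (Lau W) :=
    LinearMap.ext₂ fun c f => smulL_constL c f
  rw [this]
  rfl

/-! ### Pairs of series related by substitution -/

/-- The series `A(x₁, x₂)` lies in `W((x₁, x₂))` and, if `T` holds, `A(φ(x, z), x) = S(x, z)`. -/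
structure SubstRel {W : Type*} [AddCommGroup W] [Module ℂ W] (T : Prop) (p : Lau ℂ)
    (A S : Lau (Lau W)) : Prop where
  isLau2 : IsLau2 (ser₂ A)
  subst_eq : T → subst (phi p) (ser₂ A) = ser₁ S

namespace SubstRel

variable {A B C : Type*} [AddCommGroup A] [Module ℂ A] [AddCommGroup B] [Module ℂ B]
  [AddCommGroup C] [Module ℂ C] {T : Prop} {p : Lau ℂ}

theorem zero : SubstRel T p (0 : Lau (Lau A)) 0 where
  isLau2 := by rw [map_zero]; exact IsLau2.zero
  subst_eq _ := by
    ext a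
    simp [subst_apply]

theorem add {f f' S S' : Lau (Lau A)} (h : SubstRel T p f S) (h' : SubstRel T p f' S') :
    SubstRel T p (f + f') (S + S') where
  isLau2 := by rw [map_add]; exact h.isLau2.add h'.isLau2
  subst_eq t := by
    obtain ⟨c, hc, hφ⟩ := phi_bound p
    rw [map_add, map_add, subst_add hφ h.isLau2 h'.isLau2, h.subst_eq t, h'.subst_eq t]

theorem conv₂ (β : A →ₗ[ℂ] B →ₗ[ℂ] C) {f S : Lau (Lau A)} {f' S' : Lau (Lau B)}
    (h : SubstRel T p f S) (h' : SubstRel T p f' S') :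
    SubstRel T p (PhiCoord.conv₂ β f f') (PhiCoord.conv₂ β S S') where
  isLau2 := by rw [ser₂_conv₂]; exact h.isLau2.convSer β h'.isLau2
  subst_eq t := by
    obtain ⟨c, hc, hφ⟩ := phi_bound p
    rw [ser₂_conv₂, ser₁_conv₂, subst_convSer hc hφ (phi_ne_zero p) β h.isLau2 h'.isLau2,
      h.subst_eq t, h'.subst_eq t]

theorem scalar (f : Lau2) : SubstRel T p (expand₂ f) (substL p f) where
  isLau2 := by rw [ser₂_expand₂]; exact f.bdd
  subst_eq _ := by rw [ser₂_expand₂, ser₁_substL]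

theorem act (f : Lau2) {g S : Lau (Lau A)} (h : SubstRel T p g S) :
    SubstRel T p (PhiCoord.act (expand₂ f) g) (PhiCoord.act (substL p f) S) :=
  conv₂ (LinearMap.lsmul ℂ A) (scalar f) h

/-- Two computations of the same substitution must agree; in `substRel_twist` this identifies
E(h,φ)E(k,x)w with E(Y(h,z)k,x)w up to a factor. -/
theorem unique (t : T) {f S S' : Lau (Lau A)} (h : SubstRel T p f S) (h' : SubstRel T p f S') :
    S = S' :=
  ser₁_injective ((h.subst_eq t).symm.trans (h'.subst_eq t))

theorem const (a : A) : SubstRel T p (constL (constL a)) (constL (constL a)) := by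
  have h := (scalar (T := T) (p := p) 1)
  rw [expand₂_one, substL_one] at h
  have hs : ∀ b : ℤ × ℤ, ser₂ (constL (constL a)) b = ser₂ (1 : Lau (Lau ℂ)) b • a := by
    intro b
    change _ = ((constL (constL (1 : ℂ))).coeff b.2).coeff b.1 • a
    rw [ser₂_apply, constL_coeff, constL_coeff]
    by_cases h2 : b.2 = 0 <;> by_cases h1 : b.1 = 0 <;> simp [h1, h2, constL_coeff]
  have hs' : ∀ b : ℤ × ℤ, ser₁ (constL (constL a)) b = ser₁ (1 : Lau (Lau ℂ)) b • a :=
    fun b => hs b.swap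
  refine ⟨?_, fun t => ?_⟩
  · obtain ⟨N, hN⟩ := h.isLau2
    refine ⟨N, fun b hb => hN b fun h0 => hb ?_⟩
    rw [hs, h0, zero_smul]
  · obtain ⟨c, hc, hφ⟩ := phi_bound p
    ext b
    rw [hs', ← h.subst_eq t, subst_apply, subst_apply]
    refine Eq.trans ?_ (map_finsum (LinearMap.toSpanSingleton ℂ A a)
      (subst_finite hφ h.isLau2 b)).symm
    refine finsum_congr fun d => ?_
    rw [hs]
    simp [mul_smul]

theorem congr_right {f S S' : Lau (Lau A)} (h : SubstRel T p f S) (hS : T → S = S') :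
    SubstRel T p f S' := ⟨h.isLau2, fun t => hS t ▸ h.subst_eq t⟩

end SubstRel

/-! ### Associativity of vertex operators -/

section Assoc

variable {P Q R U V W X : Type*} [AddCommGroup P] [Module ℂ P] [AddCommGroup Q] [Module ℂ Q]
  [AddCommGroup R] [Module ℂ R] [AddCommGroup U] [Module ℂ U] [AddCommGroup V] [Module ℂ V]
  [AddCommGroup W] [Module ℂ W] [AddCommGroup X] [Module ℂ X]

/-- The series `Y₁(u, x₁) Y₂(v, x₂) w` in `X((x₁))((x₂))`. -/
def prodL (Y₁ : U →ₗ[ℂ] W →ₗ[ℂ] Lau X) (Y₂ : V →ₗ[ℂ] R →ₗ[ℂ] Lau W) (u : U) (v : V) (w : R) :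
    Lau (Lau X) :=
  mapL (Y₁ u) (Y₂ v w)

/-- The series `Y_W(Y(u, z) v, x) w` in `X((x))((z))`. -/
def iterL (Y : P →ₗ[ℂ] Q →ₗ[ℂ] Lau R) (YW : R →ₗ[ℂ] W →ₗ[ℂ] Lau X) (u : P) (v : Q) (w : W) :
    Lau (Lau X) :=
  mapL (YW.flip w) (Y u v)

theorem ser₂_prodL (Y₁ : U →ₗ[ℂ] W →ₗ[ℂ] Lau W) (Y₂ : V →ₗ[ℂ] W →ₗ[ℂ] Lau W) (u : U) (v : V)
    (w : W) : ser₂ (prodL Y₁ Y₂ u v w) = prodSer Y₁ Y₂ u v w := rfl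

theorem ser₁_iterL (Y : V →ₗ[ℂ] V →ₗ[ℂ] Lau V) (YW : V →ₗ[ℂ] W →ₗ[ℂ] Lau W) (u v : V) (w : W) :
    ser₁ (iterL Y YW u v w) = iterSer Y YW u v w := rfl

/-- The series `f(x₁, x₂) Y_W(u, x₁) Y_W(v, x₂)` lies in `Hom(W, W((x₁, x₂)))` and, if `T` holds,
its value at `x₁ = φ(x₂, z)` is `f(φ(x₂, z), x₂) Y_W(Y(u, z) v, x₂)`. -/
def AssocAt (T : Prop) (p : Lau ℂ) (YW : V →ₗ[ℂ] W →ₗ[ℂ] Lau W) (Y : V →ₗ[ℂ] V →ₗ[ℂ] Lau V)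
    (u v : V) (f : Lau2) : Prop :=
  ∀ w, SubstRel T p (act (expand₂ f) (prodL YW YW u v w)) (act (substL p f) (iterL Y YW u v w))

/-- A clearing factor may always be enlarged. Finitely many terms with different factors are
therefore added after passing to the product of the factors. -/
theorem SubstRel.act_mul_right {T : Prop} {p : Lau ℂ} {f : Lau2} {A S : Lau (Lau W)} (g : Lau2)
    (h : SubstRel T p (PhiCoord.act (expand₂ f) A) (PhiCoord.act (substL p f) S)) :
    SubstRel T p (PhiCoord.act (expand₂ (f * g)) A) (PhiCoord.act (substL p (f * g)) S) := by
  rw [mul_comm, expand₂_mul, substL_mul, ← act_act, ← act_act]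
  exact h.act g

/-- Associativity, with factors taken from the monoid `M`. -/
def Assoc (T : Prop) (p : Lau ℂ) (M : Submonoid Lau2) (YW : V →ₗ[ℂ] W →ₗ[ℂ] Lau W)
    (Y : V →ₗ[ℂ] V →ₗ[ℂ] Lau V) : Prop :=
  ∀ u v, ∃ f ∈ M, AssocAt T p YW Y u v f

theorem iterL_add_left (Y : P →ₗ[ℂ] Q →ₗ[ℂ] Lau R) (YW : R →ₗ[ℂ] W →ₗ[ℂ] Lau X) (u u' : P) (v : Q)
    (w : W) : iterL Y YW (u + u') v w = iterL Y YW u v w + iterL Y YW u' v w := by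
  simp [iterL]

theorem iterL_add_right (Y : P →ₗ[ℂ] Q →ₗ[ℂ] Lau R) (YW : R →ₗ[ℂ] W →ₗ[ℂ] Lau X) (u : P)
    (v v' : Q) (w : W) : iterL Y YW u (v + v') w = iterL Y YW u v w + iterL Y YW u v' w := by
  simp [iterL]

theorem prodL_add_left (Y₁ : U →ₗ[ℂ] W →ₗ[ℂ] Lau X) (Y₂ : V →ₗ[ℂ] R →ₗ[ℂ] Lau W) (u u' : U) (v : V)
    (w : R) : prodL Y₁ Y₂ (u + u') v w = prodL Y₁ Y₂ u v w + prodL Y₁ Y₂ u' v w := by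
  simp [prodL]

theorem prodL_add_right (Y₁ : U →ₗ[ℂ] W →ₗ[ℂ] Lau X) (Y₂ : V →ₗ[ℂ] R →ₗ[ℂ] Lau W) (u : U)
    (v v' : V) (w : R) : prodL Y₁ Y₂ u (v + v') w = prodL Y₁ Y₂ u v w + prodL Y₁ Y₂ u v' w := by
  simp [prodL]

theorem prodL_add_vec (Y₁ : U →ₗ[ℂ] W →ₗ[ℂ] Lau X) (Y₂ : V →ₗ[ℂ] R →ₗ[ℂ] Lau W) (u : U)
    (v : V) (w w' : R) : prodL Y₁ Y₂ u v (w + w') = prodL Y₁ Y₂ u v w + prodL Y₁ Y₂ u v w' := by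
  simp [prodL]

theorem iterL_add_vec (Y : P →ₗ[ℂ] Q →ₗ[ℂ] Lau R) (YW : R →ₗ[ℂ] W →ₗ[ℂ] Lau X) (u : P)
    (v : Q) (w w' : W) : iterL Y YW u v (w + w') = iterL Y YW u v w + iterL Y YW u v w' := by
  simp [iterL]

/-- For vertex operators on a tensor product, associativity can be checked on pure tensors. -/
theorem Assoc.of_tmul {T : Prop} {p : Lau ℂ} {M : Submonoid Lau2}
    {YW : U ⊗[ℂ] V →ₗ[ℂ] W →ₗ[ℂ] Lau W} {Y : U ⊗[ℂ] V →ₗ[ℂ] U ⊗[ℂ] V →ₗ[ℂ] Lau (U ⊗[ℂ] V)}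
    (h : ∀ u v u' v', ∃ f ∈ M, AssocAt T p YW Y (u ⊗ₜ v) (u' ⊗ₜ v') f) : Assoc T p M YW Y := by
  intro s t
  induction s using TensorProduct.induction_on with
  | zero =>
    refine ⟨1, M.one_mem, fun w => ?_⟩
    have h1 : prodL YW YW 0 t w = 0 := by simp [prodL]
    have h2 : iterL Y YW 0 t w = 0 := by simp [iterL]
    rw [h1, h2, map_zero, map_zero]
    exact SubstRel.zero
  | tmul u v =>
    induction t using TensorProduct.induction_on with
    | zero =>
      refine ⟨1, M.one_mem, fun w => ?_⟩
      have h1 : prodL YW YW (u ⊗ₜ v) 0 w = 0 := by simp [prodL]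
      have h2 : iterL Y YW (u ⊗ₜ v) 0 w = 0 := by simp [iterL]
      rw [h1, h2, map_zero, map_zero]
      exact SubstRel.zero
    | tmul u' v' => exact h u v u' v'
    | add t t' ht ht' =>
      obtain ⟨f, hf, hft⟩ := ht
      obtain ⟨f', hf', hft'⟩ := ht'
      refine ⟨f * f', M.mul_mem hf hf', fun w => ?_⟩
      rw [prodL_add_right, iterL_add_right, map_add, map_add]
      have h' := (hft' w).act_mul_right f
      rw [mul_comm] at h'
      exact ((hft w).act_mul_right f').add h'
  | add s s' hs hs' =>
    obtain ⟨f, hf, hfs⟩ := hs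
    obtain ⟨f', hf', hfs'⟩ := hs'
    refine ⟨f * f', M.mul_mem hf hf', fun w => ?_⟩
    rw [prodL_add_left, iterL_add_left, map_add, map_add]
    have h' := (hfs' w).act_mul_right f
    rw [mul_comm] at h'
    exact ((hfs w).act_mul_right f').add h'

end Assoc

/-! ### Series with coefficients in `W ⊗ ℂ((x))` -/

section TensorSeries

variable {U V W X S M N P : Type*} [AddCommGroup U] [Module ℂ U] [AddCommGroup V] [Module ℂ V]
  [AddCommGroup W] [Module ℂ W] [AddCommGroup X] [Module ℂ X] [AddCommGroup S] [Module ℂ S]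
  [AddCommGroup M] [Module ℂ M] [AddCommGroup N] [Module ℂ N] [AddCommGroup P] [Module ℂ P]

theorem toLau_tmul (w : W) (f : Lau ℂ) : toLau (w ⊗ₜ f) = smulL f (constL w) := rfl

theorem toLau_tmul_coeff (w : W) (f : Lau ℂ) (n : ℤ) :
    (toLau (w ⊗ₜ[ℂ] f)).coeff n = f.coeff n • w := by
  rw [toLau_tmul, smulL, conv_constL_right]
  simp

/-- In a basis of W a tensor has finitely many coordinate series, and each can be read off from the
coefficients of its image. -/
theorem toLau_injective : Function.Injective (toLau (W := W)) := by
  rw [← LinearMap.ker_eq_bot, LinearMap.ker_eq_bot']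
  intro t ht
  let b := Module.Basis.ofVectorSpace ℂ W
  obtain ⟨c, rfl⟩ := TensorProduct.eq_repr_basis_left b t
  have hc : ∀ i, c i = 0 := by
    intro i
    ext n
    have h1 := congrArg (fun f : Lau W => b.repr (f.coeff n) i) ht
    simp only [Finsupp.sum, map_sum] at h1
    rw [HahnSeries.coeff_sum, map_sum, Finset.sum_apply', Finset.sum_eq_single i] at h1
    · simpa [toLau_tmul_coeff] using h1
    · intro k _ hk
      simp [toLau_tmul_coeff, hk]
    · intro hi
      simp [Finsupp.notMem_support_iff.1 hi]
  exact Finset.sum_eq_zero fun i _ => by simp [hc]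

/-- The product of `f(x)` with an element of `W ⊗ ℂ((x))`. -/
def mulT : Lau ℂ →ₗ[ℂ] W ⊗[ℂ] Lau ℂ →ₗ[ℂ] W ⊗[ℂ] Lau ℂ :=
  LinearMap.lTensorHom W ∘ₗ smulL (W := ℂ)

theorem mulT_tmul (a b : Lau ℂ) (w : W) : mulT a (w ⊗ₜ[ℂ] b) = w ⊗ₜ (smulL a b) := rfl

theorem smulL_eq_mul (a b : Lau ℂ) : smulL a b = a * b := conv_mul a b

theorem toLau_mulT (a : Lau ℂ) (t : W ⊗[ℂ] Lau ℂ) : toLau (mulT a t) = smulL a (toLau t) := by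
  induction t using TensorProduct.induction_on with
  | zero => simp
  | tmul w b => rw [mulT_tmul, toLau_tmul, toLau_tmul, smulL_smulL, smulL_eq_mul]
  | add s t hs ht => rw [map_add, map_add, hs, ht, map_add, map_add]

theorem extL_mulT (Y : U →ₗ[ℂ] W →ₗ[ℂ] Lau X) (u : U) (a : Lau ℂ) (t : W ⊗[ℂ] Lau ℂ) :
    extL Y u (mulT a t) = smulL a (extL Y u t) := by
  induction t using TensorProduct.induction_on with
  | zero => simp
  | tmul w b => rw [mulT_tmul, extL_tmul, extL_tmul, smulL_smulL, smulL_eq_mul]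
  | add s t hs ht => rw [map_add, map_add, hs, ht, map_add, map_add]

theorem lau_mul_comm (F G : Lau (Lau ℂ)) : F * G = G * F := mul_comm (G := LL) F G

/-- The action of `ℂ((x))((y))` on `(W ⊗ ℂ((x)))((y))`. -/
def actT : Lau (Lau ℂ) →ₗ[ℂ] Lau (W ⊗[ℂ] Lau ℂ) →ₗ[ℂ] Lau (W ⊗[ℂ] Lau ℂ) := conv mulT

theorem mapL_toLau_actT (F : Lau (Lau ℂ)) (t : Lau (W ⊗[ℂ] Lau ℂ)) :
    mapL toLau (actT F t) = act F (mapL toLau t) := by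
  rw [actT, mapL_conv, act, conv_mapL_right]
  have : (mulT (W := W)).compr₂ toLau = (smulL (W := W)).compl₂ toLau :=
    LinearMap.ext₂ fun a b => toLau_mulT a b
  rw [this]

theorem mapL_extL_actT (Y : U →ₗ[ℂ] W →ₗ[ℂ] Lau X) (u : U) (F : Lau (Lau ℂ))
    (t : Lau (W ⊗[ℂ] Lau ℂ)) : mapL (extL Y u) (actT F t) = act F (mapL (extL Y u) t) := by
  rw [actT, mapL_conv, act, conv_mapL_right]
  have : (mulT (W := W)).compr₂ (extL Y u) = (smulL (W := X)).compl₂ (extL Y u) :=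
    LinearMap.ext₂ fun a b => extL_mulT Y u a b
  rw [this]

theorem conv_extL_actT (Y : U →ₗ[ℂ] W →ₗ[ℂ] Lau X) (f : Lau U) (F : Lau (Lau ℂ))
    (t : Lau (W ⊗[ℂ] Lau ℂ)) : conv (extL Y) f (actT F t) = act F (conv (extL Y) f t) :=
  conv_left_comm _ _ _ _ (fun u a t => extL_mulT Y u a t) f F t

/-- The map `v ⊗ s ↦ s D(v)`, for a product `α` of scalars `s` with the values of `D`. -/
def scal (α : S →ₗ[ℂ] N →ₗ[ℂ] P) (D : V →ₗ[ℂ] M →ₗ[ℂ] N) : V ⊗[ℂ] S →ₗ[ℂ] M →ₗ[ℂ] P :=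
  TensorProduct.lift ((LinearMap.llcomp ℂ M N P ∘ₗ α).compl₂ D).flip

/-- For `E(h, x₁) w ∈ W ⊗ ℂ((x₁))`, the series `Y(v, x₂) E(h, x₁) w` in
`(X ⊗ ℂ((x₁)))((x₂))` as a function of `v` and `E(h, x₁) w`. -/
def prodT (Y : V →ₗ[ℂ] W →ₗ[ℂ] Lau X) : V →ₗ[ℂ] W ⊗[ℂ] Lau ℂ →ₗ[ℂ] Lau (X ⊗[ℂ] Lau ℂ) :=
  (TensorProduct.lift.equiv (.id ℂ) W (Lau ℂ) (Lau (X ⊗[ℂ] Lau ℂ))).toLinearMap ∘ₗ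
    Y.compr₂ (mapL ∘ₗ (TensorProduct.mk ℂ X (Lau ℂ)).flip).flip

theorem prodT_tmul (Y : V →ₗ[ℂ] W →ₗ[ℂ] Lau X) (v : V) (w : W) (a : Lau ℂ) :
    prodT Y v (w ⊗ₜ a) = mapL ((TensorProduct.mk ℂ X (Lau ℂ)).flip a) (Y v w) := rfl

end TensorSeries

/-! ### Scalars of the form `a(x₁) b(x₂)` -/

section Separated

theorem inFst_smul (c : ℂ) (a : Lau ℂ) : inFst (c • a) = c • inFst a := by
  rw [← HahnSeries.C_mul_eq_smul, map_mul, ← HahnSeries.C_mul_eq_smul]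
  congr 1
  exact HahnSeries.embDomain_single

theorem inSnd_smul (c : ℂ) (a : Lau ℂ) : inSnd (c • a) = c • inSnd a := by
  rw [← HahnSeries.C_mul_eq_smul, map_mul, ← HahnSeries.C_mul_eq_smul]
  congr 1
  exact HahnSeries.embDomain_single

/-- The bilinear map `(a, b) ↦ a(x₁) b(x₂)`. -/
def sepMul : Lau ℂ →ₗ[ℂ] Lau ℂ →ₗ[ℂ] Lau2 :=
  LinearMap.mk₂ ℂ (fun a b => inFst a * inSnd b)
    (fun a a' b => by rw [map_add, add_mul])
    (fun c a b => by
      rw [inFst_smul, ← HahnSeries.C_mul_eq_smul, ← HahnSeries.C_mul_eq_smul, mul_assoc])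
    (fun a b b' => by rw [map_add, mul_add])
    (fun c a b => by
      rw [inSnd_smul, ← HahnSeries.C_mul_eq_smul, ← HahnSeries.C_mul_eq_smul, mul_left_comm])

theorem inFst_coeff (a : Lau ℂ) (d : ℤ × ℤ) :
    (inFst a).coeff d = if d.2 = 0 then a.coeff d.1 else 0 := by
  obtain ⟨i, j⟩ := d
  by_cases h : j = 0
  · subst h
    rw [if_pos rfl]
    exact HahnSeries.embDomain_coeff
  · rw [if_neg h]
    refine HahnSeries.embDomain_of_notMem_range ?_
    rintro ⟨k, hk⟩
    exact h (Prod.ext_iff.1 hk).2.symm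

theorem inSnd_coeff (a : Lau ℂ) (d : ℤ × ℤ) :
    (inSnd a).coeff d = if d.1 = 0 then a.coeff d.2 else 0 := by
  obtain ⟨i, j⟩ := d
  by_cases h : i = 0
  · subst h
    rw [if_pos rfl]
    exact HahnSeries.embDomain_coeff
  · rw [if_neg h]
    refine HahnSeries.embDomain_of_notMem_range ?_
    rintro ⟨k, hk⟩
    exact h (Prod.ext_iff.1 hk).1.symm

theorem expand₂_sepMul (a b : Lau ℂ) : expand₂ (sepMul a b) = zSer b * constL a := by
  have h1 : expand₂ (inFst a) = constL a := ser₂_injective <| funext fun d => by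
    rw [ser₂_expand₂, inFst_coeff, ser₂_apply, constL_coeff]
    split_ifs <;> rfl
  have h2 : expand₂ (inSnd b) = zSer b := ser₂_injective <| funext fun d => by
    rw [ser₂_expand₂, inSnd_coeff, ser₂_apply, zSer, mapL_coeff, constL_coeff]
  rw [← h1, ← h2, ← expand₂_mul, mul_comm]
  rfl

variable {W : Type*} [AddCommGroup W] [Module ℂ W]

/-- The map `(w ⊗ a) ⊗ b ↦ w ⊗ a(x₁) b(x₂)`. -/
def sepT : (W ⊗[ℂ] Lau ℂ) ⊗[ℂ] Lau ℂ →ₗ[ℂ] W ⊗[ℂ] Lau2 :=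
  LinearMap.lTensor W (TensorProduct.lift sepMul) ∘ₗ
    (TensorProduct.assoc ℂ W (Lau ℂ) (Lau ℂ)).toLinearMap

theorem sepT_tmul (w : W) (a b : Lau ℂ) :
    sepT ((w ⊗ₜ[ℂ] a) ⊗ₜ[ℂ] b) = w ⊗ₜ[ℂ] sepMul a b := rfl

/-- The map `w ⊗ F ↦ F(φ(x, z), x) w`, with values in `(W ⊗ ℂ((x)))((z))`. -/
def substT (p : Lau ℂ) : W ⊗[ℂ] Lau2 →ₗ[ℂ] Lau (W ⊗[ℂ] Lau ℂ) :=
  TensorProduct.lift ((mapL ∘ₗ TensorProduct.mk ℂ W (Lau ℂ)).compl₂ (substL p))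

theorem substT_tmul (p : Lau ℂ) (w : W) (F : Lau2) :
    substT p (w ⊗ₜ[ℂ] F) = mapL (TensorProduct.mk ℂ W (Lau ℂ) w) (substL p F) := rfl

end Separated

/-! ### The smash product vertex operators -/

section Smash

variable {H V W : Type*} [AddCommGroup H] [Module ℂ H] [AddCommGroup V] [Module ℂ V]
  [AddCommGroup W] [Module ℂ W]
  (E : H →ₗ[ℂ] W →ₗ[ℂ] W ⊗[ℂ] Lau ℂ) (YW : V →ₗ[ℂ] W →ₗ[ℂ] Lau W)

/-- The map `((v ⊗ f) ⊗ h, w) ↦ f(x₁, x₂) Y_W(v, x₂) E(h, x₁) w`, with values in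
`(W ⊗ ℂ((x₁)))((x₂))`. -/
def twistT : (V ⊗[ℂ] Lau2) ⊗[ℂ] H →ₗ[ℂ] W →ₗ[ℂ] Lau (W ⊗[ℂ] Lau ℂ) :=
  TensorProduct.lift ((LinearMap.llcomp ℂ W (W ⊗[ℂ] Lau ℂ) (Lau (W ⊗[ℂ] Lau ℂ)) ∘ₗ
    scal (actT ∘ₗ expand₂) (prodT YW)).compl₂ E)

theorem twistT_tmul (v : V) (f : Lau2) (h : H) (w : W) :
    twistT E YW ((v ⊗ₜ f) ⊗ₜ h) w = actT (expand₂ f) (prodT YW v (E h w)) := rfl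

/-- The map `w ⊗ F ↦ F(x₁, x₂) Y_W(u, x₁) Y_W(v, x₂) w`. -/
def prodScal (u v : V) : W ⊗[ℂ] Lau2 →ₗ[ℂ] Lau (Lau W) :=
  TensorProduct.lift ((act ∘ₗ expand₂).flip ∘ₗ mapL (YW u) ∘ₗ YW v)

theorem prodScal_tmul (u v : V) (w : W) (F : Lau2) :
    prodScal YW u v (w ⊗ₜ F) = act (expand₂ F) (prodL YW YW u v w) := rfl

/-- The map `w ⊗ F ↦ F(x₁, x₂) w`. -/
def vecScal : W ⊗[ℂ] Lau2 →ₗ[ℂ] Lau (Lau W) :=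
  TensorProduct.lift ((act ∘ₗ expand₂).flip ∘ₗ constL ∘ₗ constL)

theorem vecScal_tmul (w : W) (F : Lau2) :
    vecScal (w ⊗ₜ F) = act (expand₂ F) (constL (constL w)) := rfl

theorem smulL_act (b : Lau ℂ) (F : Lau (Lau ℂ)) (A : Lau (Lau W)) :
    smulL b (act F A) = act (zSer b * F) A := by
  rw [← act_zSer, act_act]

theorem act_constL (a : Lau ℂ) (A : Lau (Lau W)) : act (constL a) A = mapL (smulL a) A := by
  rw [act, conv_constL_left]

theorem mapL_toOp_toLau (h : H) (t : W ⊗[ℂ] Lau ℂ) :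
    mapL (toOp E h) (toLau t) = vecScal (sepT (LinearMap.rTensor (Lau ℂ) (E h) t)) := by
  induction t using TensorProduct.induction_on with
  | zero => simp
  | add s t hs ht => simp only [map_add, hs, ht]
  | tmul w b =>
    rw [toLau_tmul, mapL_smulL, mapL_constL, LinearMap.rTensor_tmul, toOp, LinearMap.compr₂_apply]
    generalize E h w = s
    induction s using TensorProduct.induction_on with
    | zero => simp
    | add s t hs ht => simp only [map_add, hs, ht, TensorProduct.add_tmul]
    | tmul w a =>
      rw [sepT_tmul, vecScal_tmul, expand₂_sepMul, ← smulL_act, act_constL, mapL_constL,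
        toLau_tmul]

/-- A finite sum of terms a(x₁)b(x₂)w': a product of two H-operators lies in W ⊗ ℂ((x₁,x₂)), so x₁ =
φ(x,z) can be substituted in it before any denominator is cleared. -/
theorem prodL_toOp_toOp (h k : H) (w : W) : prodL (toOp E) (toOp E) h k w =
    vecScal (sepT (LinearMap.rTensor (Lau ℂ) (E h) (E k w))) :=
  mapL_toOp_toLau E h (E k w)

theorem substRel_vecScal (T : Prop) (p : Lau ℂ) (s : W ⊗[ℂ] Lau2) :
    SubstRel T p (vecScal s) (mapL toLau (substT p s)) := by
  induction s using TensorProduct.induction_on with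
  | zero => simpa using SubstRel.zero
  | add s t hs ht => simpa only [map_add] using hs.add ht
  | tmul w F =>
    have h : mapL toLau (substT p (w ⊗ₜ[ℂ] F)) = act (substL p F) (constL (constL w)) := by
      rw [substT_tmul, mapL_mapL, act, conv_constL_right]
      rfl
    rw [h, vecScal_tmul]
    exact (SubstRel.const w).act F

/-- Multiplying an associativity relation by F is harmless, so the factor f chosen for u, v serves
all vectors with coefficients in ℂ((x₁,x₂)) at once. -/
theorem substRel_prodScal {T : Prop} {p : Lau ℂ} {Y : V →ₗ[ℂ] V →ₗ[ℂ] Lau V} {u v : V} {f : Lau2}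
    (hf : AssocAt T p YW Y u v f) (s : W ⊗[ℂ] Lau2) :
    SubstRel T p (act (expand₂ f) (prodScal YW u v s))
      (act (substL p f) (conv (extL YW) (Y u v) (substT p s))) := by
  induction s using TensorProduct.induction_on with
  | zero => simpa using SubstRel.zero
  | add s t hs ht => simpa only [map_add] using hs.add ht
  | tmul w F =>
    have h : conv (extL YW) (Y u v) (substT p (w ⊗ₜ[ℂ] F)) =
        act (substL p F) (iterL Y YW u v w) := by
      rw [substT_tmul, conv_mapL_right, iterL, act, conv_mapL_right]
      exact conv_comm _ _ (fun a b => rfl) _ _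
    rw [h, prodScal_tmul, act_act, act_act, ← expand₂_mul, ← substL_mul, mul_comm, expand₂_mul,
      substL_mul, ← act_act, ← act_act]
    exact (hf w).act F

/-- Regroups F · Y(u,x₁)Y(v,x₂)E(h,x₁)t so that the two V-operators act on the vector E(h,x₁)t with
coefficients in ℂ((x₁,x₂)). -/
theorem mapL_extL_twistT (u v : V) (F : Lau2) (h : H) (t : W ⊗[ℂ] Lau ℂ) :
    mapL (extL YW u) (extL (twistT E YW) ((v ⊗ₜ F) ⊗ₜ h) t) =
      act (expand₂ F) (prodScal YW u v (sepT (LinearMap.rTensor (Lau ℂ) (E h) t))) := by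
  induction t using TensorProduct.induction_on with
  | zero => simp
  | add s t hs ht => simp only [map_add, hs, ht]
  | tmul w b =>
    rw [extL_tmul, mapL_smulL, twistT_tmul, mapL_extL_actT, LinearMap.rTensor_tmul]
    generalize E h w = s
    induction s using TensorProduct.induction_on with
    | zero => simp
    | add s t hs ht => simp only [map_add, hs, ht, TensorProduct.add_tmul]
    | tmul w a =>
      rw [sepT_tmul, prodScal_tmul, expand₂_sepMul, smulL_act, lau_mul_comm, ← act_act, ← act_act,
        act_constL, prodT_tmul, mapL_mapL, prodL, mapL_mapL]
      rfl

/-- The map `e ↦ e(z) F`. -/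
def zMul (F : Lau (Lau ℂ)) : Lau ℂ →ₗ[ℂ] Lau (Lau ℂ) := act.flip F ∘ₗ zSer

variable (AV : VOps V) (AH : VOps H)

/-- The map `((v ⊗ G) ⊗ h) ↦ G(x, z) Y_W(Y(u, z) v, x) E(Y(h, z) k, x) w`. -/
def iterT (u : V) (k : H) (w : W) : (V ⊗[ℂ] Lau (Lau ℂ)) ⊗[ℂ] H →ₗ[ℂ] Lau (Lau W) :=
  TensorProduct.lift (scal (S := Lau (Lau ℂ)) act ((conv ((TensorProduct.mk ℂ V H).compr₂ ((compOp YW E).flip w)) ∘ₗ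
    AV.Y u).compl₂ (AH.Y.flip k)))

theorem iterT_tmul (u : V) (k : H) (w : W) (v : V) (G : Lau (Lau ℂ)) (h : H) :
    iterT E YW AV AH u k w ((v ⊗ₜ G) ⊗ₜ h) =
      act G (conv ((TensorProduct.mk ℂ V H).compr₂ ((compOp YW E).flip w)) (AV.Y u v) (AH.Y h k)) :=
  rfl

theorem conv_extL_mapL (f : Lau V) (g : Lau H) (w : W) :
    conv (extL YW) f (mapL (E.flip w) g) =
      conv ((TensorProduct.mk ℂ V H).compr₂ ((compOp YW E).flip w)) f g := by
  rw [conv_mapL_right]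
  rfl

/-- The map `t ⊗ h ↦ Y(u, x) t ⊗ Y(h, x) k` for `t ∈ V ⊗ ℂ((x))`. -/
def smashT (u : V) (k : H) : (V ⊗[ℂ] Lau ℂ) ⊗[ℂ] H →ₗ[ℂ] Lau (V ⊗[ℂ] H) :=
  TensorProduct.lift ((conv (TensorProduct.mk ℂ V H) ∘ₗ extL AV.Y u).compl₂ (AH.Y.flip k))

theorem smashT_tmul (u : V) (k : H) (t : V ⊗[ℂ] Lau ℂ) (h : H) :
    smashT AV AH u k (t ⊗ₜ h) = conv (TensorProduct.mk ℂ V H) (extL AV.Y u t) (AH.Y h k) := rfl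

theorem iterT_zMul (u : V) (k : H) (w : W) (F : Lau (Lau ℂ)) (X : (V ⊗[ℂ] Lau ℂ) ⊗[ℂ] H) :
    iterT E YW AV AH u k w (LinearMap.rTensor H (LinearMap.lTensor V (zMul F)) X) =
      act F (mapL ((compOp YW E).flip w) (smashT AV AH u k X)) := by
  induction X using TensorProduct.induction_on with
  | zero => simp
  | add s t hs ht => simp only [map_add, hs, ht]
  | tmul t h =>
    induction t using TensorProduct.induction_on with
    | zero => simp
    | add s t hs ht => simp only [map_add, hs, ht, TensorProduct.add_tmul]
    | tmul v e =>
      rw [LinearMap.rTensor_tmul, LinearMap.lTensor_tmul, iterT_tmul, smashT_tmul, extL_tmul,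
        conv_smulL_left, mapL_smulL, mapL_conv, zMul, LinearMap.comp_apply, LinearMap.flip_apply,
        act_mul, ← act_act, ← act_zSer, act_act, act_act, lau_mul_comm]

variable {E YW AV AH} {T : Prop} {p : Lau ℂ} {M : Submonoid Lau2}

/-- The commutation relation is given in W((x₁))((x₂)), but Y(u,x₁) has to be applied in the same
variable x₁, which needs coefficients in W ⊗ ℂ((x₁)). Injectivity of `toLau` lifts the relation. -/
theorem actT_prodL_extL {h : H} {v : V} {g : Lau2} {X : (V ⊗[ℂ] Lau2) ⊗[ℂ] H}
    (hX : ∀ w, act (expand₂ g) (prodL (toOp E) YW h v w) = mapL toLau (twistT E YW X w))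
    (t : W ⊗[ℂ] Lau ℂ) :
    actT (expand₂ g) (mapL (E h) (extL YW v t)) = extL (twistT E YW) X t := by
  induction t using TensorProduct.induction_on with
  | zero => simp
  | add s t hs ht => simp only [map_add, hs, ht]
  | tmul w b =>
    rw [extL_tmul, extL_tmul, mapL_smulL, actT, conv_smulL_right]
    congr 1
    refine mapL_injective toLau_injective ?_
    rw [← hX, ← actT, mapL_toLau_actT]
    rfl

/-- For one term F Y(u,x₁)Y(v,x₂)E(h,x₁)E(k,x₂)w, the factor is a product: one part for the pair u,
v and one for h, k. It can be chosen independently of w. -/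
theorem substRel_twist (hV : Assoc T p M YW AV.Y) (hH : Assoc T p M (toOp E) AH.Y) (u : V) (k : H)
    (X : (V ⊗[ℂ] Lau2) ⊗[ℂ] H) : ∃ f ∈ M, ∀ w,
      SubstRel T p (act (expand₂ f) (mapL (extL YW u) (extL (twistT E YW) X (E k w))))
        (act (substL p f) (iterT E YW AV AH u k w
          (LinearMap.rTensor H (LinearMap.lTensor V (substL p)) X))) := by
  induction X using TensorProduct.induction_on with
  | zero => exact ⟨1, M.one_mem, fun w => by simpa using SubstRel.zero⟩
  | add s t hs ht =>
    obtain ⟨f, hf, hfs⟩ := hs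
    obtain ⟨f', hf', hft⟩ := ht
    refine ⟨f * f', M.mul_mem hf hf', fun w => ?_⟩
    have h' := (hft w).act_mul_right f
    rw [mul_comm] at h'
    simpa only [map_add, LinearMap.add_apply] using ((hfs w).act_mul_right f').add h'
  | tmul t h =>
    induction t using TensorProduct.induction_on with
    | zero => exact ⟨1, M.one_mem, fun w => by simpa using SubstRel.zero⟩
    | add s t hs ht =>
      obtain ⟨f, hf, hfs⟩ := hs
      obtain ⟨f', hf', hft⟩ := ht
      refine ⟨f * f', M.mul_mem hf hf', fun w => ?_⟩
      have h' := (hft w).act_mul_right f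
      rw [mul_comm] at h'
      simpa only [map_add, LinearMap.add_apply, TensorProduct.add_tmul] using
        ((hfs w).act_mul_right f').add h'
    | tmul v F =>
      obtain ⟨f₁, hf₁, h₁⟩ := hV u v
      obtain ⟨f₂, hf₂, h₂⟩ := hH h k
      refine ⟨f₁ * f₂, M.mul_mem hf₁ hf₂, fun w => ?_⟩
      set s := sepT (LinearMap.rTensor (Lau ℂ) (E h) (E k w)) with hs
      have h3 := (substRel_prodScal YW h₁ s).act_mul_right f₂
      rw [mapL_extL_twistT, act_act, ← expand₂_mul, mul_comm _ F, expand₂_mul, ← act_act,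
        LinearMap.rTensor_tmul, LinearMap.lTensor_tmul, iterT_tmul,
        act_act (substL p (f₁ * f₂)), lau_mul_comm (substL p (f₁ * f₂)), ← act_act (substL p F)]
      refine (h3.act F).congr_right fun t => ?_
      congr 1
      -- The two H-operators are merged first. The equality must hold in W ⊗ ℂ((x)), since
      -- Y_W(Y(u,z)v,x) is applied to it afterwards; it is obtained in W((x)) by uniqueness of the
      -- substituted value and then lifted.
      have h4 : actT (substL p f₂) (substT p s) =
          actT (substL p f₂) (mapL (E.flip w) (AH.Y h k)) := by
        refine mapL_injective toLau_injective ?_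
        rw [mapL_toLau_actT, mapL_toLau_actT]
        refine ((substRel_vecScal T p s).act f₂).unique t ?_
        rw [hs, ← prodL_toOp_toOp]
        exact h₂ w
      rw [substL_mul, ← act_act, ← act_act, ← conv_extL_actT, h4, conv_extL_actT, conv_extL_mapL]

variable (E YW AV AH) [Coalgebra ℂ H] (D : H →ₗ[ℂ] V →ₗ[ℂ] V ⊗[ℂ] Lau ℂ)

theorem smash_eq_smashT (u v : V) (h k : H) : (smash AV AH D).Y (u ⊗ₜ h) (v ⊗ₜ k) =
    smashT AV AH u k (LinearMap.rTensor H (D.flip v) (Coalgebra.comul (R := ℂ) h)) := by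
  rw [smash_tmul AV AH D u v h k (Coalgebra.Repr.arbitrary ℂ h)]
  conv_rhs => rw [← (Coalgebra.Repr.arbitrary ℂ h).eq]
  simp only [map_sum, LinearMap.rTensor_tmul, smashT_tmul, LinearMap.flip_apply]

/-- The commutation relation of `E(h, x₁)` and `Y_W(v, x₂)`: after multiplication by some
`g ∈ M`, `E(h, x₁) Y_W(v, x₂)` is a finite sum of series `f(x₁, x₂) Y_W(v', x₂) E(h', x₁)` where
`∑ (v' ⊗ f(φ(x, z), x)) ⊗ h' = g(φ(x, z), x) ∑ D(h₍₁₎, z) v ⊗ h₍₂₎` if `T` holds. -/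
def Twist (E : H →ₗ[ℂ] W →ₗ[ℂ] W ⊗[ℂ] Lau ℂ) (YW : V →ₗ[ℂ] W →ₗ[ℂ] Lau W)
    (D : H →ₗ[ℂ] V →ₗ[ℂ] V ⊗[ℂ] Lau ℂ) (T : Prop) (p : Lau ℂ) (M : Submonoid Lau2) : Prop :=
  ∀ h v, ∃ g ∈ M, ∃ X : (V ⊗[ℂ] Lau2) ⊗[ℂ] H,
    (T → LinearMap.rTensor H (LinearMap.lTensor V (substL p)) X =
      LinearMap.rTensor H (LinearMap.lTensor V (zMul (substL p g)))
        (LinearMap.rTensor H (D.flip v) (Coalgebra.comul (R := ℂ) h))) ∧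
    ∀ w, act (expand₂ g) (prodL (toOp E) YW h v w) = mapL toLau (twistT E YW X w)

variable {E YW AV AH D}

/-- The factor g clears the commutation relation and f then handles its finitely many terms. The
same statement with W = V and `E` equal to `D` also serves for the smash product. -/
theorem assoc_sharp (hV : Assoc T p M YW AV.Y) (hH : Assoc T p M (toOp E) AH.Y)
    (hT : Twist E YW D T p M) : Assoc T p M (sharp YW E) (smash AV AH D).Y := by
  refine Assoc.of_tmul fun u h v k => ?_
  obtain ⟨g, hg, X, hX, hX'⟩ := hT h v
  obtain ⟨f, hf, hfX⟩ := substRel_twist hV hH u k X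
  refine ⟨f * g, M.mul_mem hf hg, fun w => ?_⟩
  have h1 : act (expand₂ (f * g)) (prodL (sharp YW E) (sharp YW E) (u ⊗ₜ h) (v ⊗ₜ k) w) =
      act (expand₂ f) (mapL (extL YW u) (extL (twistT E YW) X (E k w))) := by
    rw [← actT_prodL_extL hX', mapL_extL_actT, act_act, ← expand₂_mul]
    rfl
  rw [h1]
  refine (hfX w).congr_right fun t => ?_
  -- The substituted scalars of X equal g(φ,x) times those of D(h₍₁₎,z)v. The common factor leaves
  -- the sum, and what remains is the smash product.
  rw [hX t, iterT_zMul, act_act, ← substL_mul, ← smash_eq_smashT]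
  rfl

end Smash

/-! ### Tensor products and pullbacks of vertex operators -/

section TensorAssoc

variable {U V W X : Type*} [AddCommGroup U] [Module ℂ U] [AddCommGroup V] [Module ℂ V]
  [AddCommGroup W] [Module ℂ W] [AddCommGroup X] [Module ℂ X]
  {T : Prop} {p : Lau ℂ} {M : Submonoid Lau2}

theorem prodL_tensorOp (Y₁ : U →ₗ[ℂ] W →ₗ[ℂ] Lau W) (Y₂ : V →ₗ[ℂ] X →ₗ[ℂ] Lau X) (u u' : U)
    (v v' : V) (w : W) (x : X) :
    prodL (tensorOp Y₁ Y₂) (tensorOp Y₁ Y₂) (u ⊗ₜ v) (u' ⊗ₜ v') (w ⊗ₜ x) =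
      conv₂ (TensorProduct.mk ℂ W X) (prodL Y₁ Y₁ u u' w) (prodL Y₂ Y₂ v v' x) := by
  rw [prodL, tensorOp_tmul, mapL_conv, conv₂, prodL, prodL, conv_mapL_left, conv_mapL_right]
  congr 2

theorem iterL_tensorOp (Y₁ : U →ₗ[ℂ] W →ₗ[ℂ] Lau W) (Y₂ : V →ₗ[ℂ] X →ₗ[ℂ] Lau X)
    (Z₁ : U →ₗ[ℂ] U →ₗ[ℂ] Lau U) (Z₂ : V →ₗ[ℂ] V →ₗ[ℂ] Lau V) (u u' : U)
    (v v' : V) (w : W) (x : X) :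
    iterL (tensorOp Z₁ Z₂) (tensorOp Y₁ Y₂) (u ⊗ₜ v) (u' ⊗ₜ v') (w ⊗ₜ x) =
      conv₂ (TensorProduct.mk ℂ W X) (iterL Z₁ Y₁ u u' w) (iterL Z₂ Y₂ v v' x) := by
  rw [iterL, tensorOp_tmul, mapL_conv, conv₂, iterL, iterL, conv_mapL_left, conv_mapL_right]
  congr 2

/-- Products and iterates of tensor operators are tensor products of those of the factors, and
substitution respects such products; the two clearing factors multiply. -/
theorem Assoc.tensorOp {Y₁ : U →ₗ[ℂ] W →ₗ[ℂ] Lau W} {Y₂ : V →ₗ[ℂ] X →ₗ[ℂ] Lau X}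
    {Z₁ : U →ₗ[ℂ] U →ₗ[ℂ] Lau U} {Z₂ : V →ₗ[ℂ] V →ₗ[ℂ] Lau V}
    (h₁ : Assoc T p M Y₁ Z₁) (h₂ : Assoc T p M Y₂ Z₂) :
    Assoc T p M (tensorOp Y₁ Y₂) (PhiCoord.tensorOp Z₁ Z₂) := by
  refine Assoc.of_tmul fun u v u' v' => ?_
  obtain ⟨f, hf, h⟩ := h₁ u u'
  obtain ⟨f', hf', h'⟩ := h₂ v v'
  refine ⟨f * f', M.mul_mem hf hf', fun y => ?_⟩
  induction y using TensorProduct.induction_on with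
  | zero =>
    have e1 : prodL (PhiCoord.tensorOp Y₁ Y₂) (PhiCoord.tensorOp Y₁ Y₂) (u ⊗ₜ v) (u' ⊗ₜ v') 0 =
      0 := by simp [prodL]
    have e2 : iterL (PhiCoord.tensorOp Z₁ Z₂) (PhiCoord.tensorOp Y₁ Y₂) (u ⊗ₜ v) (u' ⊗ₜ v') 0 =
      0 := by simp [iterL]
    rw [e1, e2, map_zero, map_zero]
    exact SubstRel.zero
  | add y y' hy hy' =>
    rw [prodL_add_vec, iterL_add_vec, map_add, map_add]
    exact hy.add hy'
  | tmul w x =>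
    rw [prodL_tensorOp, iterL_tensorOp, expand₂_mul, substL_mul, ← act_act, ← act_act,
      ← conv₂_act_right, ← conv₂_act_left, ← conv₂_act_right, ← conv₂_act_left]
    exact (h w).conv₂ _ (h' x)

theorem Assoc.comp {YW : V →ₗ[ℂ] W →ₗ[ℂ] Lau W} {Y : V →ₗ[ℂ] V →ₗ[ℂ] Lau V}
    (h : Assoc T p M YW Y) {Z : U →ₗ[ℂ] U →ₗ[ℂ] Lau U} (α : U →ₗ[ℂ] V)
    (hα : ∀ u u', mapL α (Z u u') = Y (α u) (α u')) : Assoc T p M (YW ∘ₗ α) Z := by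
  intro u u'
  obtain ⟨f, hf, hfu⟩ := h (α u) (α u')
  refine ⟨f, hf, fun w => ?_⟩
  have h1 : iterL Z (YW ∘ₗ α) u u' w = iterL Y YW (α u) (α u') w := by
    rw [iterL, iterL, ← hα, mapL_mapL]
    rfl
  rw [h1]
  exact hfu w

theorem tensorOp_comp {A B H P Q : Type*} [AddCommGroup H] [Module ℂ H] [AddCommGroup A]
    [Module ℂ A] [AddCommGroup B] [Module ℂ B] [AddCommGroup P] [Module ℂ P] [AddCommGroup Q] [Module ℂ Q]
    (Y : A →ₗ[ℂ] P →ₗ[ℂ] Lau P) (Z : H →ₗ[ℂ] Q →ₗ[ℂ] Lau Q) (α : B →ₗ[ℂ] A) (x : B ⊗[ℂ] H)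
    (y : P ⊗[ℂ] Q) :
    tensorOp (Y ∘ₗ α) Z x y = tensorOp Y Z (LinearMap.rTensor H α x) y := by
  induction x using TensorProduct.induction_on with
  | zero => simp
  | add x x' hx hx' => simp only [map_add, LinearMap.add_apply, hx, hx']
  | tmul b h =>
    induction y using TensorProduct.induction_on with
    | zero => simp
    | add x x' hx hx' => simp only [map_add, hx, hx']
    | tmul c d => rfl

end TensorAssoc

/-! ### The coaction of H on the smash product and associativity by pullback -/

section SmashHom

variable {H V : Type*} [AddCommGroup H] [Module ℂ H] [Coalgebra ℂ H] [AddCommGroup V] [Module ℂ V]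

/-- The map `v ⊗ h ↦ ∑ (v ⊗ h₍₁₎) ⊗ h₍₂₎`. -/
def coact (V H : Type*) [AddCommGroup H] [Module ℂ H] [Coalgebra ℂ H] [AddCommGroup V]
    [Module ℂ V] : V ⊗[ℂ] H →ₗ[ℂ] (V ⊗[ℂ] H) ⊗[ℂ] H :=
  (TensorProduct.assoc ℂ V H H).symm.toLinearMap ∘ₗ LinearMap.lTensor V Coalgebra.comul

theorem coact_tmul (v : V) (h : H) : coact V H (v ⊗ₜ h) =
    (TensorProduct.assoc ℂ V H H).symm (v ⊗ₜ Coalgebra.comul (R := ℂ) h) := rfl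

theorem coact_coassoc (x : V ⊗[ℂ] H) : LinearMap.rTensor H (coact V H) (coact V H x) =
    (TensorProduct.assoc ℂ (V ⊗[ℂ] H) H H).symm
      (LinearMap.lTensor (V ⊗[ℂ] H) Coalgebra.comul (coact V H x)) := by
  induction x using TensorProduct.induction_on with
  | zero => simp
  | add x y hx hy => simp only [map_add, hx, hy]
  | tmul v h =>
    let Ψ : H ⊗[ℂ] (H ⊗[ℂ] H) →ₗ[ℂ] ((V ⊗[ℂ] H) ⊗[ℂ] H) ⊗[ℂ] H :=
      (TensorProduct.assoc ℂ (V ⊗[ℂ] H) H H).symm.toLinearMap ∘ₗ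
        (TensorProduct.assoc ℂ V H (H ⊗[ℂ] H)).symm.toLinearMap ∘ₗ
        TensorProduct.mk ℂ V (H ⊗[ℂ] (H ⊗[ℂ] H)) v
    rw [coact_tmul]
    have h1 : ∀ t : H ⊗[ℂ] H, (TensorProduct.assoc ℂ (V ⊗[ℂ] H) H H).symm
        (LinearMap.lTensor (V ⊗[ℂ] H) Coalgebra.comul ((TensorProduct.assoc ℂ V H H).symm
          (v ⊗ₜ t))) = Ψ (LinearMap.lTensor H Coalgebra.comul t) := by
      intro t
      induction t using TensorProduct.induction_on with
      | zero => simp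
      | add s t hs ht => simp only [map_add, TensorProduct.tmul_add, hs, ht]
      | tmul l r => rfl
    have h2 : ∀ t : H ⊗[ℂ] H, LinearMap.rTensor H (coact V H) ((TensorProduct.assoc ℂ V H H).symm
        (v ⊗ₜ t)) =
        Ψ (TensorProduct.assoc ℂ H H H (LinearMap.rTensor H Coalgebra.comul t)) := by
      intro t
      induction t using TensorProduct.induction_on with
      | zero => simp
      | add s t hs ht => simp only [map_add, TensorProduct.tmul_add, hs, ht]
      | tmul l r =>
        rw [TensorProduct.assoc_symm_tmul, LinearMap.rTensor_tmul, LinearMap.rTensor_tmul,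
          coact_tmul]
        generalize Coalgebra.comul (R := ℂ) l = s
        induction s using TensorProduct.induction_on with
        | zero => simp
        | add s t hs ht =>
          simp only [map_add, TensorProduct.tmul_add, TensorProduct.add_tmul, hs, ht]
        | tmul a b => rfl
    rw [h1, h2, Coalgebra.coassoc_apply]

variable {AV : VOps V} {AH : VOps H} {D : H →ₗ[ℂ] V →ₗ[ℂ] V ⊗[ℂ] Lau ℂ}

theorem smash_eq_comp :
    (smash AV AH D).Y = tensorOp (compOp AV.Y D) AH.Y ∘ₗ coact V H := rfl

/-- Δ applied to Y(h₍₂₎,x)k splits because Δ is a homomorphism; coassociativity distributes the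
resulting three factors of h as the right side requires. -/
theorem mapL_coact_smash (hΔ : IsHom AH (tensorOps AH AH) Coalgebra.comul) (x y : V ⊗[ℂ] H) :
    mapL (coact V H) ((smash AV AH D).Y x y) =
      tensorOp (smash AV AH D).Y AH.Y (coact V H x) (coact V H y) := by
  rw [smash_eq_comp, tensorOp_comp, coact_coassoc, LinearMap.comp_apply]
  generalize coact V H x = z
  induction z using TensorProduct.induction_on with
  | zero => simp
  | add x x' hx hx' => simp only [map_add, LinearMap.add_apply, hx, hx']
  | tmul a r =>
    induction y using TensorProduct.induction_on with
    | zero => simp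
    | add x x' hx hx' => simp only [map_add, hx, hx']
    | tmul v k =>
      have h1 : mapL Coalgebra.comul (AH.Y r k) = tensorOp AH.Y AH.Y
          (Coalgebra.comul (R := ℂ) r) (Coalgebra.comul (R := ℂ) k) := by
        ext n
        exact hΔ.map_Y r k n
      have h2 : ∀ s t : H ⊗[ℂ] H, conv ((TensorProduct.mk ℂ V (H ⊗[ℂ] H)).compr₂
          (TensorProduct.assoc ℂ V H H).symm.toLinearMap) (compOp AV.Y D a v)
          (tensorOp AH.Y AH.Y s t) =
          tensorOp (tensorOp (compOp AV.Y D) AH.Y) AH.Y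
            ((TensorProduct.assoc ℂ (V ⊗[ℂ] H) H H).symm (a ⊗ₜ s))
            ((TensorProduct.assoc ℂ V H H).symm (v ⊗ₜ t)) := by
        intro s t
        induction s using TensorProduct.induction_on with
        | zero => simp
        | add s s' hs hs' =>
          simp only [map_add, LinearMap.add_apply, TensorProduct.tmul_add, hs, hs']
        | tmul l m =>
          induction t using TensorProduct.induction_on with
          | zero => simp
          | add s s' hs hs' => simp only [map_add, TensorProduct.tmul_add, hs, hs']
          | tmul c d =>
            rw [TensorProduct.assoc_symm_tmul, TensorProduct.assoc_symm_tmul, tensorOp_tmul,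
              tensorOp_tmul, tensorOp_tmul]
            exact (conv_assoc _ _ _ _ (fun a b c => rfl) _ _ _).symm
      rw [tensorOp_tmul, mapL_conv, LinearMap.lTensor_tmul, coact_tmul, ← h2, ← h1,
        conv_mapL_right]
      rfl

/-- V carries an associative action of V♯H by `assoc_sharp`. The smash operators are the tensor
product of this action with H, restricted along `coact`. -/
theorem assoc_smash {T : Prop} {p : Lau ℂ} {M : Submonoid Lau2}
    (hΔ : IsHom AH (tensorOps AH AH) Coalgebra.comul)
    (hV : Assoc T p M AV.Y AV.Y) (hH : Assoc T p M AH.Y AH.Y) (hD : Assoc T p M (toOp D) AH.Y)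
    (hT : Twist D AV.Y D T p M) : Assoc T p M (smash AV AH D).Y (smash AV AH D).Y :=
  ((assoc_sharp hV hD hT).tensorOp hH).comp (coact V H) (mapL_coact_smash hΔ)

end SmashHom

/-! ### Rescaling of the variable -/

section Scale

variable {A B C : Type*} [AddCommGroup A] [Module ℂ A] [AddCommGroup B] [Module ℂ B]
  [AddCommGroup C] [Module ℂ C]

/-- The map `f(x) ↦ f(c x)`. -/
def scale (c : ℂˣ) : Lau A →ₗ[ℂ] Lau A where
  toFun f := ⟨fun n => (c : ℂ) ^ n • f.coeff n, f.isPWO_support.mono fun n hn h0 => hn (by simp [h0])⟩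
  map_add' f g := by ext; simp
  map_smul' a f := by ext n; exact smul_comm _ _ _

@[simp] theorem scale_coeff (c : ℂˣ) (f : Lau A) (n : ℤ) :
    (scale c f).coeff n = (c : ℂ) ^ n • f.coeff n := rfl

theorem scale_conv (c : ℂˣ) (β : A →ₗ[ℂ] B →ₗ[ℂ] C) (f : Lau A) (g : Lau B) :
    scale c (conv β f g) = conv β (scale c f) (scale c g) := by
  ext n
  rw [scale_coeff, conv_coeff, conv_coeff, smul_finsum]
  refine finsum_congr fun i => ?_
  rw [scale_coeff, scale_coeff, map_smul, map_smul, LinearMap.smul_apply, smul_smul,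
    ← zpow_add₀ c.ne_zero, sub_add_cancel]

theorem scale_constL (c : ℂˣ) (a : A) : scale c (constL a) = constL a := by
  ext n
  rw [scale_coeff, constL_coeff]
  split_ifs with h <;> simp [h]

theorem mapL_toLau (S : A →ₗ[ℂ] B) (t : A ⊗[ℂ] Lau ℂ) :
    mapL S (toLau t) = toLau (LinearMap.rTensor (Lau ℂ) S t) := by
  induction t using TensorProduct.induction_on with
  | zero => simp
  | add s t hs ht => simp only [map_add, hs, ht]
  | tmul a f => rw [toLau_tmul, mapL_smulL, mapL_constL, LinearMap.rTensor_tmul, toLau_tmul]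

theorem scale_toLau (c : ℂˣ) (t : A ⊗[ℂ] Lau ℂ) :
    scale c (toLau t) = toLau (LinearMap.lTensor A (scale c) t) := by
  induction t using TensorProduct.induction_on with
  | zero => simp
  | add s t hs ht => simp only [map_add, hs, ht]
  | tmul a f =>
    rw [toLau_tmul, smulL, scale_conv, scale_constL, LinearMap.lTensor_tmul, toLau_tmul, smulL]

/-- If `Y'(x) = Y(c x)`, then `f(c x) Y'(x) a = (f(x) Y(x) a)(c x)`. -/
theorem extL_lTensor_scale {P Q : Type*} [AddCommGroup P] [Module ℂ P] [AddCommGroup Q] [Module ℂ Q]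
    (c : ℂˣ) (Y : P →ₗ[ℂ] A →ₗ[ℂ] Lau B) (Y' : Q →ₗ[ℂ] A →ₗ[ℂ] Lau B) (u : P) (u' : Q)
    (h : ∀ a, Y' u' a = scale c (Y u a)) (t : A ⊗[ℂ] Lau ℂ) :
    extL Y' u' (LinearMap.lTensor A (scale c) t) = scale c (extL Y u t) := by
  induction t using TensorProduct.induction_on with
  | zero => simp
  | add s t hs ht => simp only [map_add, hs, ht]
  | tmul a f => rw [LinearMap.lTensor_tmul, extL_tmul, extL_tmul, h, smulL, scale_conv]

theorem extL_vacuum {U W : Type*} [AddCommGroup U] [Module ℂ U] [AddCommGroup W] [Module ℂ W]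
    (Y : U →ₗ[ℂ] W →ₗ[ℂ] Lau W) (e : U) (h : ∀ w, Y e w = constL w) (t : W ⊗[ℂ] Lau ℂ) :
    extL Y e t = toLau t := by
  induction t using TensorProduct.induction_on with
  | zero => simp
  | add s t hs ht => simp only [map_add, hs, ht]
  | tmul w f => rw [extL_tmul, h, toLau_tmul]

end Scale

/-! ### Vacuum, creation property and group action -/

section Structure

variable {G : Type*} [Group G] {H V W : Type*} [AddCommGroup H] [Module ℂ H]
  [AddCommGroup V] [Module ℂ V] [AddCommGroup W] [Module ℂ W]
  {AV : VOps V} {AH : VOps H}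

theorem compOp_vacuum {YW : V →ₗ[ℂ] W →ₗ[ℂ] Lau W} {E : H →ₗ[ℂ] W →ₗ[ℂ] W ⊗[ℂ] Lau ℂ} {v : V} {h : H}
    (hv : ∀ w, YW v w = constL w) (hh : ∀ w, toOp E h w = constL w) (w : W) :
    compOp YW E (v ⊗ₜ h) w = constL w := by
  rw [compOp_tmul, extL_vacuum YW v hv]
  exact hh w

/-- The equivariance of `D` is an identity in V((x)); it has to be lifted to V ⊗ ℂ((x)) before
Y(u,x) can be applied in the same variable. -/
theorem compOp_conj {D : H →ₗ[ℂ] V →ₗ[ℂ] V ⊗[ℂ] Lau ℂ} {RV : V →ₗ[ℂ] V} {RH : H →ₗ[ℂ] H} {c : ℂˣ}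
    (hV : ∀ u v, mapL RV (AV.Y u v) = scale c (AV.Y (RV u) (RV v)))
    (hR : ∀ h v, mapL RV (toOp D h v) = scale c (toOp D (RH h) (RV v))) (u v : V) (h : H) :
    mapL RV (compOp AV.Y D (u ⊗ₜ h) v) = scale c (compOp AV.Y D (RV u ⊗ₜ RH h) (RV v)) := by
  have h1 : LinearMap.rTensor (Lau ℂ) RV (D h v) =
      LinearMap.lTensor V (scale c) (D (RH h) (RV v)) := by
    refine toLau_injective ?_
    rw [← mapL_toLau, ← scale_toLau]
    exact hR h v
  have h2 : ∀ t, mapL RV (extL AV.Y u t) =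
      extL (AV.Y.compr₂ (scale c)) (RV u) (LinearMap.rTensor (Lau ℂ) RV t) := by
    intro t
    induction t using TensorProduct.induction_on with
    | zero => simp
    | add s t hs ht => simp only [map_add, hs, ht]
    | tmul w f =>
      rw [extL_tmul, mapL_smulL, hV, LinearMap.rTensor_tmul, extL_tmul]
      rfl
  rw [compOp_tmul, compOp_tmul, h2, h1]
  exact extL_lTensor_scale c _ _ _ _ (fun a => rfl) _

theorem sharp_equivariant {YW : V →ₗ[ℂ] W →ₗ[ℂ] Lau W} {E : H →ₗ[ℂ] W →ₗ[ℂ] W ⊗[ℂ] Lau ℂ}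
    {RV : V →ₗ[ℂ] V} {RH : H →ₗ[ℂ] H} {c : ℂˣ} (hV : ∀ v w, YW (RV v) w = scale c (YW v w))
    (hH : ∀ h w, toOp E (RH h) w = scale c (toOp E h w)) (x : V ⊗[ℂ] H) (w : W) :
    sharp YW E (TensorProduct.map RV RH x) w = scale c (sharp YW E x w) := by
  induction x using TensorProduct.induction_on with
  | zero => simp
  | add x x' hx hx' => simp only [map_add, LinearMap.add_apply, hx, hx']
  | tmul v h =>
    have h1 : E (RH h) w = LinearMap.lTensor W (scale c) (E h w) := by
      refine toLau_injective ?_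
      rw [← scale_toLau]
      exact hH h w
    rw [TensorProduct.map_tmul, sharp, compOp_tmul, compOp_tmul, h1]
    exact extL_lTensor_scale c _ _ _ _ (fun a => hV v a) _

variable [Coalgebra ℂ H] {D : H →ₗ[ℂ] V →ₗ[ℂ] V ⊗[ℂ] Lau ℂ}

theorem smash_vacuum (hΔ : IsHom AH (tensorOps AH AH) Coalgebra.comul)
    (hV : ∀ v, AV.Y AV.vac v = constL v) (hD : ∀ v, toOp D AH.vac v = constL v)
    (hH : ∀ h, AH.Y AH.vac h = constL h) (x : V ⊗[ℂ] H) :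
    (smash AV AH D).Y (smash AV AH D).vac x = constL x := by
  have h1 : coact V H (smash AV AH D).vac = (AV.vac ⊗ₜ AH.vac) ⊗ₜ AH.vac := by
    change coact V H (AV.vac ⊗ₜ AH.vac) = _
    rw [coact_tmul, hΔ.map_vac]
    rfl
  rw [smash_eq_comp, LinearMap.comp_apply, h1]
  induction x using TensorProduct.induction_on with
  | zero => simp
  | add x y hx hy => simp only [map_add, hx, hy]
  | tmul v h =>
    rw [tensorOp_tmul, compOp_vacuum hV hD, hH, conv_constL_left, mapL_constL]
    rfl

/-- On the vacuum `D` reduces to the counit, and the counit axiom collapses the sum over Δ(h) to h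
itself. -/
theorem smash_creation (hD : ∀ h, D h AV.vac = Coalgebra.counit (R := ℂ) h • (AV.vac ⊗ₜ 1))
    (u : V) (h : H) : (smash AV AH D).Y (u ⊗ₜ h) (smash AV AH D).vac =
      conv (TensorProduct.mk ℂ V H) (AV.Y u AV.vac) (AH.Y h AH.vac) := by
  have h1 : ∀ t : H ⊗[ℂ] H, smashT AV AH u AH.vac (LinearMap.rTensor H (D.flip AV.vac) t) =
      conv (TensorProduct.mk ℂ V H) (AV.Y u AV.vac)
        (AH.Y (TensorProduct.lid ℂ H (LinearMap.rTensor H Coalgebra.counit t)) AH.vac) := by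
    intro t
    induction t using TensorProduct.induction_on with
    | zero => simp
    | add s t hs ht => simp only [map_add, LinearMap.add_apply, hs, ht]
    | tmul l r =>
      rw [LinearMap.rTensor_tmul, LinearMap.rTensor_tmul, smashT_tmul, LinearMap.flip_apply, hD,
        TensorProduct.lid_tmul, map_smul, map_smul, LinearMap.smul_apply, map_smul,
        LinearMap.smul_apply, map_smul, extL_tmul, smulL_one]
  change (smash AV AH D).Y (u ⊗ₜ h) (AV.vac ⊗ₜ AH.vac) = _
  rw [smash_eq_smashT, h1, Coalgebra.rTensor_counit_comul, TensorProduct.lid_tmul, one_smul]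

theorem conv_coeff_of_nonneg {A B C : Type*} [AddCommGroup A] [Module ℂ A] [AddCommGroup B]
    [Module ℂ B] [AddCommGroup C] [Module ℂ C] (β : A →ₗ[ℂ] B →ₗ[ℂ] C) {f : Lau A} {g : Lau B}
    (hf : ∀ n < 0, f.coeff n = 0) (hg : ∀ n < 0, g.coeff n = 0) :
    (∀ n < 0, (conv β f g).coeff n = 0) ∧ (conv β f g).coeff 0 = β (f.coeff 0) (g.coeff 0) := by
  constructor
  · intro n hn
    rw [conv_coeff]
    refine finsum_eq_zero_of_forall_eq_zero fun i => ?_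
    rcases lt_or_ge i 0 with hi | hi
    · rw [hf i hi]; simp
    · rw [hg (n - i) (by lia)]; simp
  · rw [conv_coeff, finsum_eq_single _ 0, sub_zero]
    intro i hi
    rcases lt_or_gt_of_ne hi with hi | hi
    · rw [hf i hi]; simp
    · rw [hg (0 - i) (by lia)]; simp

theorem smash_creation_coeff (hD : ∀ h, D h AV.vac = Coalgebra.counit (R := ℂ) h • (AV.vac ⊗ₜ 1))
    (hV : IsNVA AV) (hH : IsNVA AH) (x : V ⊗[ℂ] H) :
    (∀ n < 0, ((smash AV AH D).Y x (smash AV AH D).vac).coeff n = 0) ∧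
      ((smash AV AH D).Y x (smash AV AH D).vac).coeff 0 = x := by
  induction x using TensorProduct.induction_on with
  | zero => simp
  | add x y hx hy =>
    simp only [map_add, LinearMap.add_apply, HahnSeries.coeff_add]
    exact ⟨fun n hn => by rw [hx.1 n hn, hy.1 n hn, add_zero], by rw [hx.2, hy.2]⟩
  | tmul u h =>
    rw [smash_creation hD]
    have := conv_coeff_of_nonneg (TensorProduct.mk ℂ V H) (hV.creation_neg u) (hH.creation_neg h)
    rw [hV.creation_zero, hH.creation_zero] at this
    exact this

theorem conj_iff {A : VOps V} (R : Representation ℂ G V) (g : G) (c : ℂˣ) :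
    (∀ v w n, R g ((A.Y v (R g⁻¹ w)).coeff n) = (c : ℂ) ^ n • (A.Y (R g v) w).coeff n) ↔
      ∀ v w, mapL (R g) (A.Y v w) = scale c (A.Y (R g v) (R g w)) := by
  constructor
  · intro h v w
    ext n
    have := h v (R g w) n
    rwa [Representation.inv_self_apply] at this
  · intro h v w n
    have := congrArg (fun f : Lau V => f.coeff n) (h v (R g⁻¹ w))
    simpa [Representation.self_inv_apply] using this

theorem coact_map {RV : V →ₗ[ℂ] V} {RH : H →ₗ[ℂ] H}
    (hΔ : Coalgebra.comul ∘ₗ RH = TensorProduct.map RH RH ∘ₗ (Coalgebra.comul : H →ₗ[ℂ] H ⊗[ℂ] H))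
    (x : V ⊗[ℂ] H) : coact V H (TensorProduct.map RV RH x) =
      TensorProduct.map (TensorProduct.map RV RH) RH (coact V H x) := by
  induction x using TensorProduct.induction_on with
  | zero => simp
  | add x y hx hy => simp only [map_add, hx, hy]
  | tmul v h =>
    rw [TensorProduct.map_tmul, coact_tmul, coact_tmul, ← LinearMap.comp_apply, hΔ,
      LinearMap.comp_apply]
    generalize Coalgebra.comul (R := ℂ) h = t
    induction t using TensorProduct.induction_on with
    | zero => simp
    | add s t hs ht => simp only [map_add, TensorProduct.tmul_add, hs, ht]
    | tmul l r => rfl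

theorem smash_conj {RV : V →ₗ[ℂ] V} {RH : H →ₗ[ℂ] H} {c : ℂˣ}
    (hV : ∀ u v, mapL RV (AV.Y u v) = scale c (AV.Y (RV u) (RV v)))
    (hH : ∀ h k, mapL RH (AH.Y h k) = scale c (AH.Y (RH h) (RH k)))
    (hR : ∀ h v, mapL RV (toOp D h v) = scale c (toOp D (RH h) (RV v)))
    (hΔ : Coalgebra.comul ∘ₗ RH = TensorProduct.map RH RH ∘ₗ (Coalgebra.comul : H →ₗ[ℂ] H ⊗[ℂ] H))
    (x y : V ⊗[ℂ] H) : mapL (TensorProduct.map RV RH) ((smash AV AH D).Y x y) =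
      scale c ((smash AV AH D).Y (TensorProduct.map RV RH x) (TensorProduct.map RV RH y)) := by
  rw [smash_eq_comp, LinearMap.comp_apply, LinearMap.comp_apply, coact_map hΔ]
  generalize coact V H x = z
  induction z using TensorProduct.induction_on with
  | zero => simp
  | add x x' hx hx' => simp only [map_add, LinearMap.add_apply, hx, hx']
  | tmul a r =>
    induction y using TensorProduct.induction_on with
    | zero => simp
    | add x x' hx hx' => simp only [map_add, hx, hx']
    | tmul v k =>
      induction a using TensorProduct.induction_on with
      | zero => simp
      | add x x' hx hx' =>
        simp only [map_add, TensorProduct.add_tmul, LinearMap.add_apply, hx, hx']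
      | tmul u h =>
        rw [TensorProduct.map_tmul, TensorProduct.map_tmul, TensorProduct.map_tmul, tensorOp_tmul,
          tensorOp_tmul, scale_conv, ← compOp_conj hV hR, ← hH, mapL_conv, conv_mapL_left,
          conv_mapL_right]
        rfl

end Structure

/-! ### Clearing denominators in commutation relations -/

section Kernel

/-! ### Maps applied to the scalar factor of (V ⊗ S) ⊗ H -/

section Mid

variable {H V S S' S'' : Type*} [AddCommGroup H] [Module ℂ H] [AddCommGroup V] [Module ℂ V]
  [AddCommMonoid S] [Module ℂ S] [AddCommMonoid S'] [Module ℂ S']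
  [AddCommMonoid S''] [Module ℂ S'']

/-- The map `(v ⊗ s) ⊗ h ↦ (v ⊗ f(s)) ⊗ h`. -/
def mid (V H : Type*) [AddCommGroup H] [Module ℂ H] [AddCommGroup V] [Module ℂ V] (f : S →ₗ[ℂ] S') :
    (V ⊗[ℂ] S) ⊗[ℂ] H →ₗ[ℂ] (V ⊗[ℂ] S') ⊗[ℂ] H :=
  LinearMap.rTensor H (LinearMap.lTensor V f)

theorem mid_tmul (f : S →ₗ[ℂ] S') (v : V) (s : S) (h : H) :
    mid V H f ((v ⊗ₜ s) ⊗ₜ h) = (v ⊗ₜ f s) ⊗ₜ h := rfl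

theorem mid_comp (g : S' →ₗ[ℂ] S'') (f : S →ₗ[ℂ] S') (X : (V ⊗[ℂ] S) ⊗[ℂ] H) :
    mid V H (g ∘ₗ f) X = mid V H g (mid V H f X) := by
  rw [mid, LinearMap.lTensor_comp, LinearMap.rTensor_comp]
  rfl

/-- Induction over the elements of `(V ⊗ S) ⊗ H`. -/
theorem mid_induction {P : (V ⊗[ℂ] S) ⊗[ℂ] H → Prop} (zero : P 0)
    (tmul : ∀ v s h, P ((v ⊗ₜ s) ⊗ₜ h)) (add : ∀ x y, P x → P y → P (x + y))
    (X : (V ⊗[ℂ] S) ⊗[ℂ] H) : P X := by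
  induction X using TensorProduct.induction_on with
  | zero => exact zero
  | add x y hx hy => exact add x y hx hy
  | tmul t h =>
    induction t using TensorProduct.induction_on with
    | zero => rw [TensorProduct.zero_tmul]; exact zero
    | add s t hs ht => rw [TensorProduct.add_tmul]; exact add _ _ hs ht
    | tmul v s => exact tmul v s h

end Mid

/-! ### Common denominators -/

section Clear

variable {H V : Type*} [AddCommGroup H] [Module ℂ H] [AddCommGroup V] [Module ℂ V]

/-- Multiplication by `g` on `ℂ((x₁, x₂))`. -/
def mulLau2 (g : Lau2) : Lau2 →ₗ[ℂ] Lau2 where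
  toFun f := g * f
  map_add' := mul_add g
  map_smul' c f := by
    rw [← HahnSeries.C_mul_eq_smul, mul_left_comm, HahnSeries.C_mul_eq_smul, RingHom.id_apply]

/-- Common denominators for the elements of `(V ⊗ S) ⊗ H`. -/
theorem exists_clear {S : Type*} [AddCommMonoid S] [Module ℂ S] {M : Submonoid Lau2} {j : Lau2 →ₗ[ℂ] LL}
    (hj : ∀ f g, j (f * g) = j f * j g) {p : Lau ℂ} {s : S →ₗ[ℂ] LL} {e : S →ₗ[ℂ] Lau ℂ}
    (h : ∀ x, ∃ g ∈ M, ∃ f, j f = j g * s x ∧ substL p f = zMul (substL p g) (e x))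
    (Z : (V ⊗[ℂ] S) ⊗[ℂ] H) : ∃ g ∈ M, ∃ X, mid V H j X =
      mid V H (LinearMap.mulLeft ℂ (j g)) (mid V H s Z) ∧
      mid V H (substL p) X = mid V H (zMul (substL p g)) (mid V H e Z) := by
  -- Enlarging a denominator keeps both the expansion and the substituted value correct; this makes
  -- the addition step possible.
  have hcl : ∀ (X : (V ⊗[ℂ] Lau2) ⊗[ℂ] H) (Z : (V ⊗[ℂ] S) ⊗[ℂ] H) (g g' : Lau2),
      (mid V H j X = mid V H (LinearMap.mulLeft ℂ (j g)) (mid V H s Z) ∧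
      mid V H (substL p) X = mid V H (zMul (substL p g)) (mid V H e Z)) →
      (mid V H j (mid V H (mulLau2 g') X) =
        mid V H (LinearMap.mulLeft ℂ (j (g' * g))) (mid V H s Z) ∧
      mid V H (substL p) (mid V H (mulLau2 g') X) =
        mid V H (zMul (substL p (g' * g))) (mid V H e Z)) := by
    intro X Z g g' ⟨h1, h2⟩
    constructor
    · have h3 : j ∘ₗ mulLau2 g' = LinearMap.mulLeft ℂ (j g') ∘ₗ j :=
        LinearMap.ext fun f => hj g' f
      rw [← mid_comp, h3, mid_comp, h1, ← mid_comp, hj, ← LinearMap.mulLeft_mul]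
    · have h3 : substL p ∘ₗ mulLau2 g' = act (substL p g') ∘ₗ substL p :=
        LinearMap.ext fun f => (substL_mul p g' f).trans (act_mul _ _).symm
      have h4 : zMul (substL p (g' * g)) = act (substL p g') ∘ₗ zMul (substL p g) :=
        LinearMap.ext fun b => by
          simp only [zMul, LinearMap.comp_apply, LinearMap.flip_apply]
          rw [act_act, lau_mul_comm, ← act_act, substL_mul, act_mul (substL p g')]
      rw [← mid_comp, h3, mid_comp, h2, ← mid_comp, ← h4]
  induction Z using mid_induction with
  | zero => exact ⟨1, M.one_mem, 0, by simp, by simp⟩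
  | tmul v x h' =>
    obtain ⟨g, hg, f, hf, hf'⟩ := h x
    refine ⟨g, hg, (v ⊗ₜ f) ⊗ₜ h', ?_, ?_⟩
    · rw [mid_tmul, mid_tmul, mid_tmul, hf]
      rfl
    · rw [mid_tmul, mid_tmul, mid_tmul, hf']
  | add x y hx hy =>
    obtain ⟨g, hg, X, hX⟩ := hx
    obtain ⟨g', hg', X', hX'⟩ := hy
    have h1 := hcl X x g g' hX
    have h2 := hcl X' y g' g hX'
    rw [mul_comm] at h2
    refine ⟨g' * g, M.mul_mem hg' hg, mid V H (mulLau2 g') X +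
      mid V H (mulLau2 g) X', ?_, ?_⟩
    · simp only [map_add, h1.1, h2.1]
    · simp only [map_add, h1.2, h2.2]

end Clear

/-! ### From commutation relations with expanded scalars to the cleared relation -/

variable {H V W S : Type*} [AddCommGroup H] [Module ℂ H] [AddCommGroup V] [Module ℂ V]
  [AddCommGroup W] [Module ℂ W] [AddCommGroup S] [Module ℂ S]

variable (E : H →ₗ[ℂ] W →ₗ[ℂ] W ⊗[ℂ] Lau ℂ) (YW : V →ₗ[ℂ] W →ₗ[ℂ] Lau W)
  (π : LL →ₗ[ℂ] Lau W →ₗ[ℂ] Lau (Lau W)) (ν : Lau ℂ →ₗ[ℂ] LL)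

theorem twistOp_mid {K : S →ₗ[ℂ] Lau ℂ →ₗ[ℂ] LL} {s : S →ₗ[ℂ] LL} (hK : ∀ x a, K x a = s x * ν a)
    (w : W) (Z : (V ⊗[ℂ] S) ⊗[ℂ] H) :
    twistOp YW K π (LinearMap.lTensor _ (E.flip w) Z) =
      twistOp YW ((LinearMap.mul ℂ LL).compl₂ ν) π
        (LinearMap.lTensor _ (E.flip w) (mid V H s Z)) := by
  induction Z using mid_induction with
  | zero => simp
  | add x y hx hy => simp only [map_add, hx, hy]
  | tmul v x h =>
    rw [mid_tmul, LinearMap.lTensor_tmul, LinearMap.lTensor_tmul, LinearMap.flip_apply]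
    induction E h w using TensorProduct.induction_on with
    | zero => simp
    | add s t hs ht => simp only [TensorProduct.tmul_add, map_add, hs, ht]
    | tmul w' a =>
      rw [twistOp_tmul, twistOp_tmul, hK]
      rfl

variable {π} {κ : Lau W →ₗ[ℂ] Lau (Lau W)} (hπ : ∀ F A, π F A = act (toLL.symm F) (κ A))

include hπ in
theorem twistOp_mid_mulLeft (G : LL) (w : W) (Z : (V ⊗[ℂ] LL) ⊗[ℂ] H) :
    twistOp YW ((LinearMap.mul ℂ LL).compl₂ ν) π
        (LinearMap.lTensor _ (E.flip w) (mid V H (LinearMap.mulLeft ℂ G) Z)) =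
      act (toLL.symm G) (twistOp YW ((LinearMap.mul ℂ LL).compl₂ ν) π
        (LinearMap.lTensor _ (E.flip w) Z)) := by
  induction Z using mid_induction with
  | zero => simp
  | add x y hx hy => simp only [map_add, hx, hy]
  | tmul v x h =>
    rw [mid_tmul, LinearMap.lTensor_tmul, LinearMap.lTensor_tmul, LinearMap.flip_apply]
    induction E h w using TensorProduct.induction_on with
    | zero => simp
    | add s t hs ht => simp only [TensorProduct.tmul_add, map_add, hs, ht]
    | tmul w' a =>
      rw [twistOp_tmul, twistOp_tmul, hπ, hπ, act_act, LinearMap.mulLeft_apply]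
      exact congrArg (fun F => act (toLL.symm F) (κ (YW v w'))) (mul_assoc G x (ν a))

variable {ser : Lau (Lau W) →ₗ[ℂ] Ser2 W} {j : Lau2 →ₗ[ℂ] LL}
  (hser : ∀ F B, ser (act (toLL.symm (j F)) B) = fmul F.coeff (ser B))
  (hν : ∀ a A, ser (act (toLL.symm (ν a)) (κ A)) =
    ser₂ (mapL (toLau ∘ₗ (TensorProduct.mk ℂ W (Lau ℂ)).flip a) A))

include hπ hser hν in
theorem ser_twistOp_mid (w : W) (X : (V ⊗[ℂ] Lau2) ⊗[ℂ] H) :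
    ser (twistOp YW ((LinearMap.mul ℂ LL).compl₂ ν) π
        (LinearMap.lTensor _ (E.flip w) (mid V H j X))) =
      ser₂ (mapL toLau (twistT E YW X w)) := by
  induction X using mid_induction with
  | zero => simp
  | add x y hx hy => simp only [map_add, hx, hy, LinearMap.add_apply]
  | tmul v F h =>
    rw [mid_tmul, LinearMap.lTensor_tmul, LinearMap.flip_apply, twistT_tmul, mapL_toLau_actT,
      ser₂_act_expand₂]
    induction E h w using TensorProduct.induction_on with
    | zero =>
      have h0 : fmul F.coeff (0 : Ser2 W) = 0 := funext fun a => by simp [fmul]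
      simp [h0]
    | add s t hs ht =>
      rw [TensorProduct.tmul_add, map_add, map_add, hs, ht, map_add, map_add, ← ser₂_act_expand₂,
        ← ser₂_act_expand₂, ← ser₂_act_expand₂, map_add, map_add]
    | tmul w' a =>
      rw [twistOp_tmul, hπ, prodT_tmul, mapL_mapL, ← hν, ← hser, act_act]
      rfl

include hπ hser hν in
-- One relation is expanded in ℂ((x₁))((x₂)), the other in ℂ((x₂))((x₁)). Once g is multiplied in,
-- all scalars come from ℂ((x₁,x₂)) and the direction of expansion no longer matters; `ser`, `j`,
-- `κ` and `ν` record which direction is in use.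
theorem act_prodL_eq_twistT {h : H} {v : V} {Z : (V ⊗[ℂ] LL) ⊗[ℂ] H}
    (hprod : ∀ w, prodSer (toOp E) YW h v w = ser (twistOp YW ((LinearMap.mul ℂ LL).compl₂ ν) π
      (LinearMap.lTensor _ (E.flip w) Z)))
    {g : Lau2} {X : (V ⊗[ℂ] Lau2) ⊗[ℂ] H} (hX : mid V H j X = mid V H (LinearMap.mulLeft ℂ (j g)) Z)
    (w : W) : act (expand₂ g) (prodL (toOp E) YW h v w) = mapL toLau (twistT E YW X w) := by
  refine ser₂_injective ?_
  rw [ser₂_act_expand₂, ser₂_prodL, hprod, ← hser, ← twistOp_mid_mulLeft E YW ν hπ, ← hX,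
    ser_twistOp_mid E YW ν hπ hser hν]

end Kernel

/-! ### Translations of the conditions on modules -/

section Translate

variable {V W : Type*} [AddCommGroup V] [Module ℂ V] [AddCommGroup W] [Module ℂ W]
  {A : VOps V} {YW : V →ₗ[ℂ] W →ₗ[ℂ] Lau W} {p : Lau ℂ}

theorem ser₁_act_substL_subVar_pow (k : ℕ) (S : Lau (Lau W)) (i m : ℤ) :
    ser₁ (act (substL 1 (subVar ^ k)) S) (i, m) = ser₁ S (i - k, m) := by
  rw [substL_pow, substL_subVar, single_pow_one, ser₁_apply, act_single]
  rfl

theorem IsModule.toAssoc (h : IsModule A YW) :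
    Assoc True 1 (Submonoid.powers subVar) YW A.Y := by
  intro u v
  obtain ⟨k, hk⟩ := h.assoc u v
  refine ⟨subVar ^ k, ⟨k, rfl⟩, fun w => ?_⟩
  obtain ⟨h1, h2⟩ := hk w
  refine ⟨?_, fun _ => funext fun a => ?_⟩
  · rw [ser₂_act_expand₂, ser₂_prodL]
    exact h1
  · rw [ser₂_act_expand₂, ser₂_prodL, phi_one, show a = (a.1, a.2) from rfl,
      ser₁_act_substL_subVar_pow, ser₁_iterL]
    exact h2 a.1 a.2

theorem Assoc.isModule (hv : ∀ w, YW A.vac w = HahnSeries.single 0 w)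
    (h : Assoc True 1 (Submonoid.powers subVar) YW A.Y) : IsModule A YW where
  vacuum := hv
  assoc u v := by
    obtain ⟨_, ⟨k, rfl⟩, hk⟩ := h u v
    refine ⟨k, fun w => ?_⟩
    have h1 := (hk w).isLau2
    have h2 := (hk w).subst_eq trivial
    rw [ser₂_act_expand₂, ser₂_prodL] at h1 h2
    refine ⟨h1, fun i m => ?_⟩
    rw [← ser₁_iterL, ← ser₁_act_substL_subVar_pow, ← phi_one]
    exact congrFun h2 (i, m)

theorem IsPhiQuasiModule.toAssoc (h : IsPhiQuasiModule p A YW) :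
    Assoc True p (nonZeroDivisors Lau2) YW A.Y := by
  intro u v
  obtain ⟨f, hf, hfw⟩ := h.assoc u v
  refine ⟨f, mem_nonZeroDivisors_of_ne_zero hf, fun w => ?_⟩
  obtain ⟨h1, h2⟩ := hfw w
  refine ⟨?_, fun _ => ?_⟩
  · rw [ser₂_act_expand₂, ser₂_prodL]
    exact h1
  · rw [ser₂_act_expand₂, ser₂_prodL, ser₁_act, ser₁_substL, ser₁_iterL]
    exact h2

theorem Assoc.isPhiQuasiModule (hv : ∀ w, YW A.vac w = HahnSeries.single 0 w)
    (h : Assoc True p (nonZeroDivisors Lau2) YW A.Y) : IsPhiQuasiModule p A YW where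
  vacuum := hv
  assoc u v := by
    obtain ⟨f, hf, hfw⟩ := h u v
    refine ⟨f, nonZeroDivisors.ne_zero hf, fun w => ?_⟩
    have h1 := (hfw w).isLau2
    have h2 := (hfw w).subst_eq trivial
    rw [ser₂_act_expand₂, ser₂_prodL] at h1 h2
    refine ⟨h1, h2.trans ?_⟩
    rw [ser₁_act, ser₁_substL, ser₁_iterL]

/-- The monoid of the series `q(x₁ / x₂)`, `q(x) ∈ ℂ_Γ[x]`. -/
def rootSeries (Γ : Subgroup ℂˣ) : Submonoid Lau2 :=
  (rootMonoid Γ).map (Polynomial.eval₂RingHom HahnSeries.C (HahnSeries.single (1, -1) 1))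

/-- With `T` false only membership in W((x₁,x₂)) is asserted, so the product `Y` of the algebra
plays no role. -/
theorem assoc_rootSeries_iff {Γ : Subgroup ℂˣ} {p : Lau ℂ} {Y : V →ₗ[ℂ] V →ₗ[ℂ] Lau V} :
    Assoc False p (rootSeries Γ) YW Y ↔ ∀ u v, ∃ q ∈ rootMonoid Γ, ∀ w,
      IsLau2 (fmul (evalFstDivSnd q).coeff (prodSer YW YW u v w)) := by
  refine forall₂_congr fun u v => ⟨?_, ?_⟩
  · rintro ⟨_, ⟨q, hq, rfl⟩, h⟩
    refine ⟨q, hq, fun w => ?_⟩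
    have h1 := (h w).isLau2
    rw [ser₂_act_expand₂, ser₂_prodL] at h1
    exact h1
  · rintro ⟨q, hq, h⟩
    refine ⟨evalFstDivSnd q, ⟨q, hq, rfl⟩, fun w => ⟨?_, False.elim⟩⟩
    rw [ser₂_act_expand₂, ser₂_prodL]
    exact h w

end Translate

/-! ### The map `π_φ` -/

section PiPhi

variable {p : Lau ℂ}

theorem phiValue_iff {F : Frac2} {e : Lau ℂ} : PhiValue p F e ↔ ∃ f g : Lau2, g ≠ 0 ∧
    F * algebraMap Lau2 Frac2 g = algebraMap Lau2 Frac2 f ∧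
    substL p f = zMul (substL p g) e := by
  refine exists₂_congr fun f g => and_congr_right fun _ => and_congr_right fun _ => ?_
  rw [← ser₁_substL, ← ser₁_substL, ← ser₁_zSer, ← ser₁_act]
  exact ser₁_injective.eq_iff

theorem zMul_mul_left (F G : Lau (Lau ℂ)) (e : Lau ℂ) : zMul (F * G) e = F * zMul G e := by
  simp only [zMul, LinearMap.comp_apply, LinearMap.flip_apply, act_mul]
  exact mul_left_comm (G := LL) (zSer e) F G

/-- The relation F(φ(x,z),x) = e(z) is linear, by common denominators, so it survives passage to the
span. -/
theorem phiValue_of_mem_piGraph {P : Frac2 × Lau ℂ} (hP : P ∈ piGraph p) :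
    PhiValue p P.1 P.2 := by
  induction hP using Submodule.span_induction with
  | mem P h => exact h.2
  | zero => exact phiValue_iff.2 ⟨0, 1, one_ne_zero, by simp, by simp⟩
  | add P Q _ _ hP hQ =>
    obtain ⟨f, g, hg, h1, h2⟩ := phiValue_iff.1 hP
    obtain ⟨f', g', hg', h1', h2'⟩ := phiValue_iff.1 hQ
    refine phiValue_iff.2 ⟨g' * f + g * f', g' * g, mul_ne_zero hg' hg, ?_, ?_⟩
    · rw [Prod.fst_add, map_add, map_mul, map_mul, map_mul, ← h1, ← h1']
      ring
    · rw [Prod.snd_add, map_add, map_add, substL_mul, substL_mul, h2, h2', ← zMul_mul_left,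
        ← zMul_mul_left, ← substL_mul, ← substL_mul, mul_comm g g']
  | smul c P _ hP =>
    obtain ⟨f, g, hg, h1, h2⟩ := phiValue_iff.1 hP
    refine phiValue_iff.2 ⟨c • f, g, hg, ?_, ?_⟩
    · rw [Prod.smul_fst, smul_mul_assoc, h1]
      exact (map_smul fracIncl c f).symm
    · rw [Prod.smul_snd, map_smul, map_smul, h2]

/-- If f/g has value 0, then f(φ,x) = 0, and `substL_injective` gives f = 0. This is the injectivity
of π_φ, without which the chosen left inverse would carry no information. -/
theorem graphSnd_injective (hp : p ≠ 0) : Function.Injective (graphSnd p) := by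
  rw [injective_iff_map_eq_zero]
  rintro ⟨⟨F, e⟩, hP⟩ he
  change e = 0 at he
  subst he
  obtain ⟨f, g, hg, h1, h2⟩ := phiValue_iff.1 (phiValue_of_mem_piGraph hP)
  rw [map_zero, map_eq_zero_iff _ (substL_injective hp)] at h2
  rw [h2, map_zero, mul_eq_zero] at h1
  have hF : F = 0 := h1.resolve_right fun h => hg (by simpa using h)
  exact Subtype.ext (Prod.ext hF rfl)

theorem phiValue_piInv (hp : p ≠ 0) {e : Lau ℂ} (he : e ∈ CphiZ p) :
    PhiValue p (piInv p e) e := by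
  obtain ⟨P, hP, rfl⟩ := he
  have h : LinearMap.leftInverse (graphSnd p) P.2 = (⟨P, hP⟩ : piGraph p) :=
    LinearMap.leftInverse_apply_of_inj (K := ℂ) (V := piGraph p) (V' := Lau ℂ)
      (f := graphSnd p) (LinearMap.ker_eq_bot.2 (graphSnd_injective hp)) ⟨P, hP⟩
  have h' : piInv p P.2 = P.1 := congrArg (fun Q : piGraph p => Q.1.1) h
  change PhiValue p (piInv p P.2) P.2
  rw [h']
  exact phiValue_of_mem_piGraph hP

/-- `expand` as a linear map. -/
def expandL : Lau2 →ₗ[ℂ] LL where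
  toFun := expand
  map_add' := map_add expandHom
  map_smul' _ _ := LL.ext fun _ _ => rfl

/-- `iota` as a linear map. -/
def iotaL : Frac2 →ₗ[ℂ] LL where
  toFun := iota
  map_add' := map_add iota
  map_smul' := iota_smul

theorem iota_algebraMap (f : Lau2) : iota (algebraMap Lau2 Frac2 f) = expandL f :=
  IsFractionRing.lift_algebraMap expandHom_injective f

theorem expandL_mul (f g : Lau2) : expandL (f * g) = expandL f * expandL g := expand_mul f g

theorem exists_clear_piInv (hp : p ≠ 0) (e : CphiZ p) : ∃ g ∈ nonZeroDivisors Lau2, ∃ f,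
    expandL f = expandL g * (iotaL ∘ₗ piInv p ∘ₗ (CphiZ p).subtype) e ∧
      substL p f = zMul (substL p g) ((CphiZ p).subtype e) := by
  obtain ⟨f, g, hg, h1, h2⟩ := phiValue_iff.1 (phiValue_piInv hp e.2)
  refine ⟨g, mem_nonZeroDivisors_of_ne_zero hg, f, ?_, h2⟩
  rw [← iota_algebraMap, ← h1, map_mul, iota_algebraMap, mul_comm]
  rfl

end PiPhi

/-! ### Commutation of the two structures on a quasi module -/

section QuasiTwist

variable {H V W : Type*} [AddCommGroup H] [Module ℂ H] [AddCommGroup V]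
  [Module ℂ V] [AddCommGroup W] [Module ℂ W]

theorem map_comul (D : H →ₗ[ℂ] V) (E : H →ₗ[ℂ] W) (t : H ⊗[ℂ] H) :
    TensorProduct.map D E t = LinearMap.lTensor V E (LinearMap.rTensor H D t) := by
  rw [← LinearMap.comp_apply, LinearMap.lTensor_comp_rTensor]

theorem ser₁_act_expandL (F : Lau2) (B : Lau (Lau W)) :
    ser₁ (act (toLL.symm (expandL F)) B) = fmul F.coeff (ser₁ B) :=
  ser₁_act _ _

theorem ser₁_act_inOuter (a : Lau ℂ) (A : Lau W) : ser₁ (act (toLL.symm (inOuter a)) (constL A)) =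
    ser₂ (mapL (toLau ∘ₗ (TensorProduct.mk ℂ W (Lau ℂ)).flip a) A) := by
  ext ⟨m, n⟩
  have h : act (toLL.symm (inOuter a)) (constL A) = smulL a (constL A) := act_zSer a _
  rw [h, smulL, conv_constL_right]
  exact (toLau_tmul_coeff _ _ _).symm

variable {p : Lau ℂ} {D : H →ₗ[ℂ] V →ₗ[ℂ] V ⊗[ℂ] Lau ℂ} {E : H →ₗ[ℂ] W →ₗ[ℂ] W ⊗[ℂ] Lau ℂ}
  {YW : V →ₗ[ℂ] W →ₗ[ℂ] Lau W}

theorem exists_subtype {S : Submodule ℂ (Lau ℂ)}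
    (h : ∀ h v, D h v ∈ LinearMap.range (LinearMap.lTensor V S.subtype)) (v : V) (t : H ⊗[ℂ] H) :
    ∃ Z, mid V H S.subtype Z = LinearMap.rTensor H (D.flip v) t := by
  induction t using TensorProduct.induction_on with
  | zero => exact ⟨0, by simp⟩
  | add s t hs ht =>
    obtain ⟨Z, hZ⟩ := hs
    obtain ⟨Z', hZ'⟩ := ht
    exact ⟨Z + Z', by rw [map_add, map_add, hZ, hZ']⟩
  | tmul k k' =>
    obtain ⟨z, hz⟩ := h k v
    refine ⟨z ⊗ₜ k', ?_⟩
    rw [mid, LinearMap.rTensor_tmul, hz]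
    rfl

theorem rTensor_hatY (v : V) (t : H ⊗[ℂ] H) : LinearMap.rTensor H ((hatY p D).flip v) t =
    mid V H (piInv p) (LinearMap.rTensor H (D.flip v) t) := by
  rw [mid, ← LinearMap.comp_apply, ← LinearMap.rTensor_comp]
  rfl

theorem exists_evalFstDivSnd {Γ : Subgroup ℂˣ} {q : Polynomial ℂ} (hq : q ∈ rootMonoid Γ) :
    ∃ u : Lau2, u * evalSndDivFst q ∈ rootSeries Γ := by
  induction hq using Submonoid.closure_induction with
  | one =>
    refine ⟨1, ?_⟩
    rw [evalSndDivFst, Polynomial.eval₂_one, one_mul]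
    exact one_mem _
  | mul q q' _ _ hq hq' =>
    obtain ⟨u, hu⟩ := hq
    obtain ⟨u', hu'⟩ := hq'
    refine ⟨u * u', ?_⟩
    have : u * u' * evalSndDivFst (q * q') = u * evalSndDivFst q * (u' * evalSndDivFst q') := by
      rw [evalSndDivFst, Polynomial.eval₂_mul, ← evalSndDivFst, ← evalSndDivFst]
      ring
    rw [this]
    exact mul_mem hu hu'
  | mem q hq =>
    obtain ⟨γ, hγ, rfl⟩ := hq
    -- From -γ⁻¹ (x₁/x₂)(x₂/x₁ - γ) = x₁/x₂ - γ⁻¹; the new root is in Γ because Γ is a group.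
    refine ⟨HahnSeries.C (-(γ : ℂ)⁻¹) * HahnSeries.single (1, -1) 1, Polynomial.X -
      Polynomial.C ((γ⁻¹ : ℂˣ) : ℂ), Submonoid.subset_closure ⟨γ⁻¹, inv_mem hγ, rfl⟩, ?_⟩
    have h1 : (HahnSeries.single (1, -1) 1 : Lau2) * HahnSeries.single (-1, 1) 1 = 1 := by
      rw [HahnSeries.single_mul_single, mul_one]
      rfl
    have h2 : (HahnSeries.C (γ : ℂ)⁻¹ : Lau2) * HahnSeries.C (γ : ℂ) = 1 := by
      rw [← map_mul, inv_mul_cancel₀ γ.ne_zero, map_one]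
    rw [evalSndDivFst, Polynomial.coe_eval₂RingHom, Polynomial.eval₂_sub, Polynomial.eval₂_sub,
      Polynomial.eval₂_X, Polynomial.eval₂_X, Polynomial.eval₂_C, Polynomial.eval₂_C,
      Units.val_inv_eq_inv_val, map_neg]
    linear_combination (-(HahnSeries.single (1, -1) 1 : Lau2)) * h2 +
      (HahnSeries.C (γ : ℂ)⁻¹ : Lau2) * h1

/-- Denominators q(x₂/x₁) become members of `rootSeries` after multiplication by a suitable series,
and the finitely many terms of Δ(h) share a common one. -/
theorem exists_fracIncl {Γ : Subgroup ℂˣ} (hq : ∀ h v, ∃ q ∈ rootMonoid Γ,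
      LinearMap.lTensor V (LinearMap.mulLeft ℂ (algebraMap Lau2 Frac2 (evalSndDivFst q)))
        (hatY p D h v) ∈ LinearMap.range (LinearMap.lTensor V fracIncl)) (v : V) (t : H ⊗[ℂ] H) :
    ∃ g ∈ rootSeries Γ, ∃ X, mid V H fracIncl X =
      mid V H (LinearMap.mulLeft ℂ (algebraMap Lau2 Frac2 g))
        (LinearMap.rTensor H ((hatY p D).flip v) t) := by
  have hcl : ∀ (u g : Lau2) (X : (V ⊗[ℂ] Lau2) ⊗[ℂ] H) (Z : (V ⊗[ℂ] Frac2) ⊗[ℂ] H),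
      mid V H fracIncl X = mid V H (LinearMap.mulLeft ℂ (algebraMap Lau2 Frac2 g)) Z →
      mid V H fracIncl (mid V H (mulLau2 u) X) =
        mid V H (LinearMap.mulLeft ℂ (algebraMap Lau2 Frac2 (u * g))) Z := by
    intro u g X Z hX
    have h : fracIncl ∘ₗ mulLau2 u = LinearMap.mulLeft ℂ (algebraMap Lau2 Frac2 u) ∘ₗ fracIncl :=
      LinearMap.ext fun f => map_mul (algebraMap Lau2 Frac2) u f
    rw [← mid_comp, h, mid_comp, hX, ← mid_comp, ← LinearMap.mulLeft_mul, ← map_mul]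
  induction t using TensorProduct.induction_on with
  | zero => exact ⟨1, one_mem _, 0, by simp⟩
  | add s t hs ht =>
    obtain ⟨g, hg, X, hX⟩ := hs
    obtain ⟨g', hg', X', hX'⟩ := ht
    refine ⟨g' * g, mul_mem hg' hg, mid V H (mulLau2 g') X + mid V H (mulLau2 g) X', ?_⟩
    have h' := hcl g g' X' _ hX'
    rw [mul_comm] at h'
    simp only [map_add, hcl g' g X _ hX, h']
  | tmul k k' =>
    obtain ⟨q, hq, x, hx⟩ := hq k v
    obtain ⟨u, hu⟩ := exists_evalFstDivSnd hq
    refine ⟨_, hu, mid V H (mulLau2 u) (x ⊗ₜ k'), hcl _ _ _ _ ?_⟩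
    rw [mid, LinearMap.rTensor_tmul, hx]
    rfl

variable [Coalgebra ℂ H] (hact : ∀ h v w, ∀ m n : ℤ, prodSer (toOp E) YW h v w (m, n) =
    ((twistOp YW iotaKernel mulInner (TensorProduct.map ((hatY p D).flip v) (E.flip w)
        (Coalgebra.comul (R := ℂ) h))).coeff m).coeff n)

include hact in
theorem act_prodL_of_expandL {h : H} {v : V} {g : Lau2} {X : (V ⊗[ℂ] Lau2) ⊗[ℂ] H}
    (hX : mid V H expandL X = mid V H (LinearMap.mulLeft ℂ (expandL g)) (mid V H iotaL
      (LinearMap.rTensor H ((hatY p D).flip v) (Coalgebra.comul (R := ℂ) h)))) (w : W) :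
    act (expand₂ g) (prodL (toOp E) YW h v w) = mapL toLau (twistT E YW X w) := by
  refine act_prodL_eq_twistT E YW inOuter (π := mulInner) (κ := constL) (fun F A => rfl)
    ser₁_act_expandL ser₁_act_inOuter (fun w => ?_) hX w
  rw [← twistOp_mid E YW mulInner inOuter (K := iotaKernel) (s := iotaL) (fun x a => rfl),
    ← map_comul]
  exact funext fun a => hact h v w a.1 a.2

include hact in
-- Each value of `D` has coefficients in ℂ_φ((z)); a fraction f/g representing π_φ⁻¹ of such a
-- coefficient supplies both the denominator g and the correct value of f under x₁ = φ(x,z).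
theorem twist_nonZeroDivisors (hp : p ≠ 0)
    (hD : ∀ h v, D h v ∈ LinearMap.range (LinearMap.lTensor V (CphiZ p).subtype)) :
    Twist E YW D True p (nonZeroDivisors Lau2) := by
  intro h v
  obtain ⟨Z, hZ⟩ := exists_subtype hD v (Coalgebra.comul (R := ℂ) h)
  obtain ⟨g, hg, X, h1, h2⟩ := exists_clear expandL_mul (exists_clear_piInv hp) Z
  rw [hZ] at h2
  refine ⟨g, hg, X, fun _ => h2, act_prodL_of_expandL hact ?_⟩
  rw [h1, mid_comp, mid_comp, hZ, rTensor_hatY]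

include hact in
theorem twist_rootSeries {Γ : Subgroup ℂˣ} (hq : ∀ h v, ∃ q ∈ rootMonoid Γ,
      LinearMap.lTensor V (LinearMap.mulLeft ℂ (algebraMap Lau2 Frac2 (evalSndDivFst q)))
        (hatY p D h v) ∈ LinearMap.range (LinearMap.lTensor V fracIncl)) :
    Twist E YW D False p (rootSeries Γ) := by
  intro h v
  obtain ⟨g, hg, X, hX⟩ := exists_fracIncl hq v (Coalgebra.comul (R := ℂ) h)
  refine ⟨g, hg, X, False.elim, act_prodL_of_expandL hact ?_⟩
  have h1 : expandL = iotaL ∘ₗ fracIncl := LinearMap.ext fun f => (iota_algebraMap f).symm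
  have h2 : iotaL ∘ₗ LinearMap.mulLeft ℂ (algebraMap Lau2 Frac2 g) =
      LinearMap.mulLeft ℂ (expandL g) ∘ₗ iotaL := LinearMap.ext fun F =>
    (map_mul iota _ F).trans (congrArg (fun a => a * iota F) (iota_algebraMap g))
  conv_lhs => rw [h1]
  rw [mid_comp, hX, ← mid_comp, h2, mid_comp]

end QuasiTwist

/-! ### The substitution `x₁ = x₂ + z` and the expansion of `f(x₁ - x₂)` -/

section Shift

theorem subShift_coeff (F : Lau ℂ) (n m : ℤ) : (subShift F).coeff n m =
    if n < 0 then 0 else (-1) ^ n.toNat * ((Ring.choose (m + n) n.toNat : ℤ) * F.coeff (m + n)) := by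
  change ((HahnSeries.ofPowerSeries ℤ (Lau ℂ) (PowerSeries.mk fun k =>
    ((-1 : ℂ) ^ k) • LaurentSeries.hasseDeriv ℂ k F)).coeff n).coeff m = _
  rcases lt_or_ge n 0 with hn | hn
  · rw [if_pos hn, PowerSeries.coeff_coe, if_pos hn]
    rfl
  · obtain ⟨n, rfl⟩ := Int.eq_ofNat_of_zero_le hn
    rw [if_neg (by lia), HahnSeries.ofPowerSeries_apply_coeff, PowerSeries.coeff_mk]
    simp [LaurentSeries.hasseDeriv_coeff]

theorem subShift_mul (F G : Lau ℂ) : subShift (F * G) = subShift F * subShift G := by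
  simp only [subShift_eq_expHom, map_mul]

theorem subShift_single_one : subShift (HahnSeries.single 1 1) = toLL (expand₂ subVar) := by
  refine LL.ext fun n m => ?_
  rw [subShift_coeff]
  refine Eq.trans ?_ (congrFun (ser₂_expand₂ subVar) (m, n)).symm
  rw [subVar, HahnSeries.coeff_sub, HahnSeries.coeff_single, HahnSeries.coeff_single,
    HahnSeries.coeff_single]
  rcases lt_or_ge n 0 with hn | hn
  · simp [hn, Prod.ext_iff, hn.ne, show n ≠ 1 by lia]
  · obtain ⟨n, rfl⟩ := Int.eq_ofNat_of_zero_le hn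
    rw [if_neg (by lia)]
    rcases n with _ | _ | n
    · simp [Prod.ext_iff]
    · by_cases hm : m = 0 <;> simp [Prod.ext_iff, hm]
    · have h1 : ¬ ((m, ((n + 1 + 1 : ℕ) : ℤ)) = (1, 0)) := fun h => by
        have := congrArg Prod.snd h
        simp only at this
        lia
      have h2 : ¬ ((m, ((n + 1 + 1 : ℕ) : ℤ)) = (0, 1)) := fun h => by
        have := congrArg Prod.snd h
        simp only at this
        lia
      rw [if_neg h1, if_neg h2, sub_zero]
      split_ifs with h
      · rw [h, Int.toNat_natCast, show (1 : ℤ) = ((1 : ℕ) : ℤ) from rfl, Ring.choose_natCast,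
          Nat.choose_eq_zero_of_lt (by lia)]
        simp
      · simp

theorem subShift_single_pow (N : ℕ) :
    subShift (HahnSeries.single (N : ℤ) 1) = toLL (expand₂ (subVar ^ N)) := by
  have h : (HahnSeries.single (N : ℤ) 1 : Lau ℂ) = HahnSeries.single 1 1 ^ N := by simp
  induction N with
  | zero =>
    rw [pow_zero, expand₂_one, h, pow_zero, subShift_eq_expHom, map_one]
    rfl
  | succ N ih =>
    rw [h, pow_succ, subShift_mul, pow_succ, expand₂_mul, subShift_single_one]
    have h' : (HahnSeries.single (N : ℤ) 1 : Lau ℂ) = HahnSeries.single 1 1 ^ N := by simp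
    rw [← h', ih h']
    rfl

/-- Homogeneity: (x + z)ᵐ has total degree m. Substitutions with p = 1 can therefore be compared
degree by degree. -/
theorem phi_one_zpow_coeff {m k n : ℤ} (h : (phi 1 ^ m).coeff k n ≠ 0) : n + k = m := by
  have hk : 0 ≤ k := by
    by_contra hk
    exact h (phi_zpow_coeff_neg _ _ (not_le.1 hk) _)
  obtain ⟨k, rfl⟩ := Int.eq_ofNat_of_zero_le hk
  have h1 : ⇑(vecField 1) = ⇑(LaurentSeries.derivative ℂ) :=
    funext fun f => by rw [vecField_apply, one_mul]
  rw [phi_zpow_coeff_nat, h1, LaurentSeries.derivative_iterate, HahnSeries.coeff_smul,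
    LaurentSeries.hasseDeriv_coeff] at h
  by_contra hm
  exact h (by rw [HahnSeries.coeff_single_of_ne hm]; simp)

theorem zSer_mul (a b : Lau ℂ) : zSer (a * b) = zSer a * zSer b := by
  rw [← act_mul, act_zSer, zSer, ← mapL_smulL, smulL_eq_mul]

theorem zSer_single (k : ℤ) : zSer (HahnSeries.single k 1) = HahnSeries.single k 1 := by
  refine HahnSeries.ext (funext fun n => ?_)
  rw [zSer, mapL_coeff]
  by_cases h : n = k
  · subst h
    simp only [HahnSeries.coeff_single_same]
    rfl
  · rw [HahnSeries.coeff_single_of_ne h, HahnSeries.coeff_single_of_ne h, map_zero]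

/-- For `F(x) ∈ ℂ[[x]]`, the series `F(x₁ - x₂)`. -/
theorem exists_subShift {F : Lau ℂ} (hF : ∀ n < 0, F.coeff n = 0) :
    ∃ f, toLL (expand₂ f) = subShift F ∧ substL 1 f = zSer F := by
  have hN : ∀ d : ℤ × ℤ, (subShift F).coeff d.2 d.1 ≠ 0 → 0 ≤ d.1 ∧ 0 ≤ d.2 := by
    rintro ⟨m, n⟩ h
    simp only at h ⊢
    rw [subShift_coeff] at h
    have hn : 0 ≤ n := by
      by_contra hn
      exact h (if_pos (not_le.1 hn))
    rw [if_neg (not_lt.2 hn)] at h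
    have h1 : 0 ≤ m + n := by
      by_contra h1
      exact h (by rw [hF _ (not_le.1 h1)]; simp)
    refine ⟨?_, hn⟩
    by_contra hm
    refine h ?_
    -- If m < 0 ≤ m + n, the binomial coefficient of m + n over n has its lower entry larger than
    -- its nonnegative upper one, hence vanishes.
    obtain ⟨N, hN⟩ := Int.eq_ofNat_of_zero_le h1
    rw [hN, Ring.choose_natCast, Nat.choose_eq_zero_of_lt (by lia)]
    simp
  let f : Lau2 := ⟨fun d => (subShift F).coeff d.2 d.1, (isPWO_iff_boundedBelow _).2 ⟨0, hN⟩⟩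
  have hf : ∀ d, f.coeff d = (subShift F).coeff d.2 d.1 := fun d => rfl
  refine ⟨f, LL.ext fun n m => congrFun (ser₂_expand₂ f) (m, n),
    ser₁_injective (funext fun ⟨k, n⟩ => ?_)⟩
  rw [ser₁_substL, subst_apply, ser₁_zSer, inZ]
  by_cases hkn : n + k < 0
  · rw [finsum_eq_zero_of_forall_eq_zero]
    · split_ifs with h0
      · exact (hF k (by simp only at h0; lia)).symm
      · rfl
    · intro d
      by_contra hd
      have h1 := phi_one_zpow_coeff (left_ne_zero_of_mul hd)
      have h2 := hN d (right_ne_zero_of_mul hd)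
      simp only at h1
      lia
  · obtain ⟨N, hN'⟩ := Int.eq_ofNat_of_zero_le (not_lt.1 hkn)
    -- Only the part of total degree N = n + k contributes, and there F(x₁ - x₂) is the N-th
    -- coefficient of F times (x₁ - x₂)ᴺ, whose value is zᴺ.
    have h1 : ∀ d, substCoeff (phi 1) d (k, n) • f.coeff d =
        F.coeff (n + k) • (substCoeff (phi 1) d (k, n) • (subVar ^ N).coeff d) := by
      intro d
      by_cases hd : substCoeff (phi 1) d (k, n) = 0
      · simp [hd]
      have h2 := phi_one_zpow_coeff hd
      simp only at h2
      have h3 : (subVar ^ N).coeff d = (subShift (HahnSeries.single (N : ℤ) 1)).coeff d.2 d.1 := by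
        rw [subShift_single_pow]
        exact (congrFun (ser₂_expand₂ (subVar ^ N)) d).symm
      rw [hf, h3, subShift_coeff, subShift_coeff, show d.1 + d.2 = n + k by lia, hN']
      split_ifs
      · simp
      · simp only [HahnSeries.coeff_single_same, smul_eq_mul]
        ring
    rw [finsum_congr h1, ← smul_finsum, ← subst_apply, ← ser₁_substL, substL_pow, substL_subVar,
      single_pow_one, ← zSer_single, ser₁_zSer, inZ]
    by_cases hn : n = 0
    · subst hn
      rw [zero_add] at hN'
      simp [hN']
    · simp [hn]

/-- A power of x₁ - x₂ at least the pole order of e turns e(x₁ - x₂) into the shift of a power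
series, to which `exists_subShift` applies. -/
theorem exists_clear_subShift (e : Lau ℂ) : ∃ g ∈ Submonoid.powers subVar, ∃ f,
    toLL (expand₂ f) = toLL (expand₂ g) * subShift e ∧ substL 1 f = zMul (substL 1 g) e := by
  set K := (-e.order).toNat with hK
  obtain ⟨f, h1, h2⟩ := exists_subShift (F := HahnSeries.single (K : ℤ) 1 * e) fun n hn => by
    rw [HahnSeries.coeff_single_mul, one_mul]
    exact HahnSeries.coeff_eq_zero_of_lt_order (by lia)
  refine ⟨subVar ^ K, ⟨K, rfl⟩, f, ?_, ?_⟩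
  · rw [h1, subShift_mul, subShift_single_pow]
  · rw [h2, zSer_mul, zSer_single, substL_pow, substL_subVar, single_pow_one]
    exact (lau_mul_comm _ _).trans (act_mul _ _).symm

end Shift

/-! ### The commutation relation on V for the substitution x₁ = x₂ + z -/

section ModuleTwist

variable {H V : Type*} [AddCommGroup H] [Module ℂ H] [AddCommGroup V] [Module ℂ V]

theorem act_inInner (a : Lau ℂ) (A : Lau V) : act (toLL.symm (inInner a)) (mapL constL A) =
    mapL (toLau ∘ₗ (TensorProduct.mk ℂ V (Lau ℂ)).flip a) A := by
  have h : act (toLL.symm (inInner a)) (mapL constL A) = act (constL a) (mapL constL A) := rfl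
  rw [h, act_constL, mapL_mapL]
  rfl

/-- Here the scalars are the series e(x₁ - x₂), with e a coefficient of D(h₍₁₎,x)u. Under x₁ = x + z
each returns to e(z), which is exactly the value demanded by `Twist`. -/
theorem twist_powers_subVar [Coalgebra ℂ H] {AH : VOps H} {AV : VOps V}
    {D : H →ₗ[ℂ] V →ₗ[ℂ] V ⊗[ℂ] Lau ℂ} (hD : IsModuleNVA AH AV D) :
    Twist D AV.Y D True 1 (Submonoid.powers subVar) := by
  intro h u
  obtain ⟨g, hg, X, h1, h2⟩ := exists_clear (j := toLL.toLinearMap ∘ₗ expand₂) (s := subShift)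
    (e := LinearMap.id) (fun f g => congrArg toLL (expand₂_mul f g)) exists_clear_subShift
    (LinearMap.rTensor H (D.flip u) (Coalgebra.comul (R := ℂ) h))
  refine ⟨g, hg, X, fun _ => ?_, fun w => ?_⟩
  · have h3 : mid V H (LinearMap.id (R := ℂ) (M := Lau ℂ)) = LinearMap.id := by
      rw [mid, LinearMap.lTensor_id, LinearMap.rTensor_id]
    rw [h3] at h2
    exact h2
  · refine act_prodL_eq_twistT D AV.Y inInner (π := mulOuter) (κ := mapL constL) (ser := ser₂)
      (j := toLL.toLinearMap ∘ₗ expand₂) (fun F A => rfl) ser₂_act_expand₂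
      (fun a A => congrArg ser₂ (act_inInner a A)) (fun w => ?_) h1 w
    rw [← twistOp_mid D AV.Y mulOuter inInner (K := subKernel) (s := subShift) (fun x a => rfl),
      ← map_comul]
    exact funext fun a => hD.act_Y h u w a.1 a.2

end ModuleTwist

/-! ### The smash product -/

section Main

variable {G H V W : Type*} [Group G] [AddCommGroup H] [Module ℂ H] [Coalgebra ℂ H]
  [AddCommGroup V] [Module ℂ V] [AddCommGroup W] [Module ℂ W] {χ χφ : G →* ℂˣ} {p : Lau ℂ}
  {AH : VOps H} {RH : Representation ℂ G H} {AV : VOps V} {RV : Representation ℂ G V}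
  {D : H →ₗ[ℂ] V →ₗ[ℂ] V ⊗[ℂ] Lau ℂ}

theorem isNVA_smash (hH : IsNVA AH) (hΔ : IsHom AH (tensorOps AH AH) Coalgebra.comul)
    (hVH : IsModuleNVA AH AV D) : IsNVA (smash AV AH D) where
  isModule := Assoc.isModule
    (smash_vacuum hΔ hVH.isModule.vacuum hVH.isModule_H.vacuum hH.isModule.vacuum)
    (assoc_smash hΔ hVH.isModule.toAssoc hH.isModule.toAssoc hVH.isModule_H.toAssoc
      (twist_powers_subVar hVH))
  creation_neg x := (smash_creation_coeff hVH.act_vac hVH.toIsNVA hH x).1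
  creation_zero x := (smash_creation_coeff hVH.act_vac hVH.toIsNVA hH x).2

theorem isGNVA_smash (hH : IsGBialgebra χ AH RH) (hV : IsGNVA χ AV RV)
    (hVH : IsModuleNVA AH AV D)
    (hR : ∀ g h v, ∀ n : ℤ, RV g ((toOp D h v).coeff n) =
      (χ g : ℂ) ^ n • (toOp D (RH g h) (RV g v)).coeff n) :
    IsGNVA χ (smash AV AH D) (RV.tprod RH) where
  toIsNVA := isNVA_smash hH.toIsNVA hH.comul_hom hVH
  map_vac g := congrArg₂ (fun v h => v ⊗ₜ[ℂ] h) (hV.map_vac g) (hH.map_vac g)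
  conj g := (conj_iff (RV.tprod RH) g (χ g)).2 <| smash_conj
    ((conj_iff RV g (χ g)).1 (hV.conj g)) ((conj_iff RH g (χ g)).1 (hH.conj g))
    (fun h v => HahnSeries.ext (funext fun n => hR g h v n)) (hH.comul_equivariant g)

theorem isEquivPhiQuasiModule_sharp (hp : p ≠ 0) (hVH : IsPhiCompatible p χφ AH AV D)
    {E : H →ₗ[ℂ] W →ₗ[ℂ] W ⊗[ℂ] Lau ℂ} {YW : V →ₗ[ℂ] W →ₗ[ℂ] Lau W}
    (hW : IsEquivPhiQuasiHVModule p χφ AH RH AV RV D E YW) :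
    IsEquivPhiQuasiModule p χφ (smash AV AH D) (RV.tprod RH) (sharp YW E) where
  toIsPhiQuasiModule := Assoc.isPhiQuasiModule
    (compOp_vacuum hW.module_V.vacuum hW.module_H.vacuum)
    (assoc_sharp hW.module_V.toAssoc hW.module_H.toAssoc
      (twist_nonZeroDivisors hW.act_Y hp hVH.mem_CphiZ))
  equivariant g x w n := by
    have hV : ∀ v w, YW (RV g v) w = scale (χφ g)⁻¹ (YW v w) := fun v w => by
      ext n
      rw [hW.module_V.equivariant, scale_coeff, Units.val_inv_eq_inv_val]
    have hH : ∀ h w, toOp E (RH g h) w = scale (χφ g)⁻¹ (toOp E h w) := fun h w => by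
      ext n
      rw [hW.module_H.equivariant, scale_coeff, Units.val_inv_eq_inv_val]
    rw [← Units.val_inv_eq_inv_val, ← scale_coeff]
    exact congrArg (fun f : Lau W => f.coeff n) (sharp_equivariant hV hH x w)
  -- A second run of the same argument with a different supply of denominators: the quasi condition
  -- need not hold with the factor found for associativity.
  quasi := assoc_rootSeries_iff.1 <| assoc_sharp (AV := AV) (AH := AH)
    (assoc_rootSeries_iff.2 hW.module_V.quasi) (assoc_rootSeries_iff.2 hW.module_H.quasi)
    (twist_rootSeries hW.act_Y hVH.quasi)

end Main

end PhiCoord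

end

open scoped TensorProduct in
theorem theorem4p23
    {G : Type*} [Group G]
    {H : Type*} [AddCommGroup H] [Module ℂ H] [Coalgebra ℂ H]
    {V : Type*} [AddCommGroup V] [Module ℂ V]
    {W : Type*} [AddCommGroup W] [Module ℂ W]
    (χ χφ : G →* ℂˣ) (p : PhiCoord.Lau ℂ) (hp : p ≠ 0)
    (hχ : PhiCoord.CharCompatible p χ χφ)
    (AH : PhiCoord.VOps H) (RH : Representation ℂ G H)
    (hH : PhiCoord.IsGBialgebra χ AH RH)
    (AV : PhiCoord.VOps V) (RV : Representation ℂ G V)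
    (hV : PhiCoord.IsGNVA χ AV RV)
    (YVH : H →ₗ[ℂ] V →ₗ[ℂ] V ⊗[ℂ] PhiCoord.Lau ℂ)
    (hVH : PhiCoord.IsPhiCompatible p χφ AH AV YVH)
    (hR : ∀ g h v, ∀ n : ℤ, RV g ((PhiCoord.toOp YVH h v).coeff n) =
      (χ g : ℂ) ^ n • (PhiCoord.toOp YVH (RH g h) (RV g v)).coeff n)
    (YWH : H →ₗ[ℂ] W →ₗ[ℂ] W ⊗[ℂ] PhiCoord.Lau ℂ)
    (YWV : V →ₗ[ℂ] W →ₗ[ℂ] PhiCoord.Lau W)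
    (hW : PhiCoord.IsEquivPhiQuasiHVModule p χφ AH RH AV RV YVH YWH YWV) :
    PhiCoord.IsGNVA χ (PhiCoord.smash AV AH YVH) (RV.tprod RH) ∧
      PhiCoord.IsEquivPhiQuasiModule p χφ (PhiCoord.smash AV AH YVH) (RV.tprod RH)
        (PhiCoord.sharp YWV YWH) :=
  ⟨PhiCoord.isGNVA_smash hH hV hVH.toIsModuleNVA hR,
    PhiCoord.isEquivPhiQuasiModule_sharp hp hVH hW⟩
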